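/- Let $V_7$ be a complex vector space of dimension $7$. For a three-form $\Omega\in\wedge^3V_7^*$ let $CG\subset G(4,V_7)$ be the set of four-dimensional subspaces $A\subset V_7$ with $\Omega|_A=0$ (for general $\Omega$ this is the Cayley Grassmannian). The variety $F_1(G)$ of lines in $G=G(4,V_7)$ is the flag variety $F(3,5,V_7)$, a flag $V_3\subset V_5$ corresponding to the line $\{A : V_3\subset A\subset V_5\}$. Let $F_1(CG)\subset F_1(G)$ be the closed subvariety of lines contained in $CG$. For $A_4\in G$, the lines of $G$ through $[A_4]$ are identified with the points of $\mathbb{P}(A_4^*)\times\mathbb{P}(V_7/A_4)$, the pair $([\xi],\ell)$ giving the flag with $V_3=\ker\xi$ and $V_5$ the preimage of $\ell$. Let $\Omega$ be a general three-form on $V_7$. That is, the assertions below hold for all $\Omega$ in some non-empty Zariski open subset of $\wedge^3V_7^*$, and this subset contains every form which, in the coordinates $v_0,v_\alpha,v_{-\alpha},v_\beta,v_{-\beta},v_\gamma,v_{-\gamma}$ of some basis of $V_7$, is $$v_0\wedge v_{\alpha}\wedge v_{-\alpha}+v_0\wedge v_{\beta}\wedge v_{-\beta}+v_0\wedge v_{\gamma}\wedge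 v_{-\gamma}+v_{\alpha}\wedge v_{\beta}\wedge v_{\gamma}+v_{-\alpha}\wedge v_{-\beta}\wedge v_{-\gamma}.$$ 1. For a general point $[A_4]$ of $CG$, that is, for all points of some non-empty, Zariski open and dense subset of $CG$, the variety of lines in $CG$ through $[A_4]$ is the image of a closed embedding $(f_1,f_2):\mathbb{P}^1\times\mathbb{P}^1\hookrightarrow\mathbb{P}(A_4^*)\times\mathbb{P}(V_7/A_4)$, where $f_1$ is the morphism defined by the complete linear system $|\mathcal{O}(1,1)|$ and $f_2$ the morphism defined by the complete linear system $|\mathcal{O}(2,0)|$. 2. The variety $F_1(CG)$ is irreducible. -/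

import Mathlib

open scoped LinearAlgebra.Projectivization Topology
open Module

namespace CayleyGrassmannian

noncomputable section

/-! ### Polynomial functions and Zariski topologies -/

section Zariski

variable (E F : Type*) [AddCommGroup E] [Module ℂ E] [AddCommGroup F] [Module ℂ F]

/-- The algebra of polynomial functions on a complex vector space: the algebra of functions
generated by the linear forms. -/
def polyFun : Subalgebra ℂ (E → ℂ) :=
  Algebra.adjoin ℂ (Set.range fun ξ : Dual ℂ E => (ξ : E → ℂ))

/-- Homogeneous polynomial functions of degree `d` on `E`. -/
def homForms (d : ℕ) : Submodule ℂ (E → ℂ) where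
  carrier := {P | P ∈ polyFun E ∧ ∀ (a : ℂ) (x : E), P (a • x) = a ^ d * P x}
  add_mem' := by
    rintro P Q ⟨hP, hP'⟩ ⟨hQ, hQ'⟩
    refine ⟨add_mem hP hQ, fun a x => ?_⟩
    simp only [Pi.add_apply, hP', hQ']
    ring
  zero_mem' := ⟨zero_mem _, fun a x => by simp⟩
  smul_mem' := by
    rintro c P ⟨hP, hP'⟩
    refine ⟨Subalgebra.smul_mem _ hP c, fun a x => ?_⟩
    simp only [Pi.smul_apply, hP', smul_eq_mul]
    ring

/-- Bihomogeneous polynomial functions of bidegree `(d, e)` on `E × F`, that is, the space of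
global sections of the line bundle `𝒪(d, e)` on `ℙ(E) × ℙ(F)`. -/
def bihomForms (d e : ℕ) : Submodule ℂ (E × F → ℂ) where
  carrier := {P | P ∈ polyFun (E × F) ∧
    ∀ (a b : ℂ) (x : E) (y : F), P (a • x, b • y) = a ^ d * b ^ e * P (x, y)}
  add_mem' := by
    rintro P Q ⟨hP, hP'⟩ ⟨hQ, hQ'⟩
    refine ⟨add_mem hP hQ, fun a b x y => ?_⟩
    simp only [Pi.add_apply, hP', hQ']
    ring
  zero_mem' := ⟨zero_mem _, fun a b x y => by simp⟩
  smul_mem' := by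
    rintro c P ⟨hP, hP'⟩
    refine ⟨Subalgebra.smul_mem _ hP c, fun a b x y => ?_⟩
    simp only [Pi.smul_apply, hP', smul_eq_mul]
    ring

/-- The Zariski topology of the affine space `E`. -/
@[reducible] def zariskiAffine : TopologicalSpace E :=
  TopologicalSpace.generateFrom {U | ∃ P ∈ polyFun E, U = {x | P x ≠ 0}}

/-- The Zariski topology of `ℙ(E)`. -/
@[reducible] def zariskiProj : TopologicalSpace (ℙ ℂ E) :=
  TopologicalSpace.generateFrom {U | ∃ d, ∃ P ∈ homForms E d, U = {x | P x.rep ≠ 0}}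

/-- The Zariski topology of `ℙ(E) × ℙ(F)` (which is not the product topology). -/
@[reducible] def zariskiBiproj : TopologicalSpace (ℙ ℂ E × ℙ ℂ F) :=
  TopologicalSpace.generateFrom
    {U | ∃ d e, ∃ P ∈ bihomForms E F d e, U = {x | P (x.1.rep, x.2.rep) ≠ 0}}

end Zariski

/-! ### Morphisms between products of two projective spaces -/

section Morphisms

variable {E F G H : Type*} [AddCommGroup E] [Module ℂ E] [AddCommGroup F] [Module ℂ F]
  [AddCommGroup G] [Module ℂ G] [AddCommGroup H] [Module ℂ H]

/-- `g` is a regular map from the subvariety `Z` of `ℙ(E) × ℙ(F)` to `ℙ(G)`: near every point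
of `Z` it is given by bihomogeneous polynomials of the same bidegree without common zero. -/
def IsRegularOn (Z : Set (ℙ ℂ E × ℙ ℂ F)) (g : ℙ ℂ E × ℙ ℂ F → ℙ ℂ G) : Prop :=
  ∀ x ∈ Z, ∃ (d e : ℕ) (P : E × F → G),
    (∀ ξ : Dual ℂ G, (fun z => ξ (P z)) ∈ bihomForms E F d e) ∧
    P (x.1.rep, x.2.rep) ≠ 0 ∧
    ∀ y ∈ Z, ∀ h : P (y.1.rep, y.2.rep) ≠ 0, g y = Projectivization.mk ℂ _ h

/-- `f` is a closed embedding of varieties: a regular map with Zariski closed image that is an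
isomorphism of varieties onto its image. -/
def IsClosedEmbeddingOfVarieties (f : ℙ ℂ E × ℙ ℂ F → ℙ ℂ G × ℙ ℂ H) : Prop :=
  IsRegularOn Set.univ (fun x => (f x).1) ∧ IsRegularOn Set.univ (fun x => (f x).2) ∧
  IsClosed[zariskiBiproj G H] (Set.range f) ∧
  ∃ g : ℙ ℂ G × ℙ ℂ H → ℙ ℂ E × ℙ ℂ F, Function.LeftInverse g f ∧
    IsRegularOn (Set.range f) (fun y => (g y).1) ∧ IsRegularOn (Set.range f) (fun y => (g y).2)

/-- `g` is the morphism `ℙ(E) × ℙ(F) → ℙ(G)` defined by the complete linear system `|𝒪(d, e)|`: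
pulling back linear forms identifies `G^* = H⁰(ℙ(G), 𝒪(1))` with `H⁰(ℙ(E) × ℙ(F), 𝒪(d, e))`. -/
def IsGivenByCompleteLinearSystem (d e : ℕ) (g : ℙ ℂ E × ℙ ℂ F → ℙ ℂ G) : Prop :=
  ∃ σ : Dual ℂ G ≃ₗ[ℂ] bihomForms E F d e,
    ∀ (x : E) (y : F) (hx : x ≠ 0) (hy : y ≠ 0), ∃ (z : G) (hz : z ≠ 0),
      g (Projectivization.mk ℂ x hx, Projectivization.mk ℂ y hy) = Projectivization.mk ℂ z hz ∧
      ∀ ξ : Dual ℂ G, ξ z = (σ ξ : E × F → ℂ) (x, y)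

end Morphisms

/-! ### Grassmannians, the flag variety `F(3, 5, V)` and their Plücker embeddings -/

section Grassmannian

variable (V : Type*) [AddCommGroup V] [Module ℂ V]

/-- The Grassmannian `G(k, V)` of `k`-dimensional subspaces of `V` (for `k ≥ 1`). -/
def Gr (k : ℕ) : Type _ := {A : Submodule ℂ V // finrank ℂ A = k}

/-- The flag variety of flags `V₃ ⊂ V₅ ⊂ V` with `dim V₃ = 3` and `dim V₅ = 5`. It parametrizes
the lines of `G(4, V)`, the flag `(V₃, V₅)` being the line `{A | V₃ ⊂ A ⊂ V₅}`. -/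
def Flag35 : Type _ :=
  {L : Submodule ℂ V × Submodule ℂ V // finrank ℂ L.1 = 3 ∧ finrank ℂ L.2 = 5 ∧ L.1 ≤ L.2}

variable {V}

theorem wedge_ne_zero {k : ℕ} {v : Fin k → V} (hv : LinearIndependent ℂ v) :
    exteriorPower.ιMulti ℂ k v ≠ 0 := by
  intro h0
  let g : V →ₗ[ℂ] (Fin k → ℂ) := (Basis.extend hv.linearIndepOn_id).constr ℂ fun j =>
    Function.extend v (fun i => Pi.single i (1 : ℂ)) 0 j
  have hg : ∀ i, g (v i) = Pi.single i (1 : ℂ) := by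
    intro i
    have hi : v i ∈ hv.linearIndepOn_id.extend (Set.subset_univ _) :=
      Basis.subset_extend hv.linearIndepOn_id ⟨i, rfl⟩
    have h1 := (Basis.extend hv.linearIndepOn_id).constr_basis ℂ
      (fun j => Function.extend v (fun i => (Pi.single i (1 : ℂ) : Fin k → ℂ)) 0 j) ⟨v i, hi⟩
    rw [Basis.extend_apply_self] at h1
    exact h1.trans (hv.injective.extend_apply _ _ _)
  have h1 := congrArg (exteriorPower.alternatingMapLinearEquiv
    ((Matrix.detRowAlternating (R := ℂ) (n := Fin k)).compLinearMap g)) h0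
  rw [exteriorPower.alternatingMapLinearEquiv_apply_ιMulti, map_zero,
    AlternatingMap.compLinearMap_apply] at h1
  have h2 : (fun i => g (v i)) = (1 : Matrix (Fin k) (Fin k) ℂ) := by
    ext i j
    rw [hg, Matrix.one_apply, Pi.single_apply]
    simp only [eq_comm]
  have h3 : Matrix.det (fun i => g (v i)) = 0 := h1
  rw [h2, Matrix.det_one] at h3
  exact one_ne_zero h3

theorem wedge_basis_ne_zero {k : ℕ} (A : Submodule ℂ V) (b : Basis (Fin k) ℂ A) :
    exteriorPower.ιMulti ℂ k (fun i => (b i : V)) ≠ 0 :=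
  wedge_ne_zero (b.linearIndependent.map' A.subtype A.ker_subtype)

/-- A basis of a `k`-dimensional subspace, `k ≥ 1`. -/
def basisOfFinrank {k : ℕ} [NeZero k] (A : Submodule ℂ V) (hA : finrank ℂ A = k) :
    Basis (Fin k) ℂ A :=
  haveI : Module.Finite ℂ A := Module.finite_of_finrank_pos (hA ▸ Nat.pos_of_neZero k)
  Module.finBasisOfFinrankEq ℂ A hA

/-- The Plücker point `[a₁ ∧ ⋯ ∧ aₖ] ∈ ℙ(⋀ᵏ V)` of the subspace with basis `a₁, …, aₖ`; it does
not depend on the basis. -/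
def plucker {k : ℕ} [NeZero k] (A : Submodule ℂ V) (hA : finrank ℂ A = k) :
    ℙ ℂ (⋀[ℂ]^k V) :=
  Projectivization.mk ℂ _ (wedge_basis_ne_zero A (basisOfFinrank A hA))

variable (V) in
/-- The Zariski topology of `G(4, V)` as a subvariety of `ℙ(⋀⁴ V)`. -/
@[reducible] def zariskiGr4 : TopologicalSpace (Gr V 4) :=
  (zariskiProj (⋀[ℂ]^4 V)).induced fun A => plucker A.1 A.2

variable (V) in
/-- The Zariski topology of `F(3, 5, V)` as a subvariety of `ℙ(⋀³ V) × ℙ(⋀⁵ V)`. -/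
@[reducible] def zariskiFlag35 : TopologicalSpace (Flag35 V) :=
  (zariskiBiproj (⋀[ℂ]^3 V) (⋀[ℂ]^5 V)).induced fun L =>
    (plucker L.1.1 L.2.1, plucker L.1.2 L.2.2.1)

/-- The points of `G(4, V)` on the line defined by a flag. -/
def Flag35.points (L : Flag35 V) : Set (Gr V 4) := {A | L.1.1 ≤ A.1 ∧ A.1 ≤ L.1.2}

end Grassmannian

/-! ### The Cayley Grassmannian and its lines -/

section Cayley

variable {V : Type*} [AddCommGroup V] [Module ℂ V]

/-- The three-form `f ∧ g ∧ h`. -/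
def wedge3 (f g h : Dual ℂ V) : V [⋀^Fin 3]→ₗ[ℂ] ℂ :=
  (Matrix.detRowAlternating (R := ℂ) (n := Fin 3)).compLinearMap (LinearMap.pi ![f, g, h])

/-- The three-form `v₀∧vₐ∧v₋ₐ + v₀∧v_b∧v₋b + v₀∧v_c∧v₋c + vₐ∧v_b∧v_c + v₋ₐ∧v₋b∧v₋c`, where
`v₀, vₐ, v₋ₐ, v_b, v₋b, v_c, v₋c` are the coordinates in the basis `e` of `V`, in this order. -/
def normalForm (e : Basis (Fin 7) ℂ V) : V [⋀^Fin 3]→ₗ[ℂ] ℂ :=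
  let v := e.coord
  wedge3 (v 0) (v 1) (v 2) + wedge3 (v 0) (v 3) (v 4) + wedge3 (v 0) (v 5) (v 6) +
    wedge3 (v 1) (v 3) (v 5) + wedge3 (v 2) (v 4) (v 6)

/-- The zero locus in `G(4, V)` of the section of `⋀³ T^*` defined by the three-form `Ω`: the
four-spaces on which `Ω` vanishes. It is the Cayley Grassmannian if `Ω` is general. -/
def CG (Ω : V [⋀^Fin 3]→ₗ[ℂ] ℂ) : Set (Gr V 4) :=
  {A | ∀ x ∈ A.1, ∀ y ∈ A.1, ∀ z ∈ A.1, Ω ![x, y, z] = 0}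

/-- The variety of lines contained in `CG`. -/
def F1CG (Ω : V [⋀^Fin 3]→ₗ[ℂ] ℂ) : Set (Flag35 V) := {L | L.points ⊆ CG Ω}

/-- The lines contained in `CG` that pass through the point `A`. -/
def linesThrough (Ω : V [⋀^Fin 3]→ₗ[ℂ] ℂ) (A : Gr V 4) : Set (Flag35 V) :=
  {L | L ∈ F1CG Ω ∧ A ∈ L.points}

theorem finrank_hyperplane (A : Gr V 4) (ξ : ℙ ℂ (Dual ℂ A.1)) :
    finrank ℂ ((LinearMap.ker ξ.rep).map A.1.subtype) = 3 := by
  have : Module.Finite ℂ A.1 := Module.finite_of_finrank_pos (by rw [A.2]; norm_num)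
  have h1 := Module.Dual.finrank_ker_add_one_of_ne_zero (f := ξ.rep) ξ.rep_nonzero
  rw [A.2] at h1
  have h2 := LinearEquiv.finrank_eq
    (Submodule.equivMapOfInjective A.1.subtype A.1.subtype_injective (LinearMap.ker ξ.rep))
  omega

theorem finrank_comap_mkQ (A : Gr V 4) (ℓ : ℙ ℂ (V ⧸ A.1)) :
    finrank ℂ (ℓ.submodule.comap A.1.mkQ) = 5 := by
  have : Module.Finite ℂ A.1 := Module.finite_of_finrank_pos (by rw [A.2]; norm_num)
  obtain ⟨v, hv⟩ := A.1.mkQ_surjective ℓ.rep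
  have hvA : v ∉ A.1 := fun h => ℓ.rep_nonzero (by
    rw [← hv, Submodule.mkQ_apply, Submodule.Quotient.mk_eq_zero]; exact h)
  have hv0 : v ≠ 0 := by
    rintro rfl
    exact hvA A.1.zero_mem
  have h1 : ℓ.submodule.comap A.1.mkQ = A.1 ⊔ Submodule.span ℂ {v} := by
    rw [ℓ.submodule_eq, ← hv, ← Submodule.comap_map_mkQ, Submodule.map_span, Set.image_singleton]
  have h2 := Submodule.finrank_sup_add_finrank_inf_eq A.1 (Submodule.span ℂ {v})
  have h3 : A.1 ⊓ Submodule.span ℂ {v} = ⊥ := by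
    rw [← disjoint_iff]
    exact (Submodule.disjoint_span_singleton' hv0).2 hvA
  rw [h3, finrank_bot, finrank_span_singleton hv0, A.2] at h2
  rw [h1]
  omega

/-- The identification of `ℙ(A^*) × ℙ(V/A)` with the variety of lines of `G(4, V)` through `A`:
to a linear form `ξ` on `A` and a line `ℓ` in `V/A` it attaches the flag `(V₃, V₅)` with
`V₃ = ker ξ` and `V₅` the preimage of `ℓ` in `V`. -/
def flagThrough (A : Gr V 4) (x : ℙ ℂ (Dual ℂ A.1) × ℙ ℂ (V ⧸ A.1)) : Flag35 V :=
  ⟨((LinearMap.ker x.1.rep).map A.1.subtype, x.2.submodule.comap A.1.mkQ),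
    finrank_hyperplane A x.1, finrank_comap_mkQ A x.2,
    (Submodule.map_subtype_le _ _).trans (Submodule.le_comap_mkQ _ _)⟩

end Cayley

end

end CayleyGrassmannian

open CayleyGrassmannian

open scoped LinearAlgebra.Projectivization Topology
open Module

namespace CayleyGrassmannian

noncomputable section

/-! ### Polynomial functions and polynomial maps -/

section PolynomialMaps

variable {E F G H : Type*} [AddCommGroup E] [Module ℂ E] [AddCommGroup F] [Module ℂ F]
  [AddCommGroup G] [Module ℂ G] [AddCommGroup H] [Module ℂ H]

/-! A general three-form on `V` is `⟨x × y, z⟩` for a cross product of octonionic type, and the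
identity `x × (x × y) = ⟨x, y⟩ x - ⟨x, x⟩ y` controls all the geometry.

The open set of forms. Take the `Ω` for which the infinitesimal action of `gl(V)` on three-forms is
onto at `Ω`. This is an open condition, satisfied by the normal forms
(`infAct_normalForm_surjective`). These forms make up one orbit: by the implicit function theorem
orbits are locally open there, and the complex line joining two such forms meets the set in the
complement of finitely many points, which is connected (`sameOrbit_of_surjective`). So every such
`Ω` is a normal form in some basis and comes from a cross product
(`exists_crossProduct_normalForm`).

Points of `CG`. If `Ω` vanishes on a four-space `A`, then `A^⊥` is spanned by the products of
vectors of `A`. It is closed under the product because `⟨(u × v) × t, w × s⟩` is alternating in five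
vectors of `A`. Hence `A = ⟨x, y, x × y⟩^⊥` for some `x`, `y` (`Null.exists_eq_perp`). Conversely
such an orthogonal lies in `CG` when the Gram determinant of `x`, `y` is nonzero. Thus the points
where the bilinear form is nondegenerate on `A` form a dense open subset of `CG`.

Lines through such a point. Isotropic `p`, `m` in `A^⊥` with `⟨p, m⟩ = -1/2` act on `A` with squares
zero and anticommutator the identity. Hence `A` has the shape `ℂ² ⊗ ℂ²`, with `V/A`, identified with
`A^⊥`, in the role of `Sym² ℂ²`. In adapted bases a pair `(ξ, n)` gives a line of `CG` exactly when
`ξ = s ⊗ t` and `n = s²` up to scalars. This is the graph of a conic over a Segre variety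
(`vanishes_on_ker_iff_isOnImage`, `exists_of_isOnImage`).

Irreducibility. A flag gives a line of `CG` iff the products of `V₃` lie in the plane `V₅^⊥`. Since
`⋀² V₃` is three-dimensional and its elements are decomposable, `V₃` contains independent `a`, `b`
with `a × b = 0`. In general `V₃ = ⟨a, b, d⟩` and `V₅^⊥ = ⟨a × d, b × d⟩`; the remaining lines are
limits of these (`Calibrates.exists_lineData_ne_zero`). The vector `a` is isotropic and `b` is a
polynomial expression in `a` and two free vectors, so the parameters range over open conditions on
the isotropic cone times `V³`, which is irreducible. -/

theorem linear_mem_polyFun (ξ : E →ₗ[ℂ] ℂ) : (fun x => ξ x) ∈ polyFun E :=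
  Algebra.subset_adjoin ⟨ξ, rfl⟩

theorem const_mem_polyFun (c : ℂ) : (fun _ : E => c) ∈ polyFun E :=
  (polyFun E).algebraMap_mem c

theorem polyFun_sum {ι : Type*} (s : Finset ι) {P : ι → E → ℂ} (h : ∀ i ∈ s, P i ∈ polyFun E) :
    (fun x => ∑ i ∈ s, P i x) ∈ polyFun E := by
  have := (polyFun E).sum_mem h
  convert this using 1
  ext x
  simp

theorem polyFun_prod {ι : Type*} (s : Finset ι) {P : ι → E → ℂ} (h : ∀ i ∈ s, P i ∈ polyFun E) :
    (fun x => ∏ i ∈ s, P i x) ∈ polyFun E := by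
  have := (polyFun E).prod_mem h
  convert this using 1
  ext x
  simp

theorem polyFun_mul {P Q : E → ℂ} (hP : P ∈ polyFun E) (hQ : Q ∈ polyFun E) :
    (fun x => P x * Q x) ∈ polyFun E := mul_mem hP hQ

theorem polyFun_add {P Q : E → ℂ} (hP : P ∈ polyFun E) (hQ : Q ∈ polyFun E) :
    (fun x => P x + Q x) ∈ polyFun E := add_mem hP hQ

theorem polyFun_sub {P Q : E → ℂ} (hP : P ∈ polyFun E) (hQ : Q ∈ polyFun E) :
    (fun x => P x - Q x) ∈ polyFun E := sub_mem hP hQ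

theorem polyFun_det {n : Type*} [Fintype n] [DecidableEq n] {M : E → Matrix n n ℂ}
    (h : ∀ i j, (fun x => M x i j) ∈ polyFun E) : (fun x => (M x).det) ∈ polyFun E := by
  simp only [Matrix.det_apply']
  exact polyFun_sum _ fun σ _ => polyFun_mul (const_mem_polyFun _)
    (polyFun_prod _ fun i _ => h _ _)

theorem polyFun_adjugate {n : Type*} [Fintype n] [DecidableEq n] {M : E → Matrix n n ℂ}
    (h : ∀ i j, (fun x => M x i j) ∈ polyFun E) (i j : n) :
    (fun x => (M x).adjugate i j) ∈ polyFun E := by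
  simp only [Matrix.adjugate_apply]
  refine polyFun_det fun k l => ?_
  by_cases hk : k = j
  · subst hk
    simp only [Matrix.updateRow_self]
    exact const_mem_polyFun _
  · simp only [Matrix.updateRow_ne hk]
    exact h k l

/-- Polynomial maps between complex vector spaces. -/
def IsPolyMap (f : E → F) : Prop := ∀ ξ : Dual ℂ F, (fun x => ξ (f x)) ∈ polyFun E

theorem IsPolyMap.comp_mem {f : E → F} (hf : IsPolyMap f) {P : F → ℂ} (hP : P ∈ polyFun F) :
    (fun x => P (f x)) ∈ polyFun E := by
  induction hP using Algebra.adjoin_induction with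
  | mem P hP =>
    obtain ⟨ξ, rfl⟩ := hP
    exact hf ξ
  | algebraMap c => exact const_mem_polyFun c
  | add P Q _ _ hP hQ => exact polyFun_add hP hQ
  | mul P Q _ _ hP hQ => exact polyFun_mul hP hQ

theorem isPolyMap_linear (f : E →ₗ[ℂ] F) : IsPolyMap f := fun ξ => linear_mem_polyFun (ξ ∘ₗ f)

theorem isPolyMap_id : IsPolyMap (fun x : E => x) := isPolyMap_linear LinearMap.id

theorem isPolyMap_fst : IsPolyMap (fun x : E × F => x.1) := isPolyMap_linear (LinearMap.fst ℂ E F)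

theorem isPolyMap_snd : IsPolyMap (fun x : E × F => x.2) := isPolyMap_linear (LinearMap.snd ℂ E F)

theorem isPolyMap_eval {ι : Type*} (i : ι) : IsPolyMap (fun x : ι → E => x i) :=
  isPolyMap_linear (LinearMap.proj (R := ℂ) (φ := fun _ : ι => E) i)

theorem isPolyMap_const (c : F) : IsPolyMap (fun _ : E => c) := fun ξ => const_mem_polyFun (ξ c)

theorem isPolyMap_of_mem {P : E → ℂ} (hP : P ∈ polyFun E) : IsPolyMap P := fun ξ => by
  have h : (fun x => ξ (P x)) = fun x => P x * ξ 1 := by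
    ext x
    rw [← smul_eq_mul, ← map_smul, smul_eq_mul, mul_one]
  rw [h]
  exact polyFun_mul hP (const_mem_polyFun _)

theorem IsPolyMap.mem {P : E → ℂ} (hP : IsPolyMap P) : P ∈ polyFun E := hP LinearMap.id

theorem IsPolyMap.comp {f : F → G} (hf : IsPolyMap f) {g : E → F} (hg : IsPolyMap g) :
    IsPolyMap (fun x => f (g x)) := fun ξ => hg.comp_mem (hf ξ)

theorem IsPolyMap.add {f g : E → F} (hf : IsPolyMap f) (hg : IsPolyMap g) :
    IsPolyMap (fun x => f x + g x) := fun ξ => by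
  simp only [map_add]
  exact polyFun_add (hf ξ) (hg ξ)

theorem IsPolyMap.sub {f g : E → F} (hf : IsPolyMap f) (hg : IsPolyMap g) :
    IsPolyMap (fun x => f x - g x) := fun ξ => by
  simp only [map_sub]
  exact polyFun_sub (hf ξ) (hg ξ)

theorem IsPolyMap.smul {c : E → ℂ} {f : E → F} (hc : IsPolyMap c) (hf : IsPolyMap f) :
    IsPolyMap (fun x => c x • f x) := fun ξ => by
  simp only [map_smul, smul_eq_mul]
  exact polyFun_mul hc.mem (hf ξ)

theorem IsPolyMap.sum {ι : Type*} (s : Finset ι) {f : ι → E → F}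
    (hf : ∀ i ∈ s, IsPolyMap (f i)) : IsPolyMap (fun x => ∑ i ∈ s, f i x) := fun ξ => by
  simp only [map_sum]
  exact polyFun_sum s fun i hi => hf i hi ξ

theorem IsPolyMap.prodMk {f : E → F} {g : E → G} (hf : IsPolyMap f) (hg : IsPolyMap g) :
    IsPolyMap (fun x => (f x, g x)) := fun ξ => by
  have h : (fun x => ξ (f x, g x)) = fun x => (ξ ∘ₗ LinearMap.inl ℂ F G) (f x) +
      (ξ ∘ₗ LinearMap.inr ℂ F G) (g x) := by
    ext x
    simp [← map_add]
  rw [h]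
  exact polyFun_add (hf _) (hg _)

theorem IsPolyMap.pi {ι : Type*} [Fintype ι] [DecidableEq ι] {f : E → ι → F}
    (hf : ∀ i, IsPolyMap fun x => f x i) : IsPolyMap f := fun ξ => by
  have h : (fun x => ξ (f x)) = fun x => ∑ i, (ξ ∘ₗ LinearMap.single ℂ (fun _ => F) i) (f x i) := by
    ext x
    conv_lhs => rw [← LinearMap.sum_single_apply (fun _ : ι => F) (f x)]
    simp [map_sum]
  rw [h]
  exact polyFun_sum _ fun i _ => hf i _

theorem IsPolyMap.multilinear [Module.Finite ℂ F] {m : ℕ}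
    (μ : MultilinearMap ℂ (fun _ : Fin m => F) G) {w : E → Fin m → F} (hw : ∀ i, IsPolyMap fun x => w x i) : IsPolyMap fun x => μ (w x) := by
  let b := finBasis ℂ F
  have h : (fun x => μ (w x)) = fun x => ∑ r : Fin m → Fin (finrank ℂ F),
      (∏ i, b.coord (r i) (w x i)) • μ fun i => b (r i) := by
    ext x
    have h1 : w x = fun i => ∑ j, b.coord j (w x i) • b j := by
      ext i
      exact (b.sum_repr (w x i)).symm
    conv_lhs => rw [h1]
    rw [MultilinearMap.map_sum]
    exact Finset.sum_congr rfl fun r _ => μ.map_smul_univ _ _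
  rw [h]
  refine IsPolyMap.sum _ fun r _ => IsPolyMap.smul (isPolyMap_of_mem ?_) (isPolyMap_const _)
  exact polyFun_prod _ fun i _ => hw i _

theorem IsPolyMap.bilinear [Module.Finite ℂ F] [Module.Finite ℂ G] (μ : F →ₗ[ℂ] G →ₗ[ℂ] H)
    {f : E → F} {g : E → G} (hf : IsPolyMap f) (hg : IsPolyMap g) :
    IsPolyMap fun x => μ (f x) (g x) := by
  let b := finBasis ℂ F
  let b' := finBasis ℂ G
  have h : (fun x => μ (f x) (g x)) = fun x => ∑ i, ∑ j,
      (b.coord i (f x) * b'.coord j (g x)) • μ (b i) (b' j) := by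
    ext x
    conv_lhs => rw [← b.sum_repr (f x), ← b'.sum_repr (g x)]
    simp only [map_sum, LinearMap.sum_apply, map_smul, LinearMap.smul_apply, Finset.smul_sum,
      smul_smul]
    rw [Finset.sum_comm]
    simp [mul_comm]
  rw [h]
  exact IsPolyMap.sum _ fun i _ => IsPolyMap.sum _ fun j _ => IsPolyMap.smul
    (isPolyMap_of_mem (polyFun_mul (hf _) (hg _))) (isPolyMap_const _)

theorem polyFun_exists_polynomial {P : ℂ → ℂ} (hP : P ∈ polyFun ℂ) :
    ∃ p : Polynomial ℂ, ∀ t, P t = p.eval t := by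
  induction hP using Algebra.adjoin_induction with
  | mem P hP =>
    obtain ⟨ξ, rfl⟩ := hP
    refine ⟨Polynomial.C (ξ 1) * Polynomial.X, fun t => ?_⟩
    simp only [Polynomial.eval_mul, Polynomial.eval_C, Polynomial.eval_X]
    rw [mul_comm, ← smul_eq_mul, ← map_smul, smul_eq_mul, mul_one]
  | algebraMap c => exact ⟨Polynomial.C c, fun t => by simp⟩
  | add P Q _ _ hP hQ =>
    obtain ⟨p, hp⟩ := hP
    obtain ⟨q, hq⟩ := hQ
    exact ⟨p + q, fun t => by simp [hp, hq]⟩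
  | mul P Q _ _ hP hQ =>
    obtain ⟨p, hp⟩ := hP
    obtain ⟨q, hq⟩ := hQ
    exact ⟨p * q, fun t => by simp [hp, hq]⟩

theorem polyFun_finite_zeros {P : ℂ → ℂ} (hP : P ∈ polyFun ℂ) {t₀ : ℂ} (h : P t₀ ≠ 0) :
    {t | P t = 0}.Finite := by
  obtain ⟨p, hp⟩ := polyFun_exists_polynomial hP
  have hp0 : p ≠ 0 := by
    rintro rfl
    simp [hp] at h
  refine (p.rootSet_finite ℂ).subset fun t ht => ?_
  rw [Polynomial.mem_rootSet]
  refine ⟨hp0, ?_⟩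
  rw [Polynomial.coe_aeval_eq_eval, ← hp]
  exact ht

theorem isPolyMap_line (x y : E) : IsPolyMap fun t : ℂ => x + t • (y - x) :=
  (isPolyMap_const x).add (isPolyMap_id.smul (isPolyMap_const _))

/-- A subset of a vector space whose Zariski closure is irreducible (or empty). -/
def PolyIrreducible (S : Set E) : Prop :=
  ∀ P ∈ polyFun E, ∀ Q ∈ polyFun E, (∃ x ∈ S, P x ≠ 0) → (∃ x ∈ S, Q x ≠ 0) →
    ∃ x ∈ S, P x ≠ 0 ∧ Q x ≠ 0

/-- Restricted to the line joining the two points, both functions become nonzero polynomials in one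
variable, with finitely many zeros in all. -/
theorem polyIrreducible_univ : PolyIrreducible (Set.univ : Set E) := by
  rintro P hP Q hQ ⟨x, -, hx⟩ ⟨y, -, hy⟩
  have h1 := polyFun_finite_zeros ((isPolyMap_line x y).comp_mem hP) (t₀ := 0) (by simpa using hx)
  have h2 := polyFun_finite_zeros ((isPolyMap_line x y).comp_mem hQ) (t₀ := 1) (by simpa using hy)
  obtain ⟨t, ht⟩ := (h1.union h2).exists_notMem
  simp only [Set.mem_union, Set.mem_ofPred_eq, not_or] at ht
  exact ⟨_, Set.mem_univ _, ht⟩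

theorem polyFun_exists_ne {P Q : E → ℂ} (hP : P ∈ polyFun E) (hQ : Q ∈ polyFun E) {x y : E}
    (hx : P x ≠ 0) (hy : Q y ≠ 0) : ∃ z, P z ≠ 0 ∧ Q z ≠ 0 := by
  obtain ⟨z, -, hz⟩ := polyIrreducible_univ P hP Q hQ ⟨x, trivial, hx⟩ ⟨y, trivial, hy⟩
  exact ⟨z, hz⟩

theorem PolyIrreducible.prod_univ {S : Set E} (hS : PolyIrreducible S) :
    PolyIrreducible {x : E × F | x.1 ∈ S} := by
  rintro P hP Q hQ ⟨x, hxS, hx⟩ ⟨y, hyS, hy⟩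
  obtain ⟨s, hs, hsP, hsQ⟩ := hS _ ((isPolyMap_id.prodMk (isPolyMap_const x.2)).comp_mem hP)
    _ ((isPolyMap_id.prodMk (isPolyMap_const y.2)).comp_mem hQ) ⟨x.1, hxS, hx⟩ ⟨y.1, hyS, hy⟩
  obtain ⟨z, hz⟩ := polyFun_exists_ne (((isPolyMap_const s).prodMk isPolyMap_id).comp_mem hP)
    (((isPolyMap_const s).prodMk isPolyMap_id).comp_mem hQ) hsP hsQ
  exact ⟨(s, z), hs, hz⟩

end PolynomialMaps

/-! ### Bases of the Zariski topologies -/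

section Topologies

variable {E F : Type*} [AddCommGroup E] [Module ℂ E] [AddCommGroup F] [Module ℂ F]

/-- A generating family containing the whole space and stable under finite intersections is a basis;
the Zariski topologies then have basic open sets defined by a single form. -/
theorem exists_basic_of_generateFrom {X : Type*} {S : Set (Set X)} (huniv : Set.univ ∈ S)
    (hinter : ∀ s ∈ S, ∀ t ∈ S, s ∩ t ∈ S) {O : Set X}
    (hO : IsOpen[TopologicalSpace.generateFrom S] O) {x : X} (hx : x ∈ O) :
    ∃ s ∈ S, x ∈ s ∧ s ⊆ O := by
  change TopologicalSpace.GenerateOpen S O at hO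
  induction hO with
  | basic s hs => exact ⟨s, hs, hx, subset_rfl⟩
  | univ => exact ⟨_, huniv, hx, subset_rfl⟩
  | inter s t _ _ hs ht =>
    obtain ⟨s', hs', hxs, hss⟩ := hs hx.1
    obtain ⟨t', ht', hxt, htt⟩ := ht hx.2
    exact ⟨s' ∩ t', hinter _ hs' _ ht', ⟨hxs, hxt⟩, Set.inter_subset_inter hss htt⟩
  | sUnion T _ hT =>
    obtain ⟨t, ht, hxt⟩ := hx
    obtain ⟨s, hs, hxs, hst⟩ := hT t ht hxt
    exact ⟨s, hs, hxs, hst.trans (Set.subset_sUnion_of_mem ht)⟩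

theorem zariskiProj_exists_basic {O : Set (ℙ ℂ E)} (hO : IsOpen[zariskiProj E] O) {x : ℙ ℂ E}
    (hx : x ∈ O) : ∃ d, ∃ P ∈ homForms E d, P x.rep ≠ 0 ∧ ∀ y : ℙ ℂ E, P y.rep ≠ 0 → y ∈ O := by
  obtain ⟨s, ⟨d, P, hP, rfl⟩, hxs, hsO⟩ := exists_basic_of_generateFrom
    (S := {U | ∃ d, ∃ P ∈ homForms E d, U = {x | P x.rep ≠ 0}})
    ⟨0, 1, ⟨one_mem _, fun a x => by simp⟩, by ext; simp⟩ (by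
      rintro _ ⟨d, P, hP, rfl⟩ _ ⟨e, Q, hQ, rfl⟩
      refine ⟨d + e, P * Q, ⟨mul_mem hP.1 hQ.1, fun a x => ?_⟩, ?_⟩
      · simp only [Pi.mul_apply, hP.2, hQ.2]
        ring
      · ext x
        simp) hO hx
  exact ⟨d, P, hP, hxs, fun y hy => hsO hy⟩

theorem zariskiBiproj_exists_basic {O : Set (ℙ ℂ E × ℙ ℂ F)} (hO : IsOpen[zariskiBiproj E F] O)
    {x : ℙ ℂ E × ℙ ℂ F} (hx : x ∈ O) : ∃ d e, ∃ P ∈ bihomForms E F d e,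
      P (x.1.rep, x.2.rep) ≠ 0 ∧ ∀ y : ℙ ℂ E × ℙ ℂ F, P (y.1.rep, y.2.rep) ≠ 0 → y ∈ O := by
  obtain ⟨s, ⟨d, e, P, hP, rfl⟩, hxs, hsO⟩ := exists_basic_of_generateFrom
    (S := {U | ∃ d e, ∃ P ∈ bihomForms E F d e, U = {x | P (x.1.rep, x.2.rep) ≠ 0}})
    ⟨0, 0, 1, ⟨one_mem _, fun a b x y => by simp⟩, by ext; simp⟩ (by
      rintro _ ⟨d, e, P, hP, rfl⟩ _ ⟨d', e', Q, hQ, rfl⟩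
      refine ⟨d + d', e + e', P * Q, ⟨mul_mem hP.1 hQ.1, fun a b x y => ?_⟩, ?_⟩
      · simp only [Pi.mul_apply, hP.2, hQ.2]
        ring
      · ext x
        simp) hO hx
  exact ⟨d, e, P, hP, hxs, fun y hy => hsO hy⟩

theorem homForms_ne_zero_smul {d : ℕ} {P : E → ℂ} (hP : P ∈ homForms E d) {c : ℂ} (hc : c ≠ 0)
    {x : E} : P (c • x) ≠ 0 ↔ P x ≠ 0 := by
  rw [hP.2]
  simp [hc]

theorem bihomForms_ne_zero_smul {d e : ℕ} {P : E × F → ℂ} (hP : P ∈ bihomForms E F d e) {a b : ℂ}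
    (ha : a ≠ 0) (hb : b ≠ 0) {x : E} {y : F} : P (a • x, b • y) ≠ 0 ↔ P (x, y) ≠ 0 := by
  rw [hP.2]
  simp [ha, hb]

end Topologies

/-! ### Plücker coordinates in arbitrary bases -/

section Plucker

variable {V : Type*} [AddCommGroup V] [Module ℂ V]

/-- Both sides are alternating in `w`, so they need only be compared on injective families of basis
vectors, that is, on permutations of `b`. -/
theorem wedge_eq_det_smul {k : ℕ} {A : Submodule ℂ V} (b : Basis (Fin k) ℂ A) (w : Fin k → A) :
    exteriorPower.ιMulti ℂ k (fun i => (w i : V)) =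
      b.det w • exteriorPower.ιMulti ℂ k (fun i => (b i : V)) := by
  have h : (exteriorPower.ιMulti ℂ k).compLinearMap A.subtype =
      (LinearMap.toSpanSingleton ℂ _
        (exteriorPower.ιMulti ℂ k (fun i => (b i : V)))).compAlternatingMap b.det := by
    refine Basis.ext_alternating b fun v hv => ?_
    have hv' : Function.Bijective v := Finite.injective_iff_bijective.1 hv
    let σ : Equiv.Perm (Fin k) := Equiv.ofBijective v hv'
    have h1 : (fun i => b (v i)) = b ∘ σ := rfl
    simp only [AlternatingMap.compLinearMap_apply, LinearMap.compAlternatingMap_apply,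
      LinearMap.toSpanSingleton_apply]
    rw [h1, AlternatingMap.map_perm, b.det_self]
    change exteriorPower.ιMulti ℂ k ((fun i => (b i : V)) ∘ σ) = _
    rw [AlternatingMap.map_perm]
    simp [Units.smul_def, Int.cast_smul_eq_zsmul]
  exact congrArg (fun f => f w) h

theorem plucker_rep {k : ℕ} [NeZero k] (A : Submodule ℂ V) (hA : finrank ℂ A = k) {v : Fin k → V}
    (hv : LinearIndependent ℂ v) (hvA : ∀ i, v i ∈ A) :
    ∃ c : ℂ, c ≠ 0 ∧ (plucker A hA).rep = c • exteriorPower.ιMulti ℂ k v := by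
  obtain ⟨a, ha⟩ := Projectivization.exists_smul_eq_mk_rep ℂ _
    (wedge_basis_ne_zero A (basisOfFinrank A hA))
  have h := wedge_eq_det_smul (basisOfFinrank A hA) fun i => ⟨v i, hvA i⟩
  have h0 : (basisOfFinrank A hA).det (fun i => (⟨v i, hvA i⟩ : A)) ≠ 0 := by
    intro h0
    rw [h0, zero_smul] at h
    exact wedge_ne_zero hv h
  refine ⟨a * ((basisOfFinrank A hA).det (fun i => (⟨v i, hvA i⟩ : A)))⁻¹,
    mul_ne_zero a.ne_zero (inv_ne_zero h0), ?_⟩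
  change _ = _ • exteriorPower.ιMulti ℂ k (fun i => ((⟨v i, hvA i⟩ : A) : V))
  rw [h, smul_smul, mul_assoc, inv_mul_cancel₀ h0, mul_one]
  exact ha.symm

theorem linearIndependent_of_wedge {k : ℕ} {v : Fin k → V}
    {ψ : Dual ℂ (⋀[ℂ]^k V)} (h : ψ (exteriorPower.ιMulti ℂ k v) ≠ 0) : LinearIndependent ℂ v := by
  by_contra hv
  exact h (by rw [AlternatingMap.map_linearDependent _ _ hv, map_zero])

theorem exists_dual_wedge_ne_zero {k : ℕ} {v : Fin k → V} (hv : LinearIndependent ℂ v) :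
    ∃ ψ : Dual ℂ (⋀[ℂ]^k V), ψ (exteriorPower.ιMulti ℂ k v) ≠ 0 := by
  by_contra! h
  exact wedge_ne_zero hv ((Module.forall_dual_apply_eq_zero_iff ℂ _).1 h)

end Plucker

/-! ### Cross products -/

section CrossProduct

/-- A cross product on a complex vector space with a nondegenerate symmetric bilinear form. -/
structure CrossProduct (V : Type*) [AddCommGroup V] [Module ℂ V] where
  /-- The bilinear form. -/
  form : V →ₗ[ℂ] V →ₗ[ℂ] ℂ
  /-- The product. -/
  cross : V →ₗ[ℂ] V →ₗ[ℂ] V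
  symm : ∀ x y, form x y = form y x
  nondeg : ∀ x, (∀ y, form x y = 0) → x = 0
  cross_self : ∀ x, cross x x = 0
  form_cross : ∀ x y z, form (cross x y) z = form x (cross y z)
  cross_cross_self : ∀ x y, cross x (cross x y) = form x y • x - form x x • y

/-- `Ω` is the three-form `⟨x × y, z⟩` of the cross product. -/
def CrossProduct.Calibrates {V : Type*} [AddCommGroup V] [Module ℂ V] (c : CrossProduct V)
    (Ω : V [⋀^Fin 3]→ₗ[ℂ] ℂ) : Prop :=
  ∀ x y z, Ω ![x, y, z] = c.form (c.cross x y) z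

variable {V : Type*} [AddCommGroup V] [Module ℂ V]

theorem normalForm_apply (e : Basis (Fin 7) ℂ V) (x y z : V) :
    normalForm e ![x, y, z] =
      (Matrix.of ![![e.repr x 0, e.repr x 1, e.repr x 2], ![e.repr y 0, e.repr y 1, e.repr y 2],
        ![e.repr z 0, e.repr z 1, e.repr z 2]]).det +
      (Matrix.of ![![e.repr x 0, e.repr x 3, e.repr x 4], ![e.repr y 0, e.repr y 3, e.repr y 4],
        ![e.repr z 0, e.repr z 3, e.repr z 4]]).det +
      (Matrix.of ![![e.repr x 0, e.repr x 5, e.repr x 6], ![e.repr y 0, e.repr y 5, e.repr y 6],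
        ![e.repr z 0, e.repr z 5, e.repr z 6]]).det +
      (Matrix.of ![![e.repr x 1, e.repr x 3, e.repr x 5], ![e.repr y 1, e.repr y 3, e.repr y 5],
        ![e.repr z 1, e.repr z 3, e.repr z 5]]).det +
      (Matrix.of ![![e.repr x 2, e.repr x 4, e.repr x 6], ![e.repr y 2, e.repr y 4, e.repr y 6],
        ![e.repr z 2, e.repr z 4, e.repr z 6]]).det := by
  simp only [normalForm, wedge3, AlternatingMap.add_apply, AlternatingMap.compLinearMap_apply]
  congr 1

/-- The product of two vectors of coordinates in the basis of a normal form, up to a factor. -/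
def normalCross (x y : Fin 7 → ℂ) : Fin 7 → ℂ :=
  ![-(x 1 * y 2 - x 2 * y 1 + (x 3 * y 4 - x 4 * y 3) + (x 5 * y 6 - x 6 * y 5)),
    2 * ((x 0 * y 1 - x 1 * y 0) + (x 4 * y 6 - x 6 * y 4)),
    2 * (-(x 0 * y 2 - x 2 * y 0) + (x 3 * y 5 - x 5 * y 3)),
    2 * ((x 0 * y 3 - x 3 * y 0) - (x 2 * y 6 - x 6 * y 2)),
    2 * (-(x 0 * y 4 - x 4 * y 0) - (x 1 * y 5 - x 5 * y 1)),
    2 * ((x 0 * y 5 - x 5 * y 0) + (x 2 * y 4 - x 4 * y 2)),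
    2 * (-(x 0 * y 6 - x 6 * y 0) + (x 1 * y 3 - x 3 * y 1))]

/-- The quadratic form preserved by a normal form in coordinates, up to a factor. -/
def normalPairing (x y : Fin 7 → ℂ) : ℂ :=
  -2 * (x 0 * y 0) + x 1 * y 2 + x 2 * y 1 + x 3 * y 4 + x 4 * y 3 + x 5 * y 6 + x 6 * y 5

theorem normalCross_normalCross (x y : Fin 7 → ℂ) :
    normalCross x (normalCross x y) =
      (2 * normalPairing x y) • x - (2 * normalPairing x x) • y := by
  ext i
  fin_cases i <;> simp [normalCross, normalPairing] <;> ring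

theorem normalCross_add_left (x x' y : Fin 7 → ℂ) :
    normalCross (x + x') y = normalCross x y + normalCross x' y := by
  ext i
  fin_cases i <;> simp [normalCross] <;> ring

theorem normalCross_smul_left (a : ℂ) (x y : Fin 7 → ℂ) :
    normalCross (a • x) y = a • normalCross x y := by
  ext i
  fin_cases i <;> simp [normalCross] <;> ring

theorem normalCross_swap (x y : Fin 7 → ℂ) : normalCross x y = -normalCross y x := by
  ext i
  fin_cases i <;> simp [normalCross] <;> ring

theorem normalCross_add_right (x y y' : Fin 7 → ℂ) :
    normalCross x (y + y') = normalCross x y + normalCross x y' := by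
  rw [normalCross_swap, normalCross_add_left, normalCross_swap x y, normalCross_swap x y']
  abel

theorem normalCross_smul_right (a : ℂ) (x y : Fin 7 → ℂ) :
    normalCross x (a • y) = a • normalCross x y := by
  rw [normalCross_swap, normalCross_smul_left, normalCross_swap x y, smul_neg]

theorem normalCross_self (x : Fin 7 → ℂ) : normalCross x x = 0 := by
  ext i
  fin_cases i <;> simp [normalCross] <;> ring

theorem normalPairing_smul_left (a : ℂ) (x y : Fin 7 → ℂ) :
    normalPairing (a • x) y = a * normalPairing x y := by
  simp [normalPairing]
  ring

theorem normalPairing_symm (x y : Fin 7 → ℂ) : normalPairing x y = normalPairing y x := by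
  simp only [normalPairing]
  ring

theorem normalPairing_add_left (x x' y : Fin 7 → ℂ) :
    normalPairing (x + x') y = normalPairing x y + normalPairing x' y := by
  simp [normalPairing]
  ring

theorem normalPairing_normalCross (x y z : Fin 7 → ℂ) :
    normalPairing (normalCross x y) z = normalPairing x (normalCross y z) := by
  simp [normalPairing, normalCross]
  ring

theorem normalPairing_nondeg (x : Fin 7 → ℂ)
    (h : ∀ i : Fin 7, normalPairing x (Pi.single i 1) = 0) : x = 0 := by
  have h0 := h 0
  have h1 := h 1
  have h2 := h 2
  have h3 := h 3
  have h4 := h 4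
  have h5 := h 5
  have h6 := h 6
  simp [normalPairing] at h0 h1 h2 h3 h4 h5 h6
  ext i
  fin_cases i <;> simp [*]

theorem normalForm_eq_pairing (e : Basis (Fin 7) ℂ V) (x y z : V) :
    2 * normalForm e ![x, y, z] =
      normalPairing (normalCross (e.equivFun x) (e.equivFun y)) (e.equivFun z) := by
  rw [normalForm_apply]
  simp only [Matrix.det_fin_three, normalPairing, normalCross, Basis.equivFun_apply]
  simp
  ring

theorem exists_crossProduct_normalForm (e : Basis (Fin 7) ℂ V) :
    ∃ c : CrossProduct V, c.Calibrates (normalForm e) := by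
  -- The pairing is scaled by `κ` and the product by `κ²`. The double product formula needs `2 κ⁴ =
  -- κ`, and `normalForm_eq_pairing` needs `2 κ³ = 1` for the three-form: both amount to `κ³ = 1/2`.
  obtain ⟨κ, hκ⟩ := IsAlgClosed.exists_pow_nat_eq (1 / 2 : ℂ) (n := 3) (by norm_num)
  let F : V →ₗ[ℂ] V →ₗ[ℂ] ℂ := LinearMap.mk₂ ℂ
    (fun x y => κ * normalPairing (e.equivFun x) (e.equivFun y))
    (fun x x' y => by rw [map_add, normalPairing_add_left, mul_add])
    (fun a x y => by rw [map_smul, normalPairing_smul_left, smul_eq_mul]; ring)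
    (fun x y y' => by
      rw [map_add, normalPairing_symm, normalPairing_add_left, mul_add,
        normalPairing_symm (e.equivFun x), normalPairing_symm (e.equivFun x)])
    (fun a x y => by
      rw [map_smul, normalPairing_symm, normalPairing_smul_left, smul_eq_mul,
        normalPairing_symm (e.equivFun x)]
      ring)
  let C : V →ₗ[ℂ] V →ₗ[ℂ] V := LinearMap.mk₂ ℂ
    (fun x y => e.equivFun.symm (κ ^ 2 • normalCross (e.equivFun x) (e.equivFun y)))
    (fun x x' y => by rw [map_add, normalCross_add_left, smul_add, map_add])
    (fun a x y => by
      rw [map_smul e.equivFun, normalCross_smul_left, smul_comm, map_smul])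
    (fun x y y' => by rw [map_add, normalCross_add_right, smul_add, map_add])
    (fun a x y => by
      rw [map_smul e.equivFun, normalCross_smul_right, smul_comm, map_smul])
  have hF : ∀ x y, F x y = κ * normalPairing (e.equivFun x) (e.equivFun y) := fun _ _ => rfl
  have hC : ∀ x y, e.equivFun (C x y) = κ ^ 2 • normalCross (e.equivFun x) (e.equivFun y) :=
    fun x y => LinearEquiv.apply_symm_apply _ _
  have hκ0 : κ ≠ 0 := by
    rintro rfl
    norm_num at hκ
  refine ⟨⟨F, C, fun x y => ?_, fun x hx => ?_, fun x => ?_, fun x y z => ?_, fun x y => ?_⟩,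
    fun x y z => ?_⟩
  · rw [hF, hF, normalPairing_symm]
  · apply e.equivFun.injective
    rw [map_zero]
    refine normalPairing_nondeg _ fun i => ?_
    have := hx (e.equivFun.symm (Pi.single i 1))
    rw [hF, LinearEquiv.apply_symm_apply] at this
    exact (mul_eq_zero.1 this).resolve_left hκ0
  · apply e.equivFun.injective
    rw [hC, map_zero, normalCross_self, smul_zero]
  · rw [hF, hF, hC, hC, normalPairing_smul_left, normalPairing_normalCross,
      normalPairing_symm _ (κ ^ 2 • _), normalPairing_smul_left, normalPairing_symm (e.equivFun x)]
  · apply e.equivFun.injective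
    rw [hC, hC, hF, hF, map_sub, map_smul, map_smul, normalCross_smul_right,
      normalCross_normalCross]
    ext i
    simp only [Pi.smul_apply, Pi.sub_apply, smul_eq_mul]
    linear_combination 2 * κ * (normalPairing (e.equivFun x) (e.equivFun y) * e.equivFun x i -
      normalPairing (e.equivFun x) (e.equivFun x) * e.equivFun y i) * hκ
  · change _ = F (C x y) z
    rw [hF, hC, normalPairing_smul_left, ← normalForm_eq_pairing]
    linear_combination -2 * (normalForm e ![x, y, z]) * hκ

namespace CrossProduct

variable (c : CrossProduct V)

theorem cross_swap (x y : V) : c.cross x y = -c.cross y x := by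
  have h := c.cross_self (x + y)
  simp only [map_add, LinearMap.add_apply, c.cross_self, zero_add, add_zero] at h
  exact eq_neg_of_add_eq_zero_right h

/-- Polarization of `cross_cross_self` in its repeated argument. -/
theorem cross_cross_add (a b z : V) : c.cross a (c.cross b z) + c.cross b (c.cross a z) =
    c.form a z • b + c.form b z • a - (2 * c.form a b) • z := by
  have h := c.cross_cross_self (a + b) z
  simp only [map_add, LinearMap.add_apply, c.cross_cross_self, c.symm b a] at h
  linear_combination (norm := module) h

/-- The previous identity with its arguments permuted by antisymmetry. It expresses `(a × b) × z`
through `a × (b × z)` and is the main tool below. -/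
theorem cross_cross_assoc (a b z : V) : c.cross (c.cross a b) z + c.cross a (c.cross b z) =
    (2 * c.form a z) • b - c.form a b • z - c.form b z • a := by
  have h := c.cross_cross_add z a b
  rw [c.cross_swap (c.cross a b) z]
  rw [c.cross_swap z b, map_neg] at h
  rw [c.symm z b, c.symm z a] at h
  linear_combination (norm := module) -h

theorem form_cross_swap (x y z : V) : c.form (c.cross x y) z = -c.form y (c.cross x z) := by
  rw [c.cross_swap, map_neg, LinearMap.neg_apply, c.form_cross]

theorem form_cross_left (x y : V) : c.form (c.cross x y) x = 0 := by
  rw [c.form_cross_swap, c.cross_self, map_zero, neg_zero]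

theorem form_cross_right (x y : V) : c.form (c.cross x y) y = 0 := by
  rw [c.form_cross, c.cross_self, map_zero]

end CrossProduct

end CrossProduct

/-! ### The open orbit of three-forms -/

section ThreeForms

theorem update_vec_zero {V : Type*} (x y z w : V) :
    Function.update ![x, y, z] 0 w = ![w, y, z] := by
  ext i
  fin_cases i <;> rfl

theorem update_vec_one {V : Type*} (x y z w : V) : Function.update ![x, y, z] 1 w = ![x, w, z] := by
  ext i
  fin_cases i <;> rfl

theorem update_vec_two {V : Type*} (x y z w : V) : Function.update ![x, y, z] 2 w = ![x, y, w] := by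
  ext i
  fin_cases i <;> rfl

variable {V : Type*} [AddCommGroup V] [Module ℂ V]

section Trilinear

variable (Ω : V [⋀^Fin 3]→ₗ[ℂ] ℂ)

/-- The trilinear form underlying an alternating three-form. -/
def trilin : V →ₗ[ℂ] V →ₗ[ℂ] V →ₗ[ℂ] ℂ :=
  LinearMap.mk₂ ℂ (fun x y =>
    { toFun := fun z => Ω ![x, y, z]
      map_add' := fun a b => by
        simpa only [update_vec_two] using Ω.map_update_add ![x, y, 0] 2 a b
      map_smul' := fun c a => by
        simpa only [update_vec_two, RingHom.id_apply] using Ω.map_update_smul ![x, y, 0] 2 c a })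
    (fun a b y => LinearMap.ext fun z => by
      have h := Ω.map_update_add ![0, y, z] 0 a b
      simp only [update_vec_zero] at h
      exact h)
    (fun c a y => LinearMap.ext fun z => by
      have h := Ω.map_update_smul ![0, y, z] 0 c a
      simp only [update_vec_zero] at h
      exact h)
    (fun x a b => LinearMap.ext fun z => by
      have h := Ω.map_update_add ![x, 0, z] 1 a b
      simp only [update_vec_one] at h
      exact h)
    (fun c x a => LinearMap.ext fun z => by
      have h := Ω.map_update_smul ![x, 0, z] 1 c a
      simp only [update_vec_one] at h
      exact h)

theorem trilin_apply (x y z : V) : trilin Ω x y z = Ω ![x, y, z] := rfl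

theorem threeForm_swap_left (x y z : V) : Ω ![y, x, z] = -Ω ![x, y, z] := by
  have h := Ω.map_swap ![x, y, z] (i := 0) (j := 1) (by decide)
  rw [← h]
  congr 1
  ext i
  fin_cases i <;> rfl

theorem threeForm_swap_right (x y z : V) : Ω ![x, z, y] = -Ω ![x, y, z] := by
  have h := Ω.map_swap ![x, y, z] (i := 1) (j := 2) (by decide)
  rw [← h]
  congr 1
  ext i
  fin_cases i <;> rfl

theorem threeForm_ext {Ω Ω' : V [⋀^Fin 3]→ₗ[ℂ] ℂ} (h : ∀ x y z, Ω ![x, y, z] = Ω' ![x, y, z]) :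
    Ω = Ω' := by
  ext v
  have hv : v = ![v 0, v 1, v 2] := by
    ext i
    fin_cases i <;> rfl
  rw [hv]
  exact h _ _ _

theorem compLinearMap_vec (X : V →ₗ[ℂ] V) (x y z : V) :
    Ω.compLinearMap X ![x, y, z] = Ω ![X x, X y, X z] := by
  rw [AlternatingMap.compLinearMap_apply]
  congr 1
  ext i
  fin_cases i <;> rfl

/-- The infinitesimal action of an endomorphism on a three-form. -/
def infAct (X : V →ₗ[ℂ] V) : V [⋀^Fin 3]→ₗ[ℂ] ℂ :=
  -- The pullback of `Ω` by `1 + tX` is a cubic polynomial in `t`; its linear coefficient is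
  -- recovered from the values at `1`, `-1`, `2`, `0` with weights `1`, `-1/3`, `-1/6`, `-1/2`. In
  -- this form the result is visibly alternating.
  Ω.compLinearMap (LinearMap.id + X) - (1 / 3 : ℂ) • Ω.compLinearMap (LinearMap.id - X) -
    (1 / 6 : ℂ) • Ω.compLinearMap (LinearMap.id + (2 : ℂ) • X) - (1 / 2 : ℂ) • Ω

theorem infAct_apply (X : V →ₗ[ℂ] V) (x y z : V) :
    infAct Ω X ![x, y, z] = Ω ![X x, y, z] + Ω ![x, X y, z] + Ω ![x, y, X z] := by
  simp only [infAct, AlternatingMap.sub_apply, AlternatingMap.smul_apply, compLinearMap_vec]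
  simp only [← trilin_apply, LinearMap.add_apply, LinearMap.sub_apply, LinearMap.smul_apply,
    LinearMap.id_apply, map_add, map_sub, map_smul, smul_eq_mul]
  ring

/-- The infinitesimal action on three-forms as a bilinear map. -/
def infActHom : (V [⋀^Fin 3]→ₗ[ℂ] ℂ) →ₗ[ℂ] (V →ₗ[ℂ] V) →ₗ[ℂ] (V [⋀^Fin 3]→ₗ[ℂ] ℂ) :=
  LinearMap.mk₂ ℂ infAct
    (fun Ω Ω' X => threeForm_ext fun x y z => by
      simp only [infAct_apply, AlternatingMap.add_apply]
      ring)
    (fun c Ω X => threeForm_ext fun x y z => by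
      simp only [infAct_apply, AlternatingMap.smul_apply, smul_eq_mul]
      ring)
    (fun Ω X Y => threeForm_ext fun x y z => by
      simp only [infAct_apply, AlternatingMap.add_apply]
      simp only [← trilin_apply, LinearMap.add_apply, map_add]
      ring)
    (fun c Ω X => threeForm_ext fun x y z => by
      simp only [infAct_apply, AlternatingMap.smul_apply]
      simp only [← trilin_apply, LinearMap.smul_apply, map_smul, smul_eq_mul]
      ring)

theorem infActHom_apply (X : V →ₗ[ℂ] V) : infActHom Ω X = infAct Ω X := rfl

theorem compLinearMap_one_add_smul (X : V →ₗ[ℂ] V) : ∃ Ω₂ Ω₃ : V [⋀^Fin 3]→ₗ[ℂ] ℂ, ∀ t : ℂ,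
    Ω.compLinearMap (LinearMap.id + t • X) = Ω + t • infAct Ω X + t ^ 2 • Ω₂ + t ^ 3 • Ω₃ := by
  -- The quadratic coefficient is half the second difference at `1`, `0`, `-1`; the cubic one is the
  -- pullback by `X`.
  refine ⟨(1 / 2 : ℂ) • (Ω.compLinearMap (LinearMap.id + X) +
    Ω.compLinearMap (LinearMap.id - X) - (2 : ℂ) • Ω), Ω.compLinearMap X, fun t => ?_⟩
  refine threeForm_ext fun x y z => ?_
  simp only [infAct_apply, AlternatingMap.sub_apply, AlternatingMap.add_apply,
    AlternatingMap.smul_apply, compLinearMap_vec]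
  simp only [← trilin_apply, LinearMap.add_apply, LinearMap.sub_apply, LinearMap.smul_apply,
    LinearMap.id_apply, map_add, map_sub, map_smul, smul_eq_mul]
  ring

theorem wedge3_apply (f g h : Dual ℂ V) (x y z : V) : wedge3 f g h ![x, y, z] =
    f x * (g y * h z - h y * g z) - g x * (f y * h z - h y * f z) +
      h x * (f y * g z - g y * f z) := by
  rw [wedge3, AlternatingMap.compLinearMap_apply]
  change Matrix.det (Matrix.of fun i => LinearMap.pi ![f, g, h] (![x, y, z] i)) = _
  rw [Matrix.det_fin_three]
  simp
  ring

/-- Every basis three-form is counted once for each of the six orderings of its indices, hence the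
factor `6`. -/
theorem sum_smul_wedge3 {n : ℕ} (e : Basis (Fin n) ℂ V) : (6 : ℂ) • Ω = ∑ i, ∑ j, ∑ k,
    Ω ![e i, e j, e k] • wedge3 (e.coord i) (e.coord j) (e.coord k) := by
  refine threeForm_ext fun x y z => ?_
  have key (x y z : V) : Ω ![x, y, z] =
      ∑ i, ∑ j, ∑ k, Ω ![e i, e j, e k] * (e.coord i x * e.coord j y * e.coord k z) := by
    have hlin (f : V →ₗ[ℂ] ℂ) (x : V) : f x = ∑ i, e.coord i x * f (e i) := by
      conv_lhs => rw [← e.sum_repr x]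
      rw [map_sum]
      exact Finset.sum_congr rfl fun i _ => by rw [map_smul, smul_eq_mul, Basis.coord_apply]
    have h1 := hlin ((trilin Ω).flip y |>.flip z) x
    simp only [LinearMap.flip_apply] at h1
    rw [← trilin_apply, h1]
    refine Finset.sum_congr rfl fun i _ => ?_
    have h2 := hlin ((trilin Ω (e i)).flip z) y
    simp only [LinearMap.flip_apply] at h2
    rw [h2, Finset.mul_sum]
    refine Finset.sum_congr rfl fun j _ => ?_
    rw [hlin (trilin Ω (e i) (e j)) z, Finset.mul_sum, Finset.mul_sum]
    refine Finset.sum_congr rfl fun k _ => ?_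
    rw [trilin_apply]
    ring
  have e1 := key x y z
  have e2 := key x z y
  have e3 := key y x z
  have e4 := key y z x
  have e5 := key z x y
  have e6 := key z y x
  have hR : (∑ i, ∑ j, ∑ k,
      Ω ![e i, e j, e k] • wedge3 (e.coord i) (e.coord j) (e.coord k)) ![x, y, z] =
      Ω ![x, y, z] - Ω ![x, z, y] - Ω ![y, x, z] + Ω ![y, z, x] + Ω ![z, x, y] - Ω ![z, y, x] := by
    rw [e1, e2, e3, e4, e5, e6]
    let ev : (V [⋀^Fin 3]→ₗ[ℂ] ℂ) →ₗ[ℂ] ℂ :=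
      { toFun := fun Ω' => Ω' ![x, y, z]
        map_add' := fun _ _ => rfl
        map_smul' := fun _ _ => rfl }
    change ev _ = _
    simp only [map_sum, map_smul, smul_eq_mul]
    simp only [ev, LinearMap.coe_mk, AddHom.coe_mk, wedge3_apply,
      ← Finset.sum_sub_distrib, ← Finset.sum_add_distrib]
    refine Finset.sum_congr rfl fun i _ => Finset.sum_congr rfl fun j _ =>
      Finset.sum_congr rfl fun k _ => ?_
    ring
  rw [hR, AlternatingMap.smul_apply, smul_eq_mul]
  have s1 := threeForm_swap_right Ω x y z
  have s2 := threeForm_swap_left Ω x y z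
  have s3 := threeForm_swap_right Ω y x z
  have s4 := threeForm_swap_left Ω x z y
  have s5 := threeForm_swap_right Ω z x y
  linear_combination s1 + s2 - s3 + s2 - s4 + s1 + s5 - s4 + s1

end Trilinear

theorem infAct_wedge3 (f g h : Dual ℂ V) (X : V →ₗ[ℂ] V) : infAct (wedge3 f g h) X =
    wedge3 (f ∘ₗ X) g h + wedge3 f (g ∘ₗ X) h + wedge3 f g (h ∘ₗ X) := by
  refine threeForm_ext fun x y z => ?_
  simp only [infAct_apply, AlternatingMap.add_apply, wedge3_apply, LinearMap.comp_apply]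
  ring

theorem wedge3_zero_left (g h : Dual ℂ V) : wedge3 0 g h = 0 :=
  threeForm_ext fun x y z => by simp [wedge3_apply]

theorem wedge3_zero_mid (f h : Dual ℂ V) : wedge3 f 0 h = 0 :=
  threeForm_ext fun x y z => by simp [wedge3_apply]

theorem wedge3_zero_right (f g : Dual ℂ V) : wedge3 f g 0 = 0 :=
  threeForm_ext fun x y z => by simp [wedge3_apply]

/-- `T i j k` stands for the value on a basis three-form of a functional that kills the tangent
space to the orbit of the normal form. The relation `h i` at `j` comes from the endomorphism sending
`e j` to `e i` and the other basis vectors to zero. -/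
theorem eq_zero_of_alternating_relations (T : Fin 7 → Fin 7 → Fin 7 → ℂ)
    (p213 : ∀ i j k, T j i k + T i j k = 0) (p132 : ∀ i j k, T i k j + T i j k = 0)
    (h0 : ∀ j, T j 1 2 + T j 3 4 + T j 5 6 = 0) (h1 : ∀ j, T 0 j 2 + T j 3 5 = 0)
    (h2 : ∀ j, T 0 1 j + T j 4 6 = 0) (h3 : ∀ j, T 0 j 4 + T 1 j 5 = 0)
    (h4 : ∀ j, T 0 3 j + T 2 j 6 = 0) (h5 : ∀ j, T 0 j 6 + T 1 3 j = 0)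
    (h6 : ∀ j, T 0 5 j + T 2 4 j = 0) (i j k : Fin 7) : T i j k = 0 := by
  have p231 (i j k) : T j k i - T i j k = 0 := by
    linear_combination p132 j i k - p213 i j k
  have p312 (i j k) : T k i j - T i j k = 0 := by
    linear_combination p213 i k j - p132 i j k
  have p321 (i j k) : T k j i + T i j k = 0 := by
    linear_combination p213 j k i + p132 j i k * (-1) + p213 i j k
  have z1 (i k) : T i i k = 0 := by linear_combination (1 / 2 : ℂ) * p213 i i k
  have z2 (i k) : T i k k = 0 := by linear_combination (1 / 2 : ℂ) * p132 i k k
  have z3 (i k) : T i k i = 0 := by linear_combination p132 i i k - z1 i k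
  -- The five unknowns indexed by the terms of the normal form are coupled; this combination of four
  -- relations isolates one of them, after which the others follow one by one.
  have t012 : T 0 1 2 = 0 := by
    linear_combination (1 / 3 : ℂ) * (h0 0 + 2 * h1 1 - h3 3 - h5 5)
  have t135 : T 1 3 5 = 0 := by linear_combination h1 1 - t012
  have t246 : T 2 4 6 = 0 := by linear_combination h2 2 - t012
  have t034 : T 0 3 4 = 0 := by linear_combination h3 3 - t135
  have t056 : T 0 5 6 = 0 := by linear_combination h5 5 - t135
  have t035 : T 0 3 5 = 0 := by linear_combination h1 0 - z1 0 2
  have t235 : T 2 3 5 = 0 := by linear_combination h1 2 - z2 0 2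
  have t023 : T 0 2 3 = 0 := by linear_combination -(h1 3 - p132 0 2 3 - z1 3 5)
  have t025 : T 0 2 5 = 0 := by linear_combination -(h1 5 - p132 0 2 5 - z3 5 3)
  have t046 : T 0 4 6 = 0 := by linear_combination h2 0 - z3 0 1
  have t146 : T 1 4 6 = 0 := by linear_combination h2 1 - z2 0 1
  have t014 : T 0 1 4 = 0 := by linear_combination h2 4 - z1 4 6
  have t016 : T 0 1 6 = 0 := by linear_combination h2 6 - z3 6 4
  have t015 : T 0 1 5 = 0 := by linear_combination -(h3 0 - z1 0 4 - p213 0 1 5)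
  have t145 : T 1 4 5 = 0 := by linear_combination h3 4 - z2 0 4
  have t045 : T 0 4 5 = 0 := by linear_combination -(h3 5 - p132 0 4 5 - z2 1 5)
  have t156 : T 1 5 6 = 0 := by linear_combination -(h3 6 - p132 0 4 6 - p132 1 5 6 + t046)
  have t026 : T 0 2 6 = 0 := by linear_combination -(h4 0 - z3 0 3 - p213 0 2 6)
  have t236 : T 2 3 6 = 0 := by linear_combination h4 3 - z2 0 3
  have t256 : T 2 5 6 = 0 := by linear_combination h4 5 - t035
  have t036 : T 0 3 6 = 0 := by linear_combination h4 6 - z2 2 6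
  have t013 : T 0 1 3 = 0 := by linear_combination h5 0 - z1 0 6 - p231 0 1 3
  have t123 : T 1 2 3 = 0 := by linear_combination -(h5 2 - p132 1 2 3 - t026)
  have t134 : T 1 3 4 = 0 := by linear_combination h5 4 - t046
  have t136 : T 1 3 6 = 0 := by linear_combination h5 6 - z2 0 6
  have t024 : T 0 2 4 = 0 := by linear_combination h6 0 - z3 0 5 - p231 0 2 4
  have t124 : T 1 2 4 = 0 := by linear_combination h6 1 - p132 0 1 5 - p231 1 2 4 + t015
  have t234 : T 2 3 4 = 0 := by linear_combination -(h6 3 - p132 0 3 5 - p132 2 3 4 + t035)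
  have t245 : T 2 4 5 = 0 := by linear_combination h6 5 - z2 0 5
  have t356 : T 3 5 6 = 0 := by linear_combination h0 3 - p312 1 2 3 - z1 3 4 - t123
  have t456 : T 4 5 6 = 0 := by linear_combination h0 4 - p312 1 2 4 - z3 4 3 - t124
  have t345 : T 3 4 5 = 0 := by linear_combination -(h1 4 - p132 0 2 4 - p213 3 4 5 + t024)
  have t346 : T 3 4 6 = 0 := by linear_combination h2 3 - t013
  have t125 : T 1 2 5 = 0 := by linear_combination h3 2 - t024
  have t126 : T 1 2 6 = 0 := by linear_combination -(h4 1 - p132 0 1 3 - p213 1 2 6 + t013)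
  have sorted (i j k : Fin 7) (hij : i < j) (hjk : j < k) : T i j k = 0 := by
    fin_cases i <;> fin_cases j <;> first | exact absurd hij (by decide) | skip
    all_goals fin_cases k <;> first | exact absurd hjk (by decide) | assumption
  rcases lt_trichotomy i j with hij | rfl | hij
  · rcases lt_trichotomy j k with hjk | rfl | hjk
    · exact sorted _ _ _ hij hjk
    · exact z2 _ _
    · rcases lt_trichotomy i k with hik | rfl | hik
      · linear_combination p132 i k j - sorted _ _ _ hik hjk
      · exact z3 _ _
      · linear_combination p231 k i j + sorted _ _ _ hik hij
  · exact z1 _ _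
  · rcases lt_trichotomy i k with hik | rfl | hik
    · linear_combination p213 j i k - sorted _ _ _ hij hik
    · exact z3 _ _
    · rcases lt_trichotomy j k with hjk | rfl | hjk
      · linear_combination p312 j k i + sorted _ _ _ hjk hik
      · exact z2 _ _
      · linear_combination p321 k j i - sorted _ _ _ hjk hij

/-- Otherwise a nonzero functional would kill the image. Testing it on elementary endomorphisms,
which replace one factor of a wedge by another coordinate, gives the relations of
`eq_zero_of_alternating_relations`. -/
theorem infAct_normalForm_surjective (e : Basis (Fin 7) ℂ V) :
    Function.Surjective (infActHom (normalForm e)) := by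
  rw [← LinearMap.range_eq_top]
  by_contra hne
  obtain ⟨φ, hφ0, hφ⟩ := Submodule.exists_le_ker_of_lt_top _ (lt_top_iff_ne_top.2 hne)
  apply hφ0
  let T : Fin 7 → Fin 7 → Fin 7 → ℂ := fun i j k => φ (wedge3 (e.coord i) (e.coord j) (e.coord k))
  have hw (i j k) : φ (wedge3 (e.coord i) (e.coord j) (e.coord k)) = T i j k := rfl
  have hrel (i j : Fin 7) : φ (infAct (normalForm e)
      ((e.coord j).smulRight (e i))) = 0 := hφ ⟨_, rfl⟩
  have hX (i j k : Fin 7) : e.coord k ∘ₗ (e.coord j).smulRight (e i) =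
      if k = i then e.coord j else 0 := by
    ext x
    simp only [LinearMap.comp_apply, LinearMap.smulRight_apply, map_smul, Basis.coord_apply,
      Basis.repr_self, smul_eq_mul, Finsupp.single_apply, eq_comm (a := i)]
    split_ifs <;> simp
  have hN (X : V →ₗ[ℂ] V) : infAct (normalForm e) X =
      infAct (wedge3 (e.coord 0) (e.coord 1) (e.coord 2)) X +
      infAct (wedge3 (e.coord 0) (e.coord 3) (e.coord 4)) X +
      infAct (wedge3 (e.coord 0) (e.coord 5) (e.coord 6)) X +
      infAct (wedge3 (e.coord 1) (e.coord 3) (e.coord 5)) X +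
      infAct (wedge3 (e.coord 2) (e.coord 4) (e.coord 6)) X := by
    simp only [← infActHom_apply, normalForm, map_add, LinearMap.add_apply]
  have hT : ∀ i j k, T i j k = 0 := by
    apply eq_zero_of_alternating_relations T
    · intro i j k
      rw [← hw, ← hw, ← map_add]
      convert map_zero φ
      refine threeForm_ext fun x y z => ?_
      simp only [AlternatingMap.add_apply, wedge3_apply, AlternatingMap.zero_apply]
      ring
    · intro i j k
      rw [← hw, ← hw, ← map_add]
      convert map_zero φ
      refine threeForm_ext fun x y z => ?_
      simp only [AlternatingMap.add_apply, wedge3_apply, AlternatingMap.zero_apply]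
      ring
    all_goals intro j
    · simpa [hN, infAct_wedge3, hX, wedge3_zero_left, wedge3_zero_mid, wedge3_zero_right, hw]
        using hrel 0 j
    · simpa [hN, infAct_wedge3, hX, wedge3_zero_left, wedge3_zero_mid, wedge3_zero_right, hw]
        using hrel 1 j
    · simpa [hN, infAct_wedge3, hX, wedge3_zero_left, wedge3_zero_mid, wedge3_zero_right, hw]
        using hrel 2 j
    · simpa [hN, infAct_wedge3, hX, wedge3_zero_left, wedge3_zero_mid, wedge3_zero_right, hw]
        using hrel 3 j
    · simpa [hN, infAct_wedge3, hX, wedge3_zero_left, wedge3_zero_mid, wedge3_zero_right, hw]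
        using hrel 4 j
    · simpa [hN, infAct_wedge3, hX, wedge3_zero_left, wedge3_zero_mid, wedge3_zero_right, hw]
        using hrel 5 j
    · simpa [hN, infAct_wedge3, hX, wedge3_zero_left, wedge3_zero_mid, wedge3_zero_right, hw]
        using hrel 6 j
  ext Ω
  have h := congrArg φ (sum_smul_wedge3 Ω e)
  simp only [map_sum, map_smul, hw, hT, smul_zero, Finset.sum_const_zero] at h
  simpa using h

end ThreeForms

/-! ### Orbits of the general linear group on three-forms -/

section OpenOrbit

theorem contDiff_of_mem_polyFun {m : ℕ} {P : (Fin m → ℂ) → ℂ} (hP : P ∈ polyFun (Fin m → ℂ)) :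
    ContDiff ℂ 1 P := by
  induction hP using Algebra.adjoin_induction with
  | mem P hP =>
    obtain ⟨ξ, rfl⟩ := hP
    exact (LinearMap.toContinuousLinearMap ξ).contDiff
  | algebraMap c => exact contDiff_const
  | add P Q _ _ hP hQ => exact hP.add hQ
  | mul P Q _ _ hP hQ => exact hP.mul hQ

theorem IsPolyMap.contDiff {m n : ℕ} {f : (Fin m → ℂ) → Fin n → ℂ} (hf : IsPolyMap f) :
    ContDiff ℂ 1 f :=
  contDiff_pi.2 fun i => contDiff_of_mem_polyFun (hf (LinearMap.proj i))

/-- The implicit function theorem at `0`, with the derivative read off along each line through the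
origin; linearity of `D` need not be known in advance. -/
theorem IsPolyMap.map_nhds_zero {m n : ℕ} {f : (Fin m → ℂ) → Fin n → ℂ} (hf : IsPolyMap f)
    (D : (Fin m → ℂ) → Fin n → ℂ) (hD : Function.Surjective D)
    (h : ∀ s, ∃ r₂ r₃, ∀ t : ℂ, f (t • s) = f 0 + t • D s + t ^ 2 • r₂ + t ^ 3 • r₃) :
    Filter.map f (𝓝 0) = 𝓝 (f 0) := by
  have hs : HasStrictFDerivAt f (fderiv ℂ f 0) 0 :=
    hf.contDiff.contDiffAt.hasStrictFDerivAt (by norm_num)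
  refine hs.map_nhds_eq_of_surj (LinearMap.range_eq_top.2 fun w => ?_)
  obtain ⟨s, rfl⟩ := hD w
  refine ⟨s, ?_⟩
  obtain ⟨r₂, r₃, hr⟩ := h s
  have h0 : HasFDerivAt f (fderiv ℂ f 0) ((0 : ℂ) • s) := by
    rw [zero_smul]
    exact hs.hasFDerivAt
  have h1 : HasDerivAt (fun t : ℂ => f (t • s)) (fderiv ℂ f 0 s) 0 := by
    have h2 : HasDerivAt (fun t : ℂ => t • s) ((1 : ℂ) • s) 0 := (hasDerivAt_id _).smul_const s
    rw [one_smul] at h2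
    exact h0.comp_hasDerivAt (0 : ℂ) h2
  have h3 : HasDerivAt (fun t : ℂ => f (t • s)) (D s) 0 := by
    have h4 : HasDerivAt (fun t : ℂ => f 0 + t • D s + t ^ 2 • r₂ + t ^ 3 • r₃)
        ((1 : ℂ) • D s + (((2 : ℕ) : ℂ) * 0 ^ (2 - 1)) • r₂ + (((3 : ℕ) : ℂ) * 0 ^ (3 - 1)) • r₃)
        0 :=
      ((((hasDerivAt_id _).smul_const _).const_add _).add ((hasDerivAt_pow 2 _).smul_const _)).add
        ((hasDerivAt_pow 3 _).smul_const _)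
    simp only [one_smul, ne_eq, Nat.add_one_sub_one, one_ne_zero, not_false_eq_true, zero_pow,
      mul_zero, zero_smul, add_zero, OfNat.ofNat_ne_zero] at h4
    rw [funext hr]
    exact h4
  exact h1.unique h3

variable {V : Type*} [AddCommGroup V] [Module ℂ V]

theorem finite_threeForms [Module.Finite ℂ V] : Module.Finite ℂ (V [⋀^Fin 3]→ₗ[ℂ] ℂ) :=
  Module.Finite.equiv (exteriorPower.alternatingMapLinearEquiv (R := ℂ) (M := V) (N := ℂ)
    (n := 3)).symm

/-- Functionals on three-forms are combinations of evaluations at basis triples, so polynomiality of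
a family of three-forms can be checked on values. -/
theorem threeForm_dual_apply {n : ℕ} (e : Basis (Fin n) ℂ V) (ξ : Dual ℂ (V [⋀^Fin 3]→ₗ[ℂ] ℂ))
    (Ω : V [⋀^Fin 3]→ₗ[ℂ] ℂ) : ξ Ω = ∑ i, ∑ j, ∑ k, Ω ![e i, e j, e k] *
      ((1 / 6) * ξ (wedge3 (e.coord i) (e.coord j) (e.coord k))) := by
  have h := congrArg ξ (sum_smul_wedge3 Ω e)
  simp only [map_sum, map_smul, smul_eq_mul] at h
  have h' : ξ Ω = (1 / 6) * (6 * ξ Ω) := by ring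
  rw [h', h]
  simp only [Finset.mul_sum]
  exact Finset.sum_congr rfl fun i _ => Finset.sum_congr rfl fun j _ =>
    Finset.sum_congr rfl fun k _ => by ring

theorem isPolyMap_compLinearMap [Module.Finite ℂ V] (Ω : V [⋀^Fin 3]→ₗ[ℂ] ℂ) :
    IsPolyMap fun X : V →ₗ[ℂ] V => Ω.compLinearMap X := fun ξ => by
  rw [funext fun X => threeForm_dual_apply (finBasis ℂ V) ξ (Ω.compLinearMap X)]
  simp only [compLinearMap_vec]
  refine polyFun_sum _ fun i _ => polyFun_sum _ fun j _ => polyFun_sum _ fun k _ =>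
    polyFun_mul ?_ (const_mem_polyFun _)
  refine (IsPolyMap.multilinear Ω.toMultilinearMap (w := fun X : V →ₗ[ℂ] V =>
    ![X (finBasis ℂ V i), X (finBasis ℂ V j), X (finBasis ℂ V k)]) fun l => ?_).mem
  fin_cases l
  · exact isPolyMap_linear (LinearMap.applyₗ (finBasis ℂ V i))
  · exact isPolyMap_linear (LinearMap.applyₗ (finBasis ℂ V j))
  · exact isPolyMap_linear (LinearMap.applyₗ (finBasis ℂ V k))

theorem det_mem_polyFun [Module.Finite ℂ V] :
    (fun X : V →ₗ[ℂ] V => LinearMap.det X) ∈ polyFun (V →ₗ[ℂ] V) := by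
  simp only [← LinearMap.det_toMatrix (finBasis ℂ V)]
  refine polyFun_det fun i j => ?_
  simp only [LinearMap.toMatrix_apply]
  exact linear_mem_polyFun ((finBasis ℂ V).coord i ∘ₗ LinearMap.applyₗ (finBasis ℂ V j))

/-- With `s` a right inverse of the action at `Ω`, the determinant of the action at `Ω'` composed
with `s` is polynomial in `Ω'` and equals `1` at `Ω`. -/
theorem exists_poly_infAct_surjective [Module.Finite ℂ V] {Ω : V [⋀^Fin 3]→ₗ[ℂ] ℂ}
    (hΩ : Function.Surjective (infActHom Ω)) : ∃ P ∈ polyFun (V [⋀^Fin 3]→ₗ[ℂ] ℂ), P Ω ≠ 0 ∧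
      ∀ Ω', P Ω' ≠ 0 → Function.Surjective (infActHom Ω') := by
  have := finite_threeForms (V := V)
  obtain ⟨s, hs⟩ := (infActHom Ω).exists_rightInverse_of_surjective (LinearMap.range_eq_top.2 hΩ)
  refine ⟨fun Ω' => LinearMap.det (infActHom Ω' ∘ₗ s), ?_, ?_, fun Ω' h => ?_⟩
  · simp only [← LinearMap.det_toMatrix (finBasis ℂ (V [⋀^Fin 3]→ₗ[ℂ] ℂ))]
    refine polyFun_det fun i j => ?_
    simp only [LinearMap.toMatrix_apply]
    exact linear_mem_polyFun ((finBasis ℂ (V [⋀^Fin 3]→ₗ[ℂ] ℂ)).coord i ∘ₗ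
      infActHom.flip (s (finBasis ℂ (V [⋀^Fin 3]→ₗ[ℂ] ℂ) j)))
  · change LinearMap.det (infActHom Ω ∘ₗ s) ≠ 0
    rw [hs, LinearMap.det_id]
    exact one_ne_zero
  · have h1 : Function.Surjective (infActHom Ω' ∘ₗ s) :=
      (LinearEquiv.ofIsUnitDet (f := infActHom Ω' ∘ₗ s) (v := finBasis ℂ _) (v' := finBasis ℂ _)
        (by rw [LinearMap.det_toMatrix]; exact isUnit_iff_ne_zero.2 h)).surjective
    exact Function.Surjective.of_comp (g := s) h1

/-- The map `X ↦ Ω ∘ (1 + X)` has derivative `infActHom Ω` at `0`, so it covers a neighbourhood of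
`Ω` by arbitrarily small `X`, for which `1 + X` is invertible. The coordinates `ψ` only serve to
work in the topology of `ℂⁿ`. -/
theorem eventually_orbit [Module.Finite ℂ V] {Ω : V [⋀^Fin 3]→ₗ[ℂ] ℂ}
    (hΩ : Function.Surjective (infActHom Ω)) {n : ℕ}
    (ψ : (V [⋀^Fin 3]→ₗ[ℂ] ℂ) ≃ₗ[ℂ] (Fin n → ℂ)) :
    ∀ᶠ w in 𝓝 (ψ Ω), ∃ g : V ≃ₗ[ℂ] V, ψ.symm w = Ω.compLinearMap (g : V →ₗ[ℂ] V) := by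
  let θ := (finBasis ℂ (V →ₗ[ℂ] V)).equivFun.symm
  have hid : IsPolyMap fun s => (LinearMap.id : V →ₗ[ℂ] V) + θ s :=
    (isPolyMap_const _).add (isPolyMap_linear θ.toLinearMap)
  have hf : IsPolyMap fun s => ψ (Ω.compLinearMap (LinearMap.id + θ s)) :=
    (isPolyMap_linear ψ.toLinearMap).comp ((isPolyMap_compLinearMap Ω).comp hid)
  have h := hf.map_nhds_zero (fun s => ψ (infActHom Ω (θ s)))
    (ψ.surjective.comp (hΩ.comp θ.surjective)) fun s => by
      obtain ⟨Ω₂, Ω₃, h⟩ := compLinearMap_one_add_smul Ω (θ s)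
      refine ⟨ψ Ω₂, ψ Ω₃, fun t => ?_⟩
      rw [map_smul, h, map_zero, add_zero, AlternatingMap.compLinearMap_id]
      simp only [map_add, map_smul, infActHom_apply]
  have h0 : ψ (Ω.compLinearMap (LinearMap.id + θ 0)) = ψ Ω := by
    rw [map_zero, add_zero, AlternatingMap.compLinearMap_id]
  rw [h0] at h
  rw [← h, Filter.eventually_map]
  have hdet := (contDiff_of_mem_polyFun (hid.comp_mem det_mem_polyFun)).continuous
  have hne : ∀ᶠ s in 𝓝 (0 : Fin (finrank ℂ (V →ₗ[ℂ] V)) → ℂ),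
      LinearMap.det (LinearMap.id + θ s) ≠ 0 := by
    refine hdet.continuousAt.eventually_ne ?_
    rw [map_zero, add_zero, LinearMap.det_id]
    exact one_ne_zero
  filter_upwards [hne] with s hs
  refine ⟨LinearEquiv.ofIsUnitDet (f := LinearMap.id + θ s) (v := finBasis ℂ V)
    (v' := finBasis ℂ V) (by rw [LinearMap.det_toMatrix]; exact isUnit_iff_ne_zero.2 hs), ?_⟩
  rw [LinearEquiv.symm_apply_apply]
  rfl

/-- Two three-forms are in the same orbit of the general linear group. -/
def SameOrbit (Ω Ω' : V [⋀^Fin 3]→ₗ[ℂ] ℂ) : Prop :=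
  ∃ g : V ≃ₗ[ℂ] V, Ω' = Ω.compLinearMap (g : V →ₗ[ℂ] V)

theorem SameOrbit.symm {Ω Ω' : V [⋀^Fin 3]→ₗ[ℂ] ℂ} (h : SameOrbit Ω Ω') : SameOrbit Ω' Ω := by
  obtain ⟨g, rfl⟩ := h
  refine ⟨g.symm, threeForm_ext fun x y z => ?_⟩
  rw [compLinearMap_vec, compLinearMap_vec]
  simp

theorem SameOrbit.trans {Ω Ω' Ω'' : V [⋀^Fin 3]→ₗ[ℂ] ℂ} (h : SameOrbit Ω Ω')
    (h' : SameOrbit Ω' Ω'') : SameOrbit Ω Ω'' := by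
  obtain ⟨g, rfl⟩ := h
  obtain ⟨g', rfl⟩ := h'
  refine ⟨g'.trans g, threeForm_ext fun x y z => ?_⟩
  rw [compLinearMap_vec, compLinearMap_vec, compLinearMap_vec]
  simp

/-- On the complex line through the two forms, the parameters with surjective action omit only
finitely many points, hence form a connected set. Being in the orbit of `Ω` is an open and closed
condition on it. -/
theorem sameOrbit_of_surjective [Module.Finite ℂ V] {Ω Ω' : V [⋀^Fin 3]→ₗ[ℂ] ℂ}
    (hΩ : Function.Surjective (infActHom Ω)) (hΩ' : Function.Surjective (infActHom Ω')) :
    SameOrbit Ω Ω' := by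
  have := finite_threeForms (V := V)
  let ψ := (finBasis ℂ (V [⋀^Fin 3]→ₗ[ℂ] ℂ)).equivFun
  let γ : ℂ → V [⋀^Fin 3]→ₗ[ℂ] ℂ := fun t => Ω + t • (Ω' - Ω)
  have hγ0 : γ 0 = Ω := by simp [γ]
  have hγ1 : γ 1 = Ω' := by simp [γ]
  obtain ⟨P, hP, hPΩ, hPsurj⟩ := exists_poly_infAct_surjective hΩ
  have hfin := polyFun_finite_zeros ((isPolyMap_line Ω Ω').comp_mem hP) (t₀ := 0)
    (by simpa using hPΩ)
  let S : Set ℂ := {t | Function.Surjective (infActHom (γ t))}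
  have hSfin : Sᶜ.Finite := hfin.subset fun t ht => by
    by_contra h
    exact ht (hPsurj _ h)
  have hSopen : IsOpen S := by
    rw [← isClosed_compl_iff]
    exact hSfin.isClosed
  have hSconn : IsPreconnected S := by
    rw [← compl_compl S]
    exact (hSfin.countable.isPathConnected_compl_of_one_lt_rank
      (by rw [Complex.rank_real_complex]; norm_num)).isConnected.isPreconnected
  have hloc (t₀ : ℂ) (ht₀ : t₀ ∈ S) : ∀ᶠ t in 𝓝 t₀, t ∈ S ∧ SameOrbit (γ t₀) (γ t) := by
    have hc : Continuous fun t => ψ (γ t) := by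
      simp only [γ, map_add, map_smul]
      fun_prop
    have h := hc.continuousAt.eventually (eventually_orbit (n := _) (Ω := γ t₀) ht₀ ψ)
    filter_upwards [h, hSopen.mem_nhds ht₀] with t ht htS
    obtain ⟨g, hg⟩ := ht
    exact ⟨htS, g, by rw [← hg, LinearEquiv.symm_apply_apply]⟩
  by_contra hne
  have hopen₁ : IsOpen {t | t ∈ S ∧ SameOrbit Ω (γ t)} := isOpen_iff_mem_nhds.2 fun t₀ ht₀ => by
    filter_upwards [hloc t₀ ht₀.1] with t ht
    exact ⟨ht.1, ht₀.2.trans ht.2⟩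
  have hopen₂ : IsOpen {t | t ∈ S ∧ ¬SameOrbit Ω (γ t)} := isOpen_iff_mem_nhds.2 fun t₀ ht₀ => by
    filter_upwards [hloc t₀ ht₀.1] with t ht
    exact ⟨ht.1, fun h => ht₀.2 (h.trans ht.2.symm)⟩
  have h0S : (0 : ℂ) ∈ S := by
    change Function.Surjective (infActHom (γ 0))
    rwa [hγ0]
  have h1S : (1 : ℂ) ∈ S := by
    change Function.Surjective (infActHom (γ 1))
    rwa [hγ1]
  obtain ⟨t, -, ht₁, ht₂⟩ := hSconn _ _ hopen₁ hopen₂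
    (fun t ht => by
      by_cases h : SameOrbit Ω (γ t)
      · exact Or.inl ⟨ht, h⟩
      · exact Or.inr ⟨ht, h⟩)
    ⟨0, h0S, h0S, LinearEquiv.refl ℂ V, threeForm_ext fun x y z => by
      rw [hγ0, compLinearMap_vec]; simp⟩
    ⟨1, h1S, h1S, by rwa [hγ1]⟩
  exact ht₂.2 ht₁.2

theorem normalForm_map (e : Basis (Fin 7) ℂ V) (g : V ≃ₗ[ℂ] V) :
    (normalForm e).compLinearMap (g : V →ₗ[ℂ] V) = normalForm (e.map g.symm) := by
  refine threeForm_ext fun x y z => ?_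
  rw [compLinearMap_vec, normalForm_apply, normalForm_apply]
  simp

theorem exists_normalForm_of_surjective (hV : finrank ℂ V = 7) {Ω : V [⋀^Fin 3]→ₗ[ℂ] ℂ}
    (hΩ : Function.Surjective (infActHom Ω)) : ∃ e : Basis (Fin 7) ℂ V, Ω = normalForm e := by
  have : Module.Finite ℂ V := Module.finite_of_finrank_pos (by rw [hV]; norm_num)
  let e := Module.finBasisOfFinrankEq ℂ V hV
  obtain ⟨g, hg⟩ := sameOrbit_of_surjective (infAct_normalForm_surjective e) hΩ
  exact ⟨e.map g.symm, hg.trans (normalForm_map e g)⟩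

end OpenOrbit

/-! ### Geometry of cross products in dimension seven -/

namespace CrossProduct

variable {V : Type*} [AddCommGroup V] [Module ℂ V] (c : CrossProduct V)

/-- The orthogonal of a subspace. -/
def perp (S : Submodule ℂ V) : Submodule ℂ V := LinearMap.BilinForm.orthogonal c.form S

theorem mem_perp {S : Submodule ℂ V} {w : V} : w ∈ c.perp S ↔ ∀ s ∈ S, c.form s w = 0 := Iff.rfl

theorem mem_perp_span {s : Set V} {w : V} :
    w ∈ c.perp (Submodule.span ℂ s) ↔ ∀ x ∈ s, c.form x w = 0 := by
  refine ⟨fun h x hx => h x (Submodule.subset_span hx), fun h x hx => ?_⟩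
  change c.form x w = 0
  induction hx using Submodule.span_induction with
  | mem x hx => exact h x hx
  | zero => simp
  | add x y _ _ hx hy => simp [hx, hy]
  | smul a x _ hx => simp [hx]

theorem nondegenerate : LinearMap.BilinForm.Nondegenerate c.form :=
  ⟨c.nondeg, fun y h => c.nondeg y fun x => by rw [c.symm]; exact h x⟩

theorem finrank_perp [Module.Finite ℂ V] (S : Submodule ℂ V) :
    finrank ℂ (c.perp S) = finrank ℂ V - finrank ℂ S :=
  LinearMap.BilinForm.finrank_orthogonal c.nondegenerate S

theorem perp_perp [Module.Finite ℂ V] (S : Submodule ℂ V) : c.perp (c.perp S) = S :=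
  LinearMap.BilinForm.orthogonal_orthogonal c.nondegenerate
    (fun x y h => by rw [c.symm]; exact h) S

/-- A functional vanishing on the range would, by nondegeneracy, be a linear relation among the `p
i`. -/
theorem pairing_surjective {k : ℕ} {p : Fin k → V} (hp : LinearIndependent ℂ p) :
    Function.Surjective (LinearMap.pi fun i => c.form (p i)) := by
  rw [← LinearMap.range_eq_top]
  by_contra hne
  obtain ⟨φ, hφ0, hφ⟩ := Submodule.exists_le_ker_of_lt_top _ (lt_top_iff_ne_top.2 hne)
  apply hφ0
  have h1 : ∑ i, φ (fun j => if i = j then 1 else 0) • p i = 0 := by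
    refine c.nondeg _ fun v => ?_
    have h2 : φ (LinearMap.pi (fun i => c.form (p i)) v) = 0 := hφ ⟨v, rfl⟩
    rw [LinearMap.pi_apply_eq_sum_univ φ] at h2
    simp only [map_sum, map_smul, LinearMap.sum_apply, LinearMap.smul_apply, smul_eq_mul]
    refine Eq.trans ?_ h2
    exact Finset.sum_congr rfl fun i _ => mul_comm _ _
  have h2 := Fintype.linearIndependent_iff.1 hp _ h1
  ext i
  have h3 : (Pi.single i 1 : Fin k → ℂ) = fun j => if i = j then 1 else 0 := by
    ext j
    rw [Pi.single_apply]
    simp only [eq_comm]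
  rw [LinearMap.comp_apply, LinearMap.single_apply, h3, h2 i]
  simp

theorem exists_dual_family {k : ℕ} {p : Fin k → V} (hp : LinearIndependent ℂ p) :
    ∃ r : Fin k → V, ∀ i j, c.form (p i) (r j) = if i = j then 1 else 0 := by
  choose r hr using fun j => c.pairing_surjective hp (Pi.single j 1)
  refine ⟨r, fun i j => ?_⟩
  have := congrFun (hr j) i
  simpa [Pi.single_apply] using this

theorem exists_form_eq {a b : V} (h : LinearIndependent ℂ ![a, b]) :
    ∃ z, c.form a z = 1 ∧ c.form b z = 0 := by
  obtain ⟨r, hr⟩ := c.exists_dual_family h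
  exact ⟨r 0, by simpa using hr 0 0, by simpa using hr 1 0⟩

/-- Here `0 = a × (a × b) = ⟨a, b⟩ a - ⟨a, a⟩ b`, and the coefficients vanish by independence. -/
theorem form_eq_zero_of_cross {a b : V} (h : LinearIndependent ℂ ![a, b])
    (hab : c.cross a b = 0) : c.form a a = 0 ∧ c.form a b = 0 := by
  have h1 := c.cross_cross_self a b
  rw [hab, map_zero] at h1
  have h2 := LinearIndependent.pair_iff.1 h (c.form a b) (-c.form a a) (by rw [h1]; module)
  exact ⟨neg_eq_zero.1 h2.2, h2.1⟩

theorem cross_cross_of_cross {a b : V} (h : LinearIndependent ℂ ![a, b])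
    (hab : c.cross a b = 0) (z : V) :
    c.cross a (c.cross b z) = (2 * c.form a z) • b - c.form b z • a := by
  have h1 := c.cross_cross_assoc a b z
  rw [hab, (c.form_eq_zero_of_cross h hab).2] at h1
  simpa using h1

theorem exists_eq_cross {a b : V} (h : LinearIndependent ℂ ![a, b]) (hab : c.cross a b = 0) :
    ∃ y, c.form a y = 0 ∧ b = c.cross a y := by
  obtain ⟨z, hz, hz'⟩ := c.exists_form_eq h
  -- With `⟨a, z⟩ = 1` and `⟨b, z⟩ = 0`, `cross_cross_of_cross` reads `a × (b × z) = 2 b`.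
  refine ⟨(1 / 2 : ℂ) • c.cross b z, ?_, ?_⟩
  · rw [map_smul, ← c.form_cross, hab]
    simp
  · rw [map_smul, c.cross_cross_of_cross h hab, hz, hz']
    module

/-- By `exists_eq_cross` the kernel of `a ×` lies in its range, so twice its dimension is at most
`7`. -/
theorem finrank_ker_cross_le [Module.Finite ℂ V] (hV : finrank ℂ V = 7) {a b : V}
    (h : LinearIndependent ℂ ![a, b]) (hab : c.cross a b = 0) :
    finrank ℂ (LinearMap.ker (c.cross a)) ≤ 3 := by
  have key (d : V) (hd : c.cross a d = 0) (hi : LinearIndependent ℂ ![a, d]) :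
      d ∈ LinearMap.range (c.cross a) := by
    obtain ⟨y, -, hy⟩ := c.exists_eq_cross hi hd
    exact ⟨y, hy.symm⟩
  have hle : LinearMap.ker (c.cross a) ≤ LinearMap.range (c.cross a) := by
    intro d hd
    rw [LinearMap.mem_ker] at hd
    by_cases hi : LinearIndependent ℂ ![a, d]
    · exact key d hd hi
    · have ha : a ≠ 0 := h.ne_zero 0
      rw [LinearIndependent.pair_iff' ha] at hi h
      push Not at hi
      obtain ⟨t, rfl⟩ := hi
      -- A multiple of `a` is the difference of `t a + b` and `b`, which both fall under `key`.
      have h1 := key b hab ((LinearIndependent.pair_iff' ha).2 h)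
      have h2 := key (t • a + b) (by rw [map_add, hd, hab, add_zero])
        ((LinearIndependent.pair_iff' ha).2 fun s hs => h (s - t) (by
          rw [sub_smul, hs]; module))
      have h3 := Submodule.sub_mem _ h2 h1
      simpa using h3
  have h1 := Submodule.finrank_mono hle
  have h2 := LinearMap.finrank_range_add_finrank_ker (c.cross a)
  omega

/-- The operator `a ×` is skew for the bilinear form, so its range is orthogonal to its kernel, and
the dimensions agree. -/
theorem range_cross [Module.Finite ℂ V] (a : V) :
    LinearMap.range (c.cross a) = c.perp (LinearMap.ker (c.cross a)) := by
  refine Submodule.eq_of_le_of_finrank_eq ?_ ?_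
  · rintro _ ⟨y, rfl⟩ k hk
    change c.form k (c.cross a y) = 0
    rw [← c.form_cross, c.cross_swap, LinearMap.mem_ker.1 hk]
    simp
  · rw [c.finrank_perp]
    have := LinearMap.finrank_range_add_finrank_ker (c.cross a)
    omega

theorem finrank_isotropic_le [Module.Finite ℂ V] (hV : finrank ℂ V = 7) {S : Submodule ℂ V}
    (hS : ∀ x ∈ S, c.form x x = 0) : finrank ℂ S ≤ 3 := by
  have hle : S ≤ c.perp S := fun x hx y hy => by
    change c.form y x = 0
    have h := hS (x + y) (add_mem hx hy)
    simp only [map_add, LinearMap.add_apply, hS x hx, hS y hy, c.symm x y] at h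
    linear_combination (1 / 2 : ℂ) * h
  have h1 := Submodule.finrank_mono hle
  rw [c.finrank_perp] at h1
  omega

theorem finrank_span_three {a b d : V} (h : LinearIndependent ℂ ![a, b, d]) :
    finrank ℂ (Submodule.span ℂ {a, b, d}) = 3 := by
  have h1 := finrank_span_eq_card h
  have h2 : Set.range ![a, b, d] = {a, b, d} := by
    simp only [Matrix.range_cons, Matrix.range_empty, Set.union_empty, Set.singleton_union]
  rwa [h2, Fintype.card_fin] at h1

theorem pair_of_triple {a b d : V} (h : LinearIndependent ℂ ![a, b, d]) :
    LinearIndependent ℂ ![a, b] ∧ LinearIndependent ℂ ![a, d] ∧ LinearIndependent ℂ ![b, d] := by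
  have key (i j : Fin 3) (hij : i ≠ j) :
      LinearIndependent ℂ (![a, b, d] ∘ ![i, j]) := h.comp _ (by
    intro k l hkl
    fin_cases k <;> fin_cases l <;> simp_all)
  have h1 := key 0 1 (by decide)
  have h2 := key 0 2 (by decide)
  have h3 := key 1 2 (by decide)
  refine ⟨?_, ?_, ?_⟩
  · convert h1 using 1
    ext i
    fin_cases i <;> rfl
  · convert h2 using 1
    ext i
    fin_cases i <;> rfl
  · convert h3 using 1
    ext i
    fin_cases i <;> rfl

theorem triple_iff {a b d : V} : LinearIndependent ℂ ![a, b, d] ↔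
    ∀ r s t : ℂ, r • a + s • b + t • d = 0 → r = 0 ∧ s = 0 ∧ t = 0 := by
  rw [Fintype.linearIndependent_iff]
  constructor
  · intro h r s t hrst
    have := h ![r, s, t] (by simpa [Fin.sum_univ_three] using hrst)
    exact ⟨this 0, this 1, this 2⟩
  · intro h g hg
    have := h (g 0) (g 1) (g 2) (by simpa [Fin.sum_univ_three] using hg)
    intro i
    fin_cases i
    exacts [this.1, this.2.1, this.2.2]

theorem ker_cross_eq_span [Module.Finite ℂ V] (hV : finrank ℂ V = 7) {a b d : V}
    (h : LinearIndependent ℂ ![a, b, d]) (hab : c.cross a b = 0) (had : c.cross a d = 0) :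
    LinearMap.ker (c.cross a) = Submodule.span ℂ {a, b, d} := by
  refine (Submodule.eq_of_le_of_finrank_le ?_ ?_).symm
  · rw [Submodule.span_le]
    rintro x (rfl | rfl | rfl)
    exacts [c.cross_self _, hab, had]
  · rw [finrank_span_three h]
    exact c.finrank_ker_cross_le hV (pair_of_triple h).1 hab

/-- If all three products vanished, `d ×` would have kernel `⟨a, b, d⟩`. Every `b × z`, being
orthogonal to it, would then be some `d × z'`. Applying `a ×` with `⟨a, z⟩ = 1` gives a relation
among `a`, `b`, `d` in which `b` has coefficient `2`. -/
theorem cross_ne_zero_of_cross [Module.Finite ℂ V] (hV : finrank ℂ V = 7) {a b d : V}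
    (h : LinearIndependent ℂ ![a, b, d]) (hab : c.cross a b = 0) (had : c.cross a d = 0) :
    c.cross b d ≠ 0 := by
  intro hbd
  have h' : LinearIndependent ℂ ![d, a, b] := by
    rw [triple_iff] at h ⊢
    intro r s t hrst
    obtain ⟨h1, h2, h3⟩ := h s t r (by rw [← hrst]; module)
    exact ⟨h3, h1, h2⟩
  have hda : c.cross d a = 0 := by rw [c.cross_swap, had, neg_zero]
  have hdb : c.cross d b = 0 := by rw [c.cross_swap, hbd, neg_zero]
  obtain ⟨z, hz, hz'⟩ := c.exists_form_eq (pair_of_triple h).1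
  have h1 := c.cross_cross_of_cross (pair_of_triple h).1 hab z
  have h2 : c.cross b z ∈ LinearMap.range (c.cross d) := by
    rw [c.range_cross, c.ker_cross_eq_span hV h' hda hdb, c.mem_perp_span]
    rintro x (rfl | rfl | rfl)
    · rw [← c.form_cross, hdb]; simp
    · rw [← c.form_cross, hab]; simp
    · rw [← c.form_cross, c.cross_self]; simp
  obtain ⟨z', hz'⟩ := h2
  have h3 := c.cross_cross_of_cross (pair_of_triple h).2.1 had z'
  rw [hz', h1, hz] at h3
  have h4 := triple_iff.1 h (c.form d z' - c.form b z) 2 (-(2 * c.form a z')) (by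
    linear_combination (norm := module) h3)
  norm_num at h4

end CrossProduct

/-! ### Four-spaces on which the three-form vanishes, and relations from Gram determinants -/

namespace CrossProduct

variable {V : Type*} [AddCommGroup V] [Module ℂ V] (c : CrossProduct V)

/-- The three-form of the cross product vanishes on `A`. -/
def Null (A : Submodule ℂ V) : Prop :=
  ∀ x ∈ A, ∀ y ∈ A, ∀ z ∈ A, c.form (c.cross x y) z = 0

/-- The span of the products of the vectors of `A`. -/
def products (A : Submodule ℂ V) : Submodule ℂ V :=
  Submodule.span ℂ {w | ∃ u ∈ A, ∃ v ∈ A, c.cross u v = w}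

variable {c} in
-- If the products spanned less than three dimensions, the kernel of `a ×` on `A` would have
-- dimension at least two for every `a` in `A`. Then `a` is annihilated by an independent vector,
-- hence isotropic; but an isotropic space has dimension at most `3`.
theorem Null.products_eq [Module.Finite ℂ V] (hV : finrank ℂ V = 7) {A : Submodule ℂ V}
    (hA : finrank ℂ A = 4) (hN : c.Null A) : c.products A = c.perp A := by
  have hle : c.products A ≤ c.perp A := by
    rw [products, Submodule.span_le]
    rintro _ ⟨u, hu, v, hv, rfl⟩ w hw
    change c.form w (c.cross u v) = 0
    rw [c.symm]
    exact hN u hu v hv w hw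
  have hp : finrank ℂ (c.perp A) = 3 := by rw [c.finrank_perp, hV, hA]
  refine Submodule.eq_of_le_of_finrank_le hle ?_
  by_contra hlt
  have hiso : ∀ a ∈ A, c.form a a = 0 := by
    intro a ha
    by_cases ha0 : a = 0
    · simp [ha0]
    have h1 := LinearMap.finrank_range_add_finrank_ker ((c.cross a).domRestrict A)
    have h2 : LinearMap.range ((c.cross a).domRestrict A) ≤ c.products A := by
      rintro _ ⟨b, rfl⟩
      exact Submodule.subset_span ⟨a, ha, b, b.2, rfl⟩
    have h3 := Submodule.finrank_mono h2
    have h4 : ∃ b : A, c.cross a b = 0 ∧ LinearIndependent ℂ ![a, (b : V)] := by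
      by_contra! h5
      have h6 : LinearMap.ker ((c.cross a).domRestrict A) ≤
          Submodule.span ℂ {(⟨a, ha⟩ : A)} := by
        intro b hb
        have h7 := h5 b (LinearMap.mem_ker.1 hb)
        rw [LinearIndependent.pair_iff' ha0] at h7
        push Not at h7
        obtain ⟨t, ht⟩ := h7
        exact Submodule.mem_span_singleton.2 ⟨t, Subtype.ext ht⟩
      have h7 := Submodule.finrank_mono h6
      have h8 := finrank_span_singleton (K := ℂ) (v := (⟨a, ha⟩ : A))
        (fun h => ha0 (congrArg Subtype.val h))
      omega
    obtain ⟨b, hb, hi⟩ := h4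
    exact (c.form_eq_zero_of_cross hi hb).1
  have := c.finrank_isotropic_le hV hiso
  omega

variable {c} in
-- The right-hand side of `cross_cross_assoc` lies in `A`, so it pairs to zero with `y`.
theorem Null.form_cross_cyclic {A : Submodule ℂ V} {y u v w : V} (hy : y ∈ c.perp A) (hu : u ∈ A)
    (hv : v ∈ A) (hw : w ∈ A) :
    c.form (c.cross (c.cross u v) w) y = c.form (c.cross (c.cross v w) u) y := by
  have h1 := congrArg (fun x => c.form x y) (c.cross_cross_assoc u v w)
  simp only [map_add, map_sub, map_smul, LinearMap.add_apply, LinearMap.sub_apply,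
    LinearMap.smul_apply, c.mem_perp.1 hy u hu, c.mem_perp.1 hy v hv, c.mem_perp.1 hy w hw,
    smul_zero, sub_zero] at h1
  rw [c.cross_swap (c.cross v w) u, map_neg, LinearMap.neg_apply]
  linear_combination h1

variable {c} in
-- The expression is skew in `u, v` and cyclic in `u, v, t`; exchanging the pairs `u, v` and `w, s`
-- only changes its sign. So it is alternating in all five vectors, which are dependent because `A`
-- has dimension four.
theorem Null.form_products_eq_zero [Module.Finite ℂ V] {A : Submodule ℂ V}
    (hA : finrank ℂ A = 4) (hN : c.Null A) {u v t w s : V} (hu : u ∈ A) (hv : v ∈ A) (ht : t ∈ A)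
    (hw : w ∈ A) (hs : s ∈ A) : c.form (c.cross (c.cross u v) t) (c.cross w s) = 0 := by
  let G : A → A → A → A → A → ℂ := fun u v t w s =>
    c.form (c.cross (c.cross (u : V) v) t) (c.cross (w : V) s)
  have hG (u v t w s : A) : G u v t w s = c.form (c.cross (c.cross (u : V) v) t)
    (c.cross (w : V) s) := rfl
  have hperp (w s : A) : c.cross (w : V) s ∈ c.perp A := fun x hx => by
    change c.form x _ = 0
    rw [c.symm]
    exact hN w w.2 s s.2 x hx
  have cyc (u v t w s) : G u v t w s = G v t u w s :=
    Null.form_cross_cyclic (hperp w s) u.2 v.2 t.2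
  have s12 (u v t w s) : G u v t w s = -G v u t w s := by
    simp only [hG]
    rw [c.cross_swap u v]
    simp
  have s23 (u v t w s) : G u v t w s = -G u t v w s := by
    rw [cyc, s12, ← cyc u t v]
  have flip (u v t w s) : G u v t w s = -G w s t u v := by
    simp only [hG]
    rw [c.form_cross, c.symm, c.cross_swap, map_neg, LinearMap.neg_apply]
  have s45 (u v t w s) : G u v t w s = -G u v t s w := by
    rw [flip, s12, ← flip]
  have s34 (u v t w s) : G u v t w s = -G u v w t s := by
    rw [flip, s23, s12, s23, ← flip, neg_neg]
  -- If the first vector is a combination of the other four, adjacent transpositions bring each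
  -- equal pair together and kill the term.
  have zero (v t w s : A) (a b d e : ℂ) : G (a • v + b • t + d • w + e • s) v t w s = 0 := by
    have e1 : G v v t w s = 0 := by linear_combination (1 / 2 : ℂ) * s12 v v t w s
    have e2 : G t v t w s = 0 := by
      linear_combination s12 t v t w s - (1 / 2 : ℂ) * s23 v t t w s
    have e3 : G w v t w s = 0 := by
      linear_combination s12 w v t w s - s23 v w t w s + (1 / 2 : ℂ) * s34 v t w w s
    have e4 : G s v t w s = 0 := by
      linear_combination s12 s v t w s - s23 v s t w s + s34 v t s w s -
        (1 / 2 : ℂ) * s45 v t w s s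
    simp only [hG] at e1 e2 e3 e4 ⊢
    simp only [Submodule.coe_add, Submodule.coe_smul, map_add, map_smul, LinearMap.add_apply,
      LinearMap.smul_apply, e1, e2, e3, e4, smul_zero, add_zero]
  have zero' (u v t w s : A) (r a b d e : ℂ) (hr : r ≠ 0)
      (h : r • u + a • v + b • t + d • w + e • s = 0) : G u v t w s = 0 := by
    have : u = (-a / r) • v + (-b / r) • t + (-d / r) • w + (-e / r) • s := by
      have h1 : u = r⁻¹ • (r • u) := by rw [smul_smul, inv_mul_cancel₀ hr, one_smul]
      have h2 : r • u = -(a • v + b • t + d • w + e • s) := by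
        linear_combination (norm := module) h
      rw [h1, h2]
      module
    rw [this]
    exact zero _ _ _ _ _ _ _ _
  change G ⟨u, hu⟩ ⟨v, hv⟩ ⟨t, ht⟩ ⟨w, hw⟩ ⟨s, hs⟩ = 0
  generalize (⟨u, hu⟩ : A) = u
  generalize (⟨v, hv⟩ : A) = v
  generalize (⟨t, ht⟩ : A) = t
  generalize (⟨w, hw⟩ : A) = w
  generalize (⟨s, hs⟩ : A) = s
  have hdep : ¬LinearIndependent ℂ ![u, v, t, w, s] := fun h => by
    have := h.fintype_card_le_finrank
    rw [hA] at this
    simp at this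
  rw [Fintype.linearIndependent_iff] at hdep
  push Not at hdep
  obtain ⟨g, hg, i, hi⟩ := hdep
  simp only [Fin.sum_univ_five, Matrix.cons_val] at hg
  fin_cases i
  · exact zero' u v t w s _ _ _ _ _ hi hg
  · rw [s12, zero' v u t w s (g 1) (g 0) (g 2) (g 3) (g 4) hi (by rw [← hg]; module), neg_zero]
  · rw [s23, s12, zero' t u v w s (g 2) (g 0) (g 1) (g 3) (g 4) hi (by rw [← hg]; module)]
    simp
  · rw [s34, s23, s12, zero' w u v t s (g 3) (g 0) (g 1) (g 2) (g 4) hi (by rw [← hg]; module)]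
    simp
  · rw [s45, s34, s23, s12, zero' s u v t w (g 4) (g 0) (g 1) (g 2) (g 3) hi (by rw [← hg]; module)]
    simp

variable {c} in
-- `A^⊥` is spanned by products of vectors of `A`, and on those the previous lemma applies: `A^⊥` is
-- a subalgebra.
theorem Null.cross_mem_perp [Module.Finite ℂ V] (hV : finrank ℂ V = 7) {A : Submodule ℂ V}
    (hA : finrank ℂ A = 4) (hN : c.Null A) {x y : V} (hx : x ∈ c.perp A) (hy : y ∈ c.perp A) :
    c.cross x y ∈ c.perp A := by
  intro t ht
  change c.form t (c.cross x y) = 0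
  rw [← hN.products_eq hV hA] at hx hy
  induction hx using Submodule.span_induction with
  | mem x hx =>
    obtain ⟨u, hu, v, hv, rfl⟩ := hx
    induction hy using Submodule.span_induction with
    | mem y hy =>
      obtain ⟨w, hw, s, hs, rfl⟩ := hy
      rw [← c.form_cross, c.cross_swap, map_neg, LinearMap.neg_apply,
        hN.form_products_eq_zero hA hu hv ht hw hs, neg_zero]
    | zero => simp
    | add x y _ _ hx hy => simp [hx, hy]
    | smul a x _ hx => simp [hx]
  | zero => simp
  | add x y _ _ hx hy => simp [hx, hy]
  | smul a x _ hx => simp [hx]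

/-- The Gram determinant of two vectors. -/
def gram (x y : V) : ℂ := c.form x x * c.form y y - c.form x y ^ 2

theorem form_cross_cross (x y : V) : c.form (c.cross x y) (c.cross x y) = c.gram x y := by
  rw [c.form_cross_swap, c.cross_cross_self, gram]
  simp only [map_sub, map_smul, smul_eq_mul, c.symm y x]
  ring

/-- Computing `x × (x × y)` and `y × (x × y)` in two ways and comparing coefficients. The resulting
values make the Gram determinant vanish. -/
theorem relations_of_cross_eq {x y : V} (h : LinearIndependent ℂ ![x, y]) {α β : ℂ}
    (hxy : c.cross x y = α • x + β • y) :
    c.form x x = -β ^ 2 ∧ c.form y y = -α ^ 2 ∧ c.form x y = α * β := by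
  have h1 := c.cross_cross_self x y
  have h2 := c.cross_cross_self y x
  rw [hxy] at h1
  rw [c.cross_swap y x, map_neg, hxy] at h2
  simp only [map_add, map_smul, c.cross_self, hxy, c.cross_swap y x, c.symm y x] at h1 h2
  have h3 := LinearIndependent.pair_iff.1 h (α * β - c.form x y) (β ^ 2 + c.form x x) (by
    linear_combination (norm := module) h1)
  have h4 := LinearIndependent.pair_iff.1 h (α ^ 2 + c.form y y) (α * β - c.form x y) (by
    linear_combination (norm := module) h2)
  exact ⟨by linear_combination h3.2, by linear_combination h4.1, by linear_combination -h3.1⟩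

theorem triple_of_cross_ne {x y : V} (h : LinearIndependent ℂ ![x, y])
    (hne : ∀ α β : ℂ, c.cross x y ≠ α • x + β • y) :
    LinearIndependent ℂ ![x, y, c.cross x y] := by
  rw [triple_iff]
  intro r s t hrst
  have ht : t = 0 := by
    by_contra ht
    apply hne (-r / t) (-s / t)
    have h1 : c.cross x y = t⁻¹ • (t • c.cross x y) := by
      rw [smul_smul, inv_mul_cancel₀ ht, one_smul]
    have h2 : t • c.cross x y = -(r • x + s • y) := by linear_combination (norm := module) hrst
    rw [h1, h2]
    module
  subst ht
  have := LinearIndependent.pair_iff.1 h r s (by rw [← hrst]; module)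
  exact ⟨this.1, this.2, rfl⟩

theorem pair_of_gram {x y : V} (h : c.gram x y ≠ 0) : LinearIndependent ℂ ![x, y] := by
  rw [LinearIndependent.pair_iff]
  intro s t hst
  have h1 := congrArg (c.form x) hst
  have h2 := congrArg (c.form y) hst
  simp only [map_add, map_smul, smul_eq_mul, map_zero, c.symm y x] at h1 h2
  constructor
  · refine (mul_eq_zero.1 (?_ : s * c.gram x y = 0)).resolve_right h
    rw [gram]
    linear_combination c.form y y * h1 - c.form x y * h2
  · refine (mul_eq_zero.1 (?_ : t * c.gram x y = 0)).resolve_right h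
    rw [gram]
    linear_combination c.form x x * h2 - c.form x y * h1

theorem triple_of_gram {x y : V} (h : c.gram x y ≠ 0) :
    LinearIndependent ℂ ![x, y, c.cross x y] := by
  refine c.triple_of_cross_ne (c.pair_of_gram h) fun α β hxy => h ?_
  obtain ⟨h1, h2, h3⟩ := c.relations_of_cross_eq (c.pair_of_gram h) hxy
  rw [gram, h1, h2, h3]
  ring

theorem triple_of_null {x y : V} (h : LinearIndependent ℂ ![x, y]) (hx : c.form x x = 0)
    (hy : c.form y y = 0) (hxy : c.cross x y ≠ 0) :
    LinearIndependent ℂ ![x, y, c.cross x y] := by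
  refine c.triple_of_cross_ne h fun α β he => hxy ?_
  obtain ⟨h1, h2, -⟩ := c.relations_of_cross_eq h he
  have hα : α = 0 := by
    rw [hy] at h2
    simpa using h2.symm
  have hβ : β = 0 := by
    rw [hx] at h1
    simpa using h1.symm
  rw [he, hα, hβ]
  simp

/-- Suppose `n × m = 0` and take `z` with `⟨n, z⟩ = 1`, `⟨m, z⟩ = 0`, so that `n × (m × z) = 2 m`.
Then `cross_cross_assoc` for `x`, `n`, `m × z` gives `4 μ m = 0`. So `μ = 0`, whereas `x × (x × n) =
-⟨x, x⟩ n` is nonzero. -/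
theorem cross_ne_zero_of_eigenvectors {x n m : V} {μ : ℂ} (hx : c.form x x ≠ 0)
    (hnm : LinearIndependent ℂ ![n, m]) (hxn : c.form x n = 0)
    (hn : c.cross x n = μ • n) (hm : c.cross x m = μ • m) : c.cross n m ≠ 0 := by
  intro h0
  obtain ⟨z, hz, hz'⟩ := c.exists_form_eq hnm
  have h1 := c.cross_cross_of_cross hnm h0 z
  rw [hz, hz'] at h1
  have h2 := c.cross_cross_assoc x n (c.cross m z)
  rw [hn, h1, ← c.form_cross, hm, ← c.form_cross, h0, hxn] at h2
  simp only [map_smul, map_sub, LinearMap.smul_apply, h1, hz', hm, map_zero,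
    LinearMap.zero_apply] at h2
  have hm0 : m ≠ 0 := hnm.ne_zero 1
  have hn0 : n ≠ 0 := hnm.ne_zero 0
  have h3 : (4 * μ) • m = 0 := by
    linear_combination (norm := skip) h2
    rw [hn]
    module
  have hμ : μ = 0 := by
    have := (smul_eq_zero.1 h3).resolve_right hm0
    simpa using this
  have h4 := c.cross_cross_self x n
  rw [hn, hμ, hxn] at h4
  simp only [zero_smul, map_zero, zero_sub] at h4
  exact (smul_ne_zero hx hn0) (neg_eq_zero.1 h4.symm)

end CrossProduct

/-! ### Generators of three-dimensional subalgebras and nondegenerate four-spaces -/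

namespace CrossProduct

variable {V : Type*} [AddCommGroup V] [Module ℂ V] (c : CrossProduct V)

theorem exists_basis_fin_two {N : Submodule ℂ V} (hN : finrank ℂ N = 2) :
    ∃ n ∈ N, ∃ m ∈ N, LinearIndependent ℂ ![n, m] := by
  have b := basisOfFinrank N hN
  refine ⟨b 0, (b 0).2, b 1, (b 1).2, ?_⟩
  have h := b.linearIndependent.map' N.subtype N.ker_subtype
  have he : N.subtype ∘ b = ![(b 0 : V), b 1] := by
    ext i
    fin_cases i <;> rfl
  rwa [he] at h

theorem exists_basis_fin_three {N : Submodule ℂ V} (hN : finrank ℂ N = 3) :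
    ∃ a ∈ N, ∃ b ∈ N, ∃ d ∈ N, LinearIndependent ℂ ![a, b, d] := by
  have b := basisOfFinrank N hN
  refine ⟨b 0, (b 0).2, b 1, (b 1).2, b 2, (b 2).2, ?_⟩
  have h := b.linearIndependent.map' N.subtype N.ker_subtype
  have he : N.subtype ∘ b = ![(b 0 : V), b 1, b 2] := by
    ext i
    fin_cases i <;> rfl
  rwa [he] at h

/-- A nonzero Gram determinant suffices. If `B` is isotropic, not all products of a basis vanish.
Otherwise an anisotropic `x` has an isotropic orthogonal plane `N` in `B`: either the product is
nonzero on `N`, or some `k` in `N` is not an eigenvector of `x ×`, by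
`cross_ne_zero_of_eigenvectors`. -/
theorem exists_cross_generators [Module.Finite ℂ V] (hV : finrank ℂ V = 7) {B : Submodule ℂ V}
    (hB : finrank ℂ B = 3) :
    ∃ x ∈ B, ∃ y ∈ B, LinearIndependent ℂ ![x, y, c.cross x y] := by
  by_cases hgram : ∃ x ∈ B, ∃ y ∈ B, c.gram x y ≠ 0
  · obtain ⟨x, hx, y, hy, hxy⟩ := hgram
    exact ⟨x, hx, y, hy, c.triple_of_gram hxy⟩
  push Not at hgram
  by_cases hiso : ∀ x ∈ B, c.form x x = 0
  · obtain ⟨a, ha, b, hb, d, hd, h⟩ := exists_basis_fin_three hB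
    obtain ⟨hab, had, hbd⟩ := pair_of_triple h
    by_cases h1 : c.cross a b = 0
    · by_cases h2 : c.cross a d = 0
      · exact ⟨b, hb, d, hd, c.triple_of_null hbd (hiso b hb) (hiso d hd)
          (c.cross_ne_zero_of_cross hV h h1 h2)⟩
      · exact ⟨a, ha, d, hd, c.triple_of_null had (hiso a ha) (hiso d hd) h2⟩
    · exact ⟨a, ha, b, hb, c.triple_of_null hab (hiso a ha) (hiso b hb) h1⟩
  push Not at hiso
  obtain ⟨x, hx, hxx⟩ := hiso
  have hnull {n : V} (hn : n ∈ B) (hxn : c.form x n = 0) : c.form n n = 0 := by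
    have := hgram x hx n hn
    rw [gram, hxn] at this
    simpa [hxx] using this
  let N : Submodule ℂ V := (LinearMap.ker ((c.form x).domRestrict B)).map B.subtype
  have hmem (n : V) : n ∈ N ↔ n ∈ B ∧ c.form x n = 0 := by
    simp only [N, Submodule.mem_map, LinearMap.mem_ker, Subtype.exists]
    constructor
    · rintro ⟨n', hn', h, rfl⟩
      exact ⟨hn', h⟩
    · rintro ⟨h1, h2⟩
      exact ⟨n, h1, h2, rfl⟩
  have hN2 : finrank ℂ N = 2 := by
    have h1 := Module.Dual.finrank_ker_add_one_of_ne_zero (f := (c.form x).domRestrict B)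
      (fun h => hxx (LinearMap.congr_fun h ⟨x, hx⟩))
    have h2 := LinearEquiv.finrank_eq (Submodule.equivMapOfInjective B.subtype
      B.subtype_injective (LinearMap.ker ((c.form x).domRestrict B)))
    change finrank ℂ ((LinearMap.ker ((c.form x).domRestrict B)).map B.subtype) = 2
    omega
  obtain ⟨n, hn, m, hm, hnm⟩ := exists_basis_fin_two hN2
  have hn' := (hmem n).1 hn
  have hm' := (hmem m).1 hm
  by_cases h0 : c.cross n m = 0
  · by_contra! hcon
    have heig {k : V} (hk : k ∈ N) (hk0 : k ≠ 0) : ∃ μ : ℂ, c.cross x k = μ • k := by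
      by_contra! hne
      have hk' := (hmem k).1 hk
      apply hcon x hx k hk'.1
      rw [triple_iff]
      intro r s t hrst
      have h1 := congrArg (c.form x) hrst
      simp only [map_add, map_smul, smul_eq_mul, hk'.2, ← c.form_cross, c.cross_self, map_zero,
        LinearMap.zero_apply, mul_zero, add_zero] at h1
      have hr : r = 0 := (mul_eq_zero.1 h1).resolve_right hxx
      subst hr
      have h2 : LinearIndependent ℂ ![k, c.cross x k] :=
        (LinearIndependent.pair_iff' hk0).2 fun a ha => hne a ha.symm
      have h3 := LinearIndependent.pair_iff.1 h2 s t (by rw [← hrst]; module)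
      exact ⟨rfl, h3⟩
    have hn0 : n ≠ 0 := hnm.ne_zero 0
    have hm0 : m ≠ 0 := hnm.ne_zero 1
    have hnm0 : n + m ≠ 0 := fun h => by
      have := LinearIndependent.pair_iff.1 hnm 1 1 (by simpa using h)
      exact one_ne_zero this.1
    -- Since `n`, `m` and `n + m` are all eigenvectors, the eigenvalues coincide.
    obtain ⟨μ, hμ⟩ := heig hn hn0
    obtain ⟨ν, hν⟩ := heig hm hm0
    obtain ⟨ρ, hρ⟩ := heig (add_mem hn hm) hnm0
    rw [map_add, hμ, hν] at hρ
    have h1 := LinearIndependent.pair_iff.1 hnm (μ - ρ) (ν - ρ) (by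
      linear_combination (norm := module) hρ)
    have hμν : ν = μ := by linear_combination h1.2 - h1.1
    rw [hμν] at hν
    exact c.cross_ne_zero_of_eigenvectors hxx hnm hn'.2 hμ hν h0
  · exact ⟨n, hn'.1, m, hm'.1, c.triple_of_null hnm (hnull hn'.1 hn'.2) (hnull hm'.1 hm'.2) h0⟩

variable {c} in
/-- Every four-space on which the three-form vanishes is the orthogonal of a three-dimensional
subalgebra `⟨x, y, x × y⟩`. -/
theorem Null.exists_eq_perp [Module.Finite ℂ V] (hV : finrank ℂ V = 7) {A : Submodule ℂ V}
    (hA : finrank ℂ A = 4) (hN : c.Null A) : ∃ x y : V,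
      LinearIndependent ℂ ![x, y, c.cross x y] ∧
        A = c.perp (Submodule.span ℂ {x, y, c.cross x y}) := by
  have h3 : finrank ℂ (c.perp A) = 3 := by rw [c.finrank_perp, hV, hA]
  obtain ⟨x, hx, y, hy, h⟩ := c.exists_cross_generators hV h3
  refine ⟨x, y, h, ?_⟩
  have : Submodule.span ℂ {x, y, c.cross x y} = c.perp A := by
    refine Submodule.eq_of_le_of_finrank_eq ?_ ?_
    · rw [Submodule.span_le]
      rintro w (rfl | rfl | rfl)
      exacts [hx, hy, hN.cross_mem_perp hV hA hx hy]
    · rw [finrank_span_three h, h3]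
  rw [this, c.perp_perp]

theorem mem_perp_triple {x y z w : V} : w ∈ c.perp (Submodule.span ℂ {x, y, z}) ↔
    c.form x w = 0 ∧ c.form y w = 0 ∧ c.form z w = 0 := by
  rw [c.mem_perp_span]
  simp

theorem form_cross_move {x u v w : V} (hu : c.form x u = 0) (hv : c.form x v = 0)
    (hw : c.form x w = 0) :
    c.form (c.cross (c.cross x u) v) w = c.form (c.cross u v) (c.cross x w) := by
  have h := congrArg (fun t => c.form t w) (c.cross_cross_assoc x u v)
  simp only [map_add, LinearMap.add_apply, hu, hv, mul_zero, sub_zero, zero_sub, zero_smul,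
    map_neg, LinearMap.neg_apply, map_smul, LinearMap.smul_apply, hw, smul_zero, neg_zero] at h
  have h2 := c.form_cross_swap x (c.cross u v) w
  linear_combination h - h2

/-- On `T` the operators `X = x ×` and `Y = y ×` can be moved from one slot of `⟨u × v, w⟩` to
another. Hence `⟨u × v, XY w⟩ = ⟨X u × Y v, w⟩ = ⟨u × v, YX w⟩`. The commutator of `X` and `Y` is
`-2 z ×`, so `⟨u × v, z × w⟩ = 0`. Replacing `w` by `z × w` multiplies `w` by `-⟨z, z⟩`, minus the
Gram determinant. -/
theorem null_perp_of_gram {x y : V} (h : c.gram x y ≠ 0) :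
    c.Null (c.perp (Submodule.span ℂ {x, y, c.cross x y})) := by
  set z := c.cross x y with hz
  set T := c.perp (Submodule.span ℂ {x, y, z}) with hT
  have hmem (w : V) : w ∈ T ↔ c.form x w = 0 ∧ c.form y w = 0 ∧ c.form z w = 0 :=
    c.mem_perp_triple
  have hX : ∀ w ∈ T, c.cross x w ∈ T := by
    intro w hw
    obtain ⟨h1, h2, h3⟩ := (hmem w).1 hw
    refine (hmem _).2 ⟨?_, ?_, ?_⟩
    · rw [← c.form_cross, c.cross_self]; simp
    · rw [← c.form_cross, c.cross_swap, ← hz]; simp [h3]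
    · rw [c.symm, c.form_cross_swap, hz, c.cross_cross_self]
      simp [c.symm w, h1, h2]
  have hY : ∀ w ∈ T, c.cross y w ∈ T := by
    intro w hw
    obtain ⟨h1, h2, h3⟩ := (hmem w).1 hw
    refine (hmem _).2 ⟨?_, ?_, ?_⟩
    · rw [← c.form_cross, ← hz, h3]
    · rw [← c.form_cross, c.cross_self]; simp
    · rw [c.symm, c.form_cross_swap, hz, c.cross_swap x y, map_neg, c.cross_cross_self]
      simp [c.symm w, h1, h2]
  have hXY : ∀ w ∈ T, c.cross x (c.cross y w) = -c.cross z w - c.form x y • w := by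
    intro w hw
    obtain ⟨h1, h2, h3⟩ := (hmem w).1 hw
    have := c.cross_cross_assoc x y w
    rw [h1, h2, ← hz] at this
    linear_combination (norm := module) this
  have hYX : ∀ w ∈ T, c.cross y (c.cross x w) = c.cross z w - c.form x y • w := by
    intro w hw
    obtain ⟨h1, h2, h3⟩ := (hmem w).1 hw
    have := c.cross_cross_assoc y x w
    rw [h1, h2, c.cross_swap y x, ← hz, c.symm y x] at this
    simp only [map_neg, LinearMap.neg_apply] at this
    linear_combination (norm := module) this
  have hZ : ∀ w ∈ T, c.cross z w ∈ T := by
    intro w hw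
    have h1 : c.cross z w = -c.cross x (c.cross y w) - c.form x y • w := by
      rw [hXY w hw]
      module
    rw [h1]
    exact sub_mem (neg_mem (hX _ (hY _ hw))) (T.smul_mem _ hw)
  have hswap (u v w : V) : c.form (c.cross u v) w = -c.form (c.cross v u) w := by
    rw [c.cross_swap]
    simp
  have hmove {t : V} (ht : ∀ w ∈ T, c.form t w = 0) {u v w : V} (hu : u ∈ T) (hv : v ∈ T)
      (hw : w ∈ T) : c.form (c.cross (c.cross t u) v) w = c.form (c.cross u v) (c.cross t w) :=
    c.form_cross_move (ht u hu) (ht v hv) (ht w hw)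
  have hmX {u v w : V} (hu : u ∈ T) (hv : v ∈ T) (hw : w ∈ T) :=
    hmove (fun w hw => ((hmem w).1 hw).1) hu hv hw
  have hmY {u v w : V} (hu : u ∈ T) (hv : v ∈ T) (hw : w ∈ T) :=
    hmove (fun w hw => ((hmem w).1 hw).2.1) hu hv hw
  have hzero : ∀ u ∈ T, ∀ v ∈ T, ∀ w ∈ T, c.form (c.cross u v) (c.cross z w) = 0 := by
    intro u hu v hv w hw
    have e1 := hmX hu hv (hY w hw)
    have e2 := hmY hv (hX u hu) hw
    have e3 := hmY hv hu (hX w hw)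
    have e4 := hmX hu (hY v hv) hw
    rw [hXY w hw] at e1
    rw [hYX w hw] at e3
    have s1 := hswap (c.cross x u) v (c.cross y w)
    have s2 := hswap (c.cross y v) (c.cross x u) w
    have s3 := hswap (c.cross y v) u (c.cross x w)
    have s4 := hswap v u (c.cross z w - c.form x y • w)
    simp only [map_sub, map_neg, map_smul, smul_eq_mul] at e1 e3 s4
    linear_combination (1 / 2 : ℂ) * (e1 - s1 - e2 + s2 - e4 - s3 + e3 + s4)
  intro u hu v hv w hw
  have h1 := hzero u hu v hv (c.cross z w) (hZ w hw)
  rw [c.cross_cross_self, ((hmem w).1 hw).2.2, c.form_cross_cross] at h1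
  simpa [h] using h1

theorem finrank_perp_triple [Module.Finite ℂ V] (hV : finrank ℂ V = 7) {x y z : V}
    (h : LinearIndependent ℂ ![x, y, z]) :
    finrank ℂ (c.perp (Submodule.span ℂ {x, y, z})) = 4 := by
  rw [c.finrank_perp, hV, finrank_span_three h]

/-- The bilinear form is nondegenerate on `A`. -/
def NondegOn (A : Submodule ℂ V) : Prop := ∀ t ∈ A, (∀ s ∈ A, c.form t s = 0) → t = 0

theorem nondegOn_of_gram [Module.Finite ℂ V] {x y : V} (h : c.gram x y ≠ 0) :
    c.NondegOn (c.perp (Submodule.span ℂ {x, y, c.cross x y})) := by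
  intro t ht hts
  obtain ⟨h1, h2, h3⟩ := c.mem_perp_triple.1 ht
  have ht' : t ∈ Submodule.span ℂ {x, y, c.cross x y} := by
    rw [← c.perp_perp (Submodule.span ℂ {x, y, c.cross x y})]
    intro s hs
    change c.form s t = 0
    rw [c.symm]
    exact hts s hs
  obtain ⟨α, w, hw, rfl⟩ := Submodule.mem_span_insert.1 ht'
  obtain ⟨β, γ, rfl⟩ := Submodule.mem_span_pair.1 hw
  have hz1 : c.form x (c.cross x y) = 0 := by rw [← c.form_cross, c.cross_self]; simp
  have hz2 : c.form y (c.cross x y) = 0 := by rw [c.symm, c.form_cross_right]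
  simp only [map_add, map_smul, smul_eq_mul, hz1, hz2, c.form_cross_cross, c.symm (c.cross x y) x,
    c.symm (c.cross x y) y, c.symm y x, mul_zero, add_zero, zero_add] at h1 h2 h3
  have hγ : γ = 0 := (mul_eq_zero.1 h3).resolve_right h
  have hα : α = 0 := by
    refine (mul_eq_zero.1 (?_ : α * c.gram x y = 0)).resolve_right h
    rw [gram]
    linear_combination c.form y y * h1 - c.form x y * h2
  have hβ : β = 0 := by
    refine (mul_eq_zero.1 (?_ : β * c.gram x y = 0)).resolve_right h
    rw [gram]
    linear_combination c.form x x * h2 - c.form x y * h1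
  simp [hα, hβ, hγ]

/-- A combination of `x` and `y` orthogonal to both is also orthogonal to `x × y`. It would then lie
in the four-space and be orthogonal to it. -/
theorem gram_ne_zero_of_nondegOn {x y : V} (hxy : LinearIndependent ℂ ![x, y])
    (h : c.NondegOn (c.perp (Submodule.span ℂ {x, y, c.cross x y}))) : c.gram x y ≠ 0 := by
  intro hg
  have key (α β : ℂ) (h1 : α * c.form x x + β * c.form x y = 0)
      (h2 : α * c.form x y + β * c.form y y = 0) : α = 0 ∧ β = 0 := by
    refine LinearIndependent.pair_iff.1 hxy α β (h _ (c.mem_perp_triple.2 ⟨?_, ?_, ?_⟩) ?_)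
    · simpa using h1
    · simpa [c.symm y x] using h2
    · simp [c.form_cross_left, c.form_cross_right]
    · intro s hs
      obtain ⟨e1, e2, -⟩ := c.mem_perp_triple.1 hs
      simp [e1, e2]
  rw [gram] at hg
  -- If the Gram determinant vanishes, `⟨x, y⟩ x - ⟨x, x⟩ y` is orthogonal to `x` and `y`. Its
  -- coefficients must therefore vanish, and then `x` itself is such a vector.
  obtain ⟨h1, h2⟩ := key (c.form x y) (-c.form x x) (by ring) (by linear_combination -hg)
  have h3 : c.form x x = 0 := neg_eq_zero.1 h2
  obtain ⟨h4, -⟩ := key 1 0 (by rw [h3]; ring) (by rw [h1]; ring)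
  exact one_ne_zero h4

end CrossProduct

/-! ### Polynomial frames of orthogonal complements -/

section Frames

variable {V : Type*} [AddCommGroup V] [Module ℂ V] (c : CrossProduct V)

namespace CrossProduct

/-- Cramer's rule: a fixed basis of the orthogonal of `p₀` is corrected by vectors dual to `p₀` so
as to be orthogonal to `p`, everything being multiplied by a determinant to avoid division. At `p₀`
the matrix is the identity and there is no correction. -/
theorem exists_perp_frame [Module.Finite ℂ V] {k m : ℕ} (hkm : finrank ℂ V = k + m)
    {p₀ : Fin k → V} (hp₀ : LinearIndependent ℂ p₀) :
    ∃ w : (Fin k → V) → Fin m → V, (∀ i, IsPolyMap fun p => w p i) ∧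
      (∀ p i, w p i ∈ c.perp (Submodule.span ℂ (Set.range p))) ∧ LinearIndependent ℂ (w p₀) := by
  obtain ⟨r, hr⟩ := c.exists_dual_family hp₀
  have hfin : finrank ℂ (c.perp (Submodule.span ℂ (Set.range p₀))) = m := by
    rw [c.finrank_perp, finrank_span_eq_card hp₀, Fintype.card_fin]
    omega
  let x := Module.finBasisOfFinrankEq ℂ (c.perp (Submodule.span ℂ (Set.range p₀))) hfin
  let M : (Fin k → V) → Matrix (Fin k) (Fin k) ℂ := fun p => Matrix.of fun l j => c.form (p l) (r j)
  have hM (l j) : (fun p => M p l j) ∈ polyFun (Fin k → V) :=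
    linear_mem_polyFun (c.form.flip (r j) ∘ₗ (LinearMap.proj l : (Fin k → V) →ₗ[ℂ] V))
  refine ⟨fun p i => (M p).det • (x i : V) -
    ∑ j, ((M p).adjugate.mulVec fun l => c.form (p l) (x i)) j • r j, fun i => ?_,
    fun p i => ?_, ?_⟩
  · refine ((isPolyMap_of_mem (polyFun_det hM)).smul (isPolyMap_const _)).sub
      (IsPolyMap.sum _ fun j _ => IsPolyMap.smul (isPolyMap_of_mem ?_) (isPolyMap_const _))
    simp only [Matrix.mulVec, dotProduct]
    exact polyFun_sum _ fun l _ => polyFun_mul (polyFun_adjugate hM j l)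
      (linear_mem_polyFun (c.form.flip (x i) ∘ₗ (LinearMap.proj l : (Fin k → V) →ₗ[ℂ] V)))
  · rw [c.mem_perp_span]
    rintro _ ⟨l, rfl⟩
    have h1 := congrFun (congrArg (fun N => N.mulVec fun l => c.form (p l) (x i))
      (Matrix.mul_adjugate (M p))) l
    simp only [← Matrix.mulVec_mulVec, Matrix.smul_mulVec, Matrix.one_mulVec, Pi.smul_apply,
      smul_eq_mul] at h1
    simp only [map_sub, map_smul, map_sum, smul_eq_mul]
    rw [← h1, sub_eq_zero, Matrix.mulVec, dotProduct]
    exact Finset.sum_congr rfl fun j _ => mul_comm _ _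
  · have hx (i l) : c.form (p₀ l) (x i) = 0 :=
      (x i).2 (p₀ l) (Submodule.subset_span ⟨l, rfl⟩)
    have hM1 : M p₀ = 1 := by
      ext l j
      rw [Matrix.one_apply, ← hr l j]
      rfl
    have : (fun i => (M p₀).det • (x i : V) -
        ∑ j, ((M p₀).adjugate.mulVec fun l => c.form (p₀ l) (x i)) j • r j) =
        (c.perp (Submodule.span ℂ (Set.range p₀))).subtype ∘ x := by
      ext i
      have h0 : (fun l => c.form (p₀ l) (x i)) = 0 := funext fun l => hx i l
      rw [hM1, h0]
      simp
    beta_reduce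
    rw [this]
    exact x.linearIndependent.map' _ (Submodule.ker_subtype _)

theorem exists_poly_independent {k : ℕ} [Module.Finite ℂ V] {p₀ : Fin k → V}
    (hp₀ : LinearIndependent ℂ p₀) : ∃ R ∈ polyFun (Fin k → V), R p₀ ≠ 0 ∧
      ∀ p, R p ≠ 0 → LinearIndependent ℂ p := by
  obtain ⟨ψ, hψ⟩ := exists_dual_wedge_ne_zero hp₀
  refine ⟨fun p => ψ (exteriorPower.ιMulti ℂ k p), ?_, hψ, fun p hp =>
    linearIndependent_of_wedge hp⟩
  exact IsPolyMap.multilinear (exteriorPower.ιMulti ℂ k).toMultilinearMap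
    (fun i => isPolyMap_eval i) ψ

theorem isPolyMap_wedge [Module.Finite ℂ V] {E : Type*} [AddCommGroup E] [Module ℂ E] {k : ℕ}
    {w : E → Fin k → V} (hw : ∀ i, IsPolyMap fun x => w x i) :
    IsPolyMap fun x => exteriorPower.ιMulti ℂ k (w x) :=
  IsPolyMap.multilinear (exteriorPower.ιMulti ℂ k).toMultilinearMap hw

/-- Plücker points of orthogonals are wedges of polynomial frames. A basic Zariski neighbourhood of
`A₀` thus pulls back to a polynomial condition on `p`, once independence of both frames is imposed.
-/
theorem exists_poly_gr [Module.Finite ℂ V] (hV : finrank ℂ V = 7) {p₀ : Fin 3 → V}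
    (hp₀ : LinearIndependent ℂ p₀) {A₀ : Gr V 4}
    (hA₀ : A₀.1 = c.perp (Submodule.span ℂ (Set.range p₀))) {d : ℕ} {P : ⋀[ℂ]^4 V → ℂ}
    (hP : P ∈ homForms (⋀[ℂ]^4 V) d) (hPA : P (plucker A₀.1 A₀.2).rep ≠ 0) :
    ∃ R ∈ polyFun (Fin 3 → V), R p₀ ≠ 0 ∧ ∀ p, R p ≠ 0 → LinearIndependent ℂ p ∧
      ∀ A : Gr V 4, A.1 = c.perp (Submodule.span ℂ (Set.range p)) →
        P (plucker A.1 A.2).rep ≠ 0 := by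
  obtain ⟨w, hwpoly, hwperp, hw₀⟩ := c.exists_perp_frame (m := 4) (by rw [hV]) hp₀
  obtain ⟨R₁, hR₁, hR₁0, hR₁i⟩ := exists_poly_independent hp₀
  obtain ⟨R₂, hR₂, hR₂0, hR₂i⟩ := exists_poly_independent hw₀
  have hplucker (p : Fin 3 → V) (hw : LinearIndependent ℂ (w p)) (A : Gr V 4)
      (hA : A.1 = c.perp (Submodule.span ℂ (Set.range p))) :
      P (plucker A.1 A.2).rep ≠ 0 ↔ P (exteriorPower.ιMulti ℂ 4 (w p)) ≠ 0 := by
    obtain ⟨a, ha, he⟩ := plucker_rep A.1 A.2 hw fun i => by rw [hA]; exact hwperp p i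
    rw [he, homForms_ne_zero_smul hP ha]
  refine ⟨fun p => R₁ p * R₂ (w p) * P (exteriorPower.ιMulti ℂ 4 (w p)), ?_, ?_, fun p hp => ?_⟩
  · exact polyFun_mul (polyFun_mul hR₁ ((IsPolyMap.pi hwpoly).comp_mem hR₂))
      ((isPolyMap_wedge hwpoly).comp_mem hP.1)
  · exact mul_ne_zero (mul_ne_zero hR₁0 hR₂0) ((hplucker p₀ hw₀ A₀ hA₀).1 hPA)
  · have h1 := left_ne_zero_of_mul hp
    exact ⟨hR₁i p (left_ne_zero_of_mul h1), fun A hA =>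
      (hplucker p (hR₂i _ (right_ne_zero_of_mul h1)) A hA).2 (right_ne_zero_of_mul hp)⟩

theorem exists_poly_flag [Module.Finite ℂ V] (hV : finrank ℂ V = 7) {v₀ : Fin 3 → V}
    (hv₀ : LinearIndependent ℂ v₀) {p₀ : Fin 2 → V} (hp₀ : LinearIndependent ℂ p₀) {L₀ : Flag35 V}
    (hL₀ : L₀.1.1 = Submodule.span ℂ (Set.range v₀))
    (hL₀' : L₀.1.2 = c.perp (Submodule.span ℂ (Set.range p₀))) {d e : ℕ}
    {P : ⋀[ℂ]^3 V × ⋀[ℂ]^5 V → ℂ} (hP : P ∈ bihomForms (⋀[ℂ]^3 V) (⋀[ℂ]^5 V) d e)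
    (hPL : P ((plucker L₀.1.1 L₀.2.1).rep, (plucker L₀.1.2 L₀.2.2.1).rep) ≠ 0) :
    ∃ R ∈ polyFun ((Fin 3 → V) × (Fin 2 → V)), R (v₀, p₀) ≠ 0 ∧ ∀ v p, R (v, p) ≠ 0 →
      LinearIndependent ℂ v ∧ LinearIndependent ℂ p ∧
      ∀ L : Flag35 V, L.1.1 = Submodule.span ℂ (Set.range v) →
        L.1.2 = c.perp (Submodule.span ℂ (Set.range p)) →
        P ((plucker L.1.1 L.2.1).rep, (plucker L.1.2 L.2.2.1).rep) ≠ 0 := by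
  obtain ⟨w, hwpoly, hwperp, hw₀⟩ := c.exists_perp_frame (m := 5) (by rw [hV]) hp₀
  obtain ⟨R₁, hR₁, hR₁0, hR₁i⟩ := exists_poly_independent hp₀
  obtain ⟨R₂, hR₂, hR₂0, hR₂i⟩ := exists_poly_independent hw₀
  obtain ⟨R₃, hR₃, hR₃0, hR₃i⟩ := exists_poly_independent hv₀
  have hplucker (v : Fin 3 → V) (hv : LinearIndependent ℂ v) (p : Fin 2 → V)
      (hw : LinearIndependent ℂ (w p)) (L : Flag35 V)
      (hL : L.1.1 = Submodule.span ℂ (Set.range v))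
      (hL' : L.1.2 = c.perp (Submodule.span ℂ (Set.range p))) :
      P ((plucker L.1.1 L.2.1).rep, (plucker L.1.2 L.2.2.1).rep) ≠ 0 ↔
        P (exteriorPower.ιMulti ℂ 3 v, exteriorPower.ιMulti ℂ 5 (w p)) ≠ 0 := by
    obtain ⟨a, ha, he⟩ := plucker_rep L.1.2 L.2.2.1 hw fun i => by rw [hL']; exact hwperp p i
    obtain ⟨b, hb, he'⟩ := plucker_rep L.1.1 L.2.1 hv fun i => by
      rw [hL]; exact Submodule.subset_span ⟨i, rfl⟩
    rw [he, he', bihomForms_ne_zero_smul hP hb ha]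
  have hwpoly' (i) : IsPolyMap fun x : (Fin 3 → V) × (Fin 2 → V) => w x.2 i :=
    (hwpoly i).comp isPolyMap_snd
  refine ⟨fun x => R₁ x.2 * R₂ (w x.2) * R₃ x.1 *
    P (exteriorPower.ιMulti ℂ 3 x.1, exteriorPower.ιMulti ℂ 5 (w x.2)), ?_, ?_, fun v p hp => ?_⟩
  · refine polyFun_mul (polyFun_mul (polyFun_mul (isPolyMap_snd.comp_mem hR₁)
      ((IsPolyMap.pi hwpoly').comp_mem hR₂)) (isPolyMap_fst.comp_mem hR₃)) ?_
    exact ((isPolyMap_wedge fun i => (isPolyMap_eval i).comp isPolyMap_fst).prodMk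
      (isPolyMap_wedge hwpoly')).comp_mem hP.1
  · exact mul_ne_zero (mul_ne_zero (mul_ne_zero hR₁0 hR₂0) hR₃0)
      ((hplucker v₀ hv₀ p₀ hw₀ L₀ hL₀ hL₀').1 hPL)
  · have h1 := left_ne_zero_of_mul hp
    have h2 := left_ne_zero_of_mul h1
    have h3 := hR₃i v (right_ne_zero_of_mul h1)
    exact ⟨h3, hR₁i p (left_ne_zero_of_mul h2), fun L hL hL' =>
      (hplucker v h3 p (hR₂i _ (right_ne_zero_of_mul h2)) L hL hL').2 (right_ne_zero_of_mul hp)⟩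

/-! ### The open set of nondegenerate four-spaces -/

/-- The quadratic form on `⋀⁴ V` induced by the bilinear form. -/
def wedgeForm (π : ⋀[ℂ]^4 V) : ℂ :=
  exteriorPower.pairingDual ℂ V 4 (exteriorPower.map 4 c.form π) π

theorem wedgeForm_mem [Module.Finite ℂ V] : c.wedgeForm ∈ homForms (⋀[ℂ]^4 V) 2 := by
  refine ⟨?_, fun a x => ?_⟩
  · exact (IsPolyMap.bilinear (exteriorPower.pairingDual ℂ V 4 ∘ₗ exteriorPower.map 4 c.form)
      isPolyMap_id isPolyMap_id).mem
  · simp only [wedgeForm, map_smul, LinearMap.smul_apply, smul_eq_mul]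
    ring

/-- The four-spaces on which the bilinear form is nondegenerate. -/
def nondegLocus : Set (Gr V 4) := {A | c.wedgeForm (plucker A.1 A.2).rep ≠ 0}

theorem isOpen_nondegLocus [Module.Finite ℂ V] : IsOpen[zariskiGr4 V] c.nondegLocus :=
  ⟨{x | c.wedgeForm x.rep ≠ 0}, TopologicalSpace.GenerateOpen.basic _
    ⟨2, c.wedgeForm, c.wedgeForm_mem, rfl⟩, rfl⟩

/-- On the wedge of a basis of `A`, `wedgeForm` is the determinant of the Gram matrix of the
bilinear form. -/
theorem mem_nondegLocus [Module.Finite ℂ V] {A : Gr V 4} :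
    A ∈ c.nondegLocus ↔ c.NondegOn A.1 := by
  let b := basisOfFinrank A.1 A.2
  have hb : LinearIndependent ℂ fun i => (b i : V) :=
    b.linearIndependent.map' A.1.subtype A.1.ker_subtype
  obtain ⟨a, ha, he⟩ := plucker_rep A.1 A.2 hb fun i => (b i).2
  have h1 : A ∈ c.nondegLocus ↔ (Matrix.of fun i j => c.form (b j) (b i)).det ≠ 0 := by
    change c.wedgeForm _ ≠ 0 ↔ _
    rw [he, homForms_ne_zero_smul c.wedgeForm_mem ha, wedgeForm,
      exteriorPower.map_apply_ιMulti, exteriorPower.pairingDual_ιMulti_ιMulti]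
    rfl
  rw [h1, not_iff_comm, ← Matrix.exists_mulVec_eq_zero_iff, NondegOn]
  have hsum (v : Fin 4 → ℂ) : ((∑ j, v j • b j : A.1) : V) = ∑ j, v j • (b j : V) := by simp
  have hform (v : Fin 4 → ℂ) (i) : (Matrix.of fun i j => c.form (b j) (b i)).mulVec v i =
      c.form (∑ j, v j • b j : A.1) (b i) := by
    rw [hsum]
    simp only [Matrix.mulVec, dotProduct, Matrix.of_apply, map_sum, map_smul, LinearMap.sum_apply,
      LinearMap.smul_apply, smul_eq_mul]
    exact Finset.sum_congr rfl fun j _ => mul_comm _ _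
  constructor
  · intro h
    push Not at h
    obtain ⟨t, ht, hts, ht0⟩ := h
    refine ⟨b.equivFun ⟨t, ht⟩, fun h0 => ht0 ?_, ?_⟩
    · have := (LinearEquiv.map_eq_zero_iff _).1 h0
      exact congrArg Subtype.val this
    · ext i
      rw [hform, b.sum_equivFun]
      exact hts _ (b i).2
  · rintro ⟨v, hv0, hv⟩ h
    apply hv0
    have h2 : ∑ j, v j • b j = 0 := by
      refine Subtype.ext (h _ (Subtype.mem _) fun s hs => ?_)
      have h3 : s = ∑ i, b.equivFun ⟨s, hs⟩ i • (b i : V) := by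
        rw [← hsum, b.sum_equivFun]
      rw [h3, map_sum]
      refine Finset.sum_eq_zero fun i _ => ?_
      rw [map_smul, ← hform, hv]
      simp
    exact funext (Fintype.linearIndependent_iff.1 b.linearIndependent v h2)

variable {c} in
theorem Calibrates.mem_CG {Ω : V [⋀^Fin 3]→ₗ[ℂ] ℂ} (h : c.Calibrates Ω) {A : Gr V 4} :
    A ∈ CG Ω ↔ c.Null A.1 := by
  simp only [CG, Null, ← h _ _ _]
  rfl

/-- If all Gram determinants vanished, the orthogonal of an anisotropic vector would be isotropic of
dimension six; without anisotropic vectors, `V` itself would be isotropic. -/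
theorem exists_gram_ne_zero [Module.Finite ℂ V] (hV : finrank ℂ V = 7) :
    ∃ x y, c.gram x y ≠ 0 := by
  by_contra! h
  have h1 (x : V) : c.form x x = 0 := by
    by_contra hx
    have h2 := Module.Dual.finrank_ker_add_one_of_ne_zero (f := c.form x)
      (fun h => hx (LinearMap.congr_fun h x))
    have h3 := c.finrank_isotropic_le hV (S := LinearMap.ker (c.form x)) fun n hn => by
      have h4 := h x n
      rw [gram, LinearMap.mem_ker.1 hn] at h4
      simpa [hx] using h4
    omega
  have := c.finrank_isotropic_le hV (S := ⊤) fun x _ => h1 x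
  rw [finrank_top] at this
  omega

theorem gram_mem_polyFun [Module.Finite ℂ V] :
    (fun x : V × V => c.gram x.1 x.2) ∈ polyFun (V × V) := by
  simp only [gram, sq]
  exact polyFun_sub (polyFun_mul (IsPolyMap.bilinear c.form isPolyMap_fst isPolyMap_fst).mem
    (IsPolyMap.bilinear c.form isPolyMap_snd isPolyMap_snd).mem)
    (polyFun_mul (IsPolyMap.bilinear c.form isPolyMap_fst isPolyMap_snd).mem
    (IsPolyMap.bilinear c.form isPolyMap_fst isPolyMap_snd).mem)

theorem range_triple {X : Type*} (x y z : X) : Set.range ![x, y, z] = {x, y, z} := by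
  simp only [Matrix.range_cons, Matrix.range_empty, Set.union_empty, Set.singleton_union]

/-- The four-space orthogonal to `x`, `y` and `x × y`. -/
def fourSpace [Module.Finite ℂ V] (hV : finrank ℂ V = 7) {x y : V}
    (h : LinearIndependent ℂ ![x, y, c.cross x y]) : Gr V 4 :=
  ⟨c.perp (Submodule.span ℂ {x, y, c.cross x y}), c.finrank_perp_triple hV h⟩

variable {c} in
theorem Calibrates.fourSpace_mem [Module.Finite ℂ V] (hV : finrank ℂ V = 7)
    {Ω : V [⋀^Fin 3]→ₗ[ℂ] ℂ} (hΩ : c.Calibrates Ω) {x y : V} (h : c.gram x y ≠ 0) :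
    c.fourSpace hV (c.triple_of_gram h) ∈ c.nondegLocus ∩ CG Ω :=
  ⟨c.mem_nondegLocus.2 (c.nondegOn_of_gram h), hΩ.mem_CG.2 (c.null_perp_of_gram h)⟩

variable {c} in
theorem Calibrates.nonempty [Module.Finite ℂ V] (hV : finrank ℂ V = 7)
    {Ω : V [⋀^Fin 3]→ₗ[ℂ] ℂ} (hΩ : c.Calibrates Ω) : (c.nondegLocus ∩ CG Ω).Nonempty := by
  obtain ⟨x, y, h⟩ := c.exists_gram_ne_zero hV
  exact ⟨_, hΩ.fourSpace_mem hV h⟩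

variable {c} in
-- Any point of `CG` is `⟨x, y, x × y⟩^⊥`, and `(x, y)` can be moved inside the irreducible space `V
-- × V` to a pair with nonzero Gram determinant without leaving a given neighbourhood.
theorem Calibrates.subset_closure [Module.Finite ℂ V] (hV : finrank ℂ V = 7)
    {Ω : V [⋀^Fin 3]→ₗ[ℂ] ℂ} (hΩ : c.Calibrates Ω) :
    CG Ω ⊆ closure[zariskiGr4 V] (c.nondegLocus ∩ CG Ω) := by
  intro A hA
  rw [@mem_closure_iff _ (zariskiGr4 V)]
  rintro _ ⟨O, hO, rfl⟩ hAO
  obtain ⟨d, P, hP, hPA, hPO⟩ := zariskiProj_exists_basic hO hAO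
  obtain ⟨x₀, y₀, h₀, hA₀⟩ := (hΩ.mem_CG.1 hA).exists_eq_perp hV A.2
  obtain ⟨R, hR, hR₀, hRp⟩ := c.exists_poly_gr hV h₀ (A₀ := A)
    (by rw [range_triple]; exact hA₀) hP hPA
  have hp : IsPolyMap fun x : V × V => ![x.1, x.2, c.cross x.1 x.2] := IsPolyMap.pi fun i => by
    fin_cases i
    exacts [isPolyMap_fst, isPolyMap_snd, IsPolyMap.bilinear c.cross isPolyMap_fst isPolyMap_snd]
  obtain ⟨x₁, y₁, h₁⟩ := c.exists_gram_ne_zero hV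
  obtain ⟨⟨x, y⟩, hxyR, hxyg⟩ := polyFun_exists_ne (hp.comp_mem hR) c.gram_mem_polyFun
    (x := (x₀, y₀)) (y := (x₁, y₁)) hR₀ h₁
  refine ⟨_, hPO _ ((hRp _ hxyR).2 (c.fourSpace hV (c.triple_of_gram hxyg)) ?_),
    hΩ.fourSpace_mem hV hxyg⟩
  rw [range_triple]
  rfl

end CrossProduct

end Frames

/-! ### Irreducibility of the variety of lines -/

section Lines

variable {V : Type*} [AddCommGroup V] [Module ℂ V] (c : CrossProduct V)

theorem finrank_sup_span_singleton [Module.Finite ℂ V] {W : Submodule ℂ V} {a : V} (ha : a ∉ W) :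
    finrank ℂ (W ⊔ Submodule.span ℂ {a} : Submodule ℂ V) = finrank ℂ W + 1 := by
  have ha0 : a ≠ 0 := by
    rintro rfl
    exact ha W.zero_mem
  have h2 := Submodule.finrank_sup_add_finrank_inf_eq W (Submodule.span ℂ {a})
  have h3 : W ⊓ Submodule.span ℂ {a} = ⊥ := by
    rw [← disjoint_iff]
    exact (Submodule.disjoint_span_singleton' ha0).2 ha
  rw [h3, finrank_bot, finrank_span_singleton ha0] at h2
  omega

namespace CrossProduct

variable {c} in
-- A vector `w` of `V₅` outside `V₃` spans with `V₃` a point of the line. Conversely a point of the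
-- line is `V₃ + ⟨a⟩`, and terms with two arguments along `a` vanish by alternation.
theorem Calibrates.mem_F1CG [Module.Finite ℂ V] {Ω : V [⋀^Fin 3]→ₗ[ℂ] ℂ} (hΩ : c.Calibrates Ω)
    {L : Flag35 V} : L ∈ F1CG Ω ↔
      ∀ u ∈ L.1.1, ∀ v ∈ L.1.1, ∀ w ∈ L.1.2, c.form (c.cross u v) w = 0 := by
  constructor
  · intro hL
    have key {w : V} (hw : w ∈ L.1.2) (hw' : w ∉ L.1.1) :
        c.Null (L.1.1 ⊔ Submodule.span ℂ {w}) := by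
      have hA : finrank ℂ (L.1.1 ⊔ Submodule.span ℂ {w} : Submodule ℂ V) = 4 := by
        rw [finrank_sup_span_singleton hw', L.2.1]
      refine hΩ.mem_CG.1 (hL (a := ⟨_, hA⟩) ⟨le_sup_left, sup_le L.2.2.2 ?_⟩)
      rwa [Submodule.span_singleton_le_iff_mem]
    intro u hu v hv w hw
    by_cases hw' : w ∈ L.1.1
    · obtain ⟨w', h1, h2⟩ : ∃ w' ∈ L.1.2, w' ∉ L.1.1 := by
        by_contra! h
        have h3 := Submodule.finrank_mono (s := L.1.2) (t := L.1.1) h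
        rw [L.2.1, L.2.2.1] at h3
        omega
      exact key h1 h2 u (Submodule.mem_sup_left hu) v (Submodule.mem_sup_left hv) w
        (Submodule.mem_sup_left hw')
    · exact key hw hw' u (Submodule.mem_sup_left hu) v (Submodule.mem_sup_left hv) w
        (Submodule.mem_sup_right (Submodule.mem_span_singleton_self w))
  · rintro h A ⟨h3, h5⟩
    rw [hΩ.mem_CG]
    obtain ⟨a, ha, ha'⟩ : ∃ a ∈ A.1, a ∉ L.1.1 := by
      by_contra! h
      have : Module.Finite ℂ L.1.1 := inferInstance
      have h4 := Submodule.finrank_mono (s := A.1) (t := L.1.1) h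
      rw [L.2.1, A.2] at h4
      omega
    have hA : A.1 = L.1.1 ⊔ Submodule.span ℂ {a} := by
      refine (Submodule.eq_of_le_of_finrank_eq (sup_le h3 ?_) ?_).symm
      · rwa [Submodule.span_singleton_le_iff_mem]
      · rw [finrank_sup_span_singleton ha', L.2.1, A.2]
    have hdec (x : V) (hx : x ∈ A.1) : ∃ x' ∈ L.1.1, ∃ r : ℂ, x = x' + r • a := by
      rw [hA] at hx
      obtain ⟨x', hx', y, hy, rfl⟩ := Submodule.mem_sup.1 hx
      obtain ⟨r, rfl⟩ := Submodule.mem_span_singleton.1 hy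
      exact ⟨x', hx', r, rfl⟩
    intro _ hxA _ hyA _ hzA
    obtain ⟨x, hx, r, rfl⟩ := hdec _ hxA
    obtain ⟨y, hy, s, rfl⟩ := hdec _ hyA
    obtain ⟨z, hz, t, rfl⟩ := hdec _ hzA
    have ha5 := h5 ha
    have e1 := h x hx y hy z (L.2.2.2 hz)
    have e2 := h x hx y hy a ha5
    have e3 : c.form (c.cross x a) z = 0 := by
      rw [c.form_cross_swap, c.symm, h x hx z hz a ha5, neg_zero]
    have e4 : c.form (c.cross a y) z = 0 := by
      rw [c.form_cross, c.symm]
      exact h y hy z hz a ha5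
    simp only [map_add, map_smul, LinearMap.add_apply, LinearMap.smul_apply, e1, e2, e3, e4,
      c.form_cross_right, c.form_cross_left, c.cross_self, smul_eq_mul, mul_zero, add_zero,
      LinearMap.zero_apply, map_zero]

theorem finrank_perp_pair [Module.Finite ℂ V] (hV : finrank ℂ V = 7) {p : Fin 2 → V}
    (h : LinearIndependent ℂ p) : finrank ℂ (c.perp (Submodule.span ℂ (Set.range p))) = 5 := by
  rw [c.finrank_perp, hV, finrank_span_eq_card h, Fintype.card_fin]

theorem range_pair {X : Type*} (x y : X) : Set.range ![x, y] = {x, y} := by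
  simp only [Matrix.range_cons, Matrix.range_empty, Set.union_empty, Set.singleton_union]

theorem mem_perp_pair {x y w : V} : w ∈ c.perp (Submodule.span ℂ (Set.range ![x, y])) ↔
    c.form x w = 0 ∧ c.form y w = 0 := by
  rw [c.mem_perp_span, range_pair]
  simp

theorem span_range_eq {k : ℕ} [NeZero k] {W : Submodule ℂ V} (hW : finrank ℂ W = k) {v : Fin k → V}
    (hv : LinearIndependent ℂ v) (hvW : ∀ i, v i ∈ W) :
    W = Submodule.span ℂ (Set.range v) := by
  have : Module.Finite ℂ W := Module.finite_of_finrank_pos (hW ▸ Nat.pos_of_neZero k)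
  refine (Submodule.eq_of_le_of_finrank_eq ?_ ?_).symm
  · rw [Submodule.span_le]
    rintro _ ⟨i, rfl⟩
    exact hvW i
  · rw [hW, finrank_span_eq_card hv, Fintype.card_fin]

/-- The vectors `a`, `b`, `d` define a line of the Cayley Grassmannian: `a × b = 0`, and
`a × d`, `b × d` are linearly independent. -/
structure IsLineData (a b d : V) : Prop where
  cross_eq : c.cross a b = 0
  indep : LinearIndependent ℂ ![a, b, d]
  indep_cross : LinearIndependent ℂ ![c.cross a d, c.cross b d]

variable {c} in
/-- The flag `⟨a, b, d⟩ ⊂ ⟨a × d, b × d⟩^⊥`. -/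
def IsLineData.flag [Module.Finite ℂ V] (hV : finrank ℂ V = 7) {a b d : V}
    (h : c.IsLineData a b d) : Flag35 V :=
  ⟨(Submodule.span ℂ (Set.range ![a, b, d]),
    c.perp (Submodule.span ℂ (Set.range ![c.cross a d, c.cross b d]))),
    by rw [finrank_span_eq_card h.indep, Fintype.card_fin],
    c.finrank_perp_pair hV h.indep_cross, by
      rw [Submodule.span_le]
      rintro _ ⟨i, rfl⟩
      refine c.mem_perp_pair.2 ?_
      have h1 : c.cross b a = 0 := by rw [c.cross_swap, h.cross_eq, neg_zero]
      fin_cases i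
      · exact ⟨c.form_cross_left a d, by
          rw [c.form_cross_swap]; simp [h1]⟩
      · exact ⟨by rw [c.form_cross_swap]; simp [h.cross_eq], c.form_cross_left b d⟩
      · exact ⟨c.form_cross_right a d, c.form_cross_right b d⟩⟩

variable {c} in
theorem IsLineData.flag_mem [Module.Finite ℂ V] (hV : finrank ℂ V = 7) {a b d : V}
    (h : c.IsLineData a b d) {Ω : V [⋀^Fin 3]→ₗ[ℂ] ℂ} (hΩ : c.Calibrates Ω) :
    h.flag hV ∈ F1CG Ω := by
  rw [hΩ.mem_F1CG]
  intro u hu v hv w hw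
  obtain ⟨h1, h2⟩ := c.mem_perp_pair.1 hw
  have hdec {x : V} (hx : x ∈ Submodule.span ℂ (Set.range ![a, b, d])) :
      ∃ r s t : ℂ, x = r • a + s • b + t • d := by
    obtain ⟨g, hg⟩ := (Submodule.mem_span_range_iff_exists_fun ℂ).1 hx
    refine ⟨g 0, g 1, g 2, ?_⟩
    rw [← hg, Fin.sum_univ_three]
    rfl
  obtain ⟨r, s, t, rfl⟩ := hdec hu
  obtain ⟨r', s', t', rfl⟩ := hdec hv
  have e1 : c.cross b a = 0 := by rw [c.cross_swap, h.cross_eq, neg_zero]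
  have e2 : c.form (c.cross d a) w = 0 := by rw [c.cross_swap]; simp [h1]
  have e3 : c.form (c.cross d b) w = 0 := by rw [c.cross_swap]; simp [h2]
  simp [h.cross_eq, e1, e2, e3, h1, h2, c.cross_self]

/-- Bivectors of a three-space are decomposable: the relation is `(x - (r/t) z) × (t y - s z) = 0`.
-/
theorem exists_cross_eq_zero_of_relation {x y z : V} (h : LinearIndependent ℂ ![x, y, z])
    {r s t : ℂ} (ht : t ≠ 0)
    (hrel : r • c.cross y z + s • c.cross z x + t • c.cross x y = 0) :
    ∃ a ∈ Submodule.span ℂ {x, y, z}, ∃ b ∈ Submodule.span ℂ {x, y, z},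
      c.cross a b = 0 ∧ LinearIndependent ℂ ![a, b, z] := by
  have hx : x ∈ Submodule.span ℂ {x, y, z} := Submodule.subset_span (by simp)
  have hy : y ∈ Submodule.span ℂ {x, y, z} := Submodule.subset_span (by simp)
  have hz : z ∈ Submodule.span ℂ {x, y, z} := Submodule.subset_span (by simp)
  refine ⟨x - (r / t) • z, sub_mem hx (Submodule.smul_mem _ _ hz), t • y - s • z,
    sub_mem (Submodule.smul_mem _ _ hy) (Submodule.smul_mem _ _ hz), ?_, ?_⟩
  · rw [← hrel, c.cross_swap z x, c.cross_swap y z]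
    simp only [map_sub, map_smul, LinearMap.sub_apply, LinearMap.smul_apply, c.cross_self]
    have h1 : r = r / t * t := by field_simp
    linear_combination (norm := skip) (0 : ℂ) • hrel
    match_scalars <;> field_simp <;> ring
  · rw [triple_iff] at h ⊢
    intro α β γ hαβγ
    obtain ⟨h1, h2, h3⟩ := h α (β * t) (γ - α * (r / t) - β * s) (by
      rw [← hαβγ]; module)
    have hβ : β = 0 := (mul_eq_zero.1 h2).resolve_right ht
    refine ⟨h1, hβ, ?_⟩
    rw [h1, hβ] at h3
    simpa using h3

/-- The three products of a basis of `W` lie in a plane, hence satisfy a relation to which the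
previous lemma applies. -/
theorem exists_cross_eq_zero [Module.Finite ℂ V] {W N : Submodule ℂ V} (hW : finrank ℂ W = 3)
    (hN : finrank ℂ N = 2) (hWN : ∀ u ∈ W, ∀ v ∈ W, c.cross u v ∈ N) :
    ∃ a ∈ W, ∃ b ∈ W, ∃ d ∈ W, c.cross a b = 0 ∧ LinearIndependent ℂ ![a, b, d] := by
  obtain ⟨x, hx, y, hy, z, hz, h⟩ := exists_basis_fin_three hW
  have hle {x y z : V} (hx : x ∈ W) (hy : y ∈ W) (hz : z ∈ W) :
      Submodule.span ℂ {x, y, z} ≤ W := by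
    rw [Submodule.span_le]
    rintro w (rfl | rfl | rfl) <;> assumption
  have hdep : ¬LinearIndependent ℂ
      ![(⟨_, hWN y hy z hz⟩ : N), ⟨_, hWN z hz x hx⟩, ⟨_, hWN x hx y hy⟩] := fun h => by
    have := h.fintype_card_le_finrank
    rw [hN] at this
    simp at this
  rw [Fintype.linearIndependent_iff] at hdep
  push Not at hdep
  obtain ⟨g, hg, i, hi⟩ := hdep
  have hrel := congrArg Subtype.val hg
  simp only [Fin.sum_univ_three, Matrix.cons_val, Submodule.coe_add, Submodule.coe_smul,
    Submodule.coe_zero] at hrel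
  have hyzx : LinearIndependent ℂ ![y, z, x] := by
    rw [triple_iff] at h ⊢
    intro r s t hrst
    obtain ⟨h1, h2, h3⟩ := h t r s (by rw [← hrst]; module)
    exact ⟨h2, h3, h1⟩
  have hzxy : LinearIndependent ℂ ![z, x, y] := by
    rw [triple_iff] at h ⊢
    intro r s t hrst
    obtain ⟨h1, h2, h3⟩ := h s t r (by rw [← hrst]; module)
    exact ⟨h3, h1, h2⟩
  fin_cases i
  · obtain ⟨a, ha, b, hb, hab, hi⟩ := c.exists_cross_eq_zero_of_relation hyzx (r := g 1) (s := g 2)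
      (t := g 0) hi (by rw [← hrel]; module)
    exact ⟨a, hle hy hz hx ha, b, hle hy hz hx hb, x, hx, hab, hi⟩
  · obtain ⟨a, ha, b, hb, hab, hi⟩ := c.exists_cross_eq_zero_of_relation hzxy (r := g 2) (s := g 0)
      (t := g 1) hi (by rw [← hrel]; module)
    exact ⟨a, hle hz hx hy ha, b, hle hz hx hy hb, y, hy, hab, hi⟩
  · obtain ⟨a, ha, b, hb, hab, hi⟩ := c.exists_cross_eq_zero_of_relation h (r := g 0) (s := g 1)
      (t := g 2) hi (by rw [← hrel])
    exact ⟨a, hle hx hy hz ha, b, hle hx hy hz hb, z, hz, hab, hi⟩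

variable {c} in
-- All products of `V₃` lie in the plane `V₅^⊥`. If `a × d` and `b × d` are independent they span
-- it. Otherwise a change of basis makes `a × d = 0` as well, so `b × d` is nonzero and needs one
-- complementary vector.
theorem Calibrates.exists_lineData [Module.Finite ℂ V] (hV : finrank ℂ V = 7)
    {Ω : V [⋀^Fin 3]→ₗ[ℂ] ℂ} (hΩ : c.Calibrates Ω) {L : Flag35 V} (hL : L ∈ F1CG Ω) :
    (∃ a b d, c.IsLineData a b d ∧ L.1.1 = Submodule.span ℂ (Set.range ![a, b, d]) ∧
      L.1.2 = c.perp (Submodule.span ℂ (Set.range ![c.cross a d, c.cross b d]))) ∨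
    ∃ a b d f, c.cross a b = 0 ∧ c.cross a d = 0 ∧ LinearIndependent ℂ ![a, b, d] ∧
      LinearIndependent ℂ ![c.cross a f, c.cross b d] ∧
      L.1.1 = Submodule.span ℂ (Set.range ![a, b, d]) ∧
      L.1.2 = c.perp (Submodule.span ℂ (Set.range ![c.cross a f, c.cross b d])) := by
  rw [hΩ.mem_F1CG] at hL
  have hN : finrank ℂ (c.perp L.1.2) = 2 := by rw [c.finrank_perp, hV, L.2.2.1]
  have hmem : ∀ u ∈ L.1.1, ∀ v ∈ L.1.1, c.cross u v ∈ c.perp L.1.2 := fun u hu v hv w hw => by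
    change c.form w _ = 0
    rw [c.symm]
    exact hL u hu v hv w hw
  have hperp {p : Fin 2 → V} (hp : LinearIndependent ℂ p) (hpN : ∀ i, p i ∈ c.perp L.1.2) :
      L.1.2 = c.perp (Submodule.span ℂ (Set.range p)) := by
    rw [← span_range_eq hN hp hpN, c.perp_perp]
  have hspan {a b d : V} (h : LinearIndependent ℂ ![a, b, d]) (ha : a ∈ L.1.1) (hb : b ∈ L.1.1)
      (hd : d ∈ L.1.1) : L.1.1 = Submodule.span ℂ (Set.range ![a, b, d]) :=
    span_range_eq L.2.1 h fun i => by fin_cases i <;> assumption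
  obtain ⟨a, ha, b, hb, d, hd, hab, h⟩ := c.exists_cross_eq_zero L.2.1 hN hmem
  by_cases hi : LinearIndependent ℂ ![c.cross a d, c.cross b d]
  · refine Or.inl ⟨a, b, d, ⟨hab, h, hi⟩, hspan h ha hb hd, hperp hi fun i => ?_⟩
    fin_cases i
    exacts [hmem a ha d hd, hmem b hb d hd]
  right
  obtain ⟨a, ha, b, hb, hab, had, h⟩ : ∃ a' ∈ L.1.1, ∃ b' ∈ L.1.1, c.cross a' b' = 0 ∧
      c.cross a' d = 0 ∧ LinearIndependent ℂ ![a', b', d] := by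
    rw [LinearIndependent.pair_iff] at hi
    push Not at hi
    obtain ⟨r, s, hrs, hrs0⟩ := hi
    have hba : c.cross b a = 0 := by rw [c.cross_swap, hab, neg_zero]
    by_cases hr : r = 0
    · have hs := hrs0 hr
      refine ⟨b, hb, a, ha, hba, ?_, ?_⟩
      · rw [hr, zero_smul, zero_add] at hrs
        exact (smul_eq_zero.1 hrs).resolve_left hs
      · rw [triple_iff] at h ⊢
        intro x y z hxyz
        obtain ⟨h1, h2, h3⟩ := h y x z (by rw [← hxyz]; module)
        exact ⟨h2, h1, h3⟩
    · refine ⟨r • a + s • b, add_mem (Submodule.smul_mem _ _ ha) (Submodule.smul_mem _ _ hb), b,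
        hb, ?_, ?_, ?_⟩
      · simp [hab, c.cross_self]
      · simpa using hrs
      · rw [triple_iff] at h ⊢
        intro x y z hxyz
        obtain ⟨h1, h2, h3⟩ := h (x * r) (x * s + y) z (by rw [← hxyz]; module)
        have hx : x = 0 := (mul_eq_zero.1 h1).resolve_right hr
        rw [hx] at h2
        exact ⟨hx, by simpa using h2, h3⟩
  have hbd := c.cross_ne_zero_of_cross hV h hab had
  have hbdN := hmem b hb d hd
  obtain ⟨l, hl, hli⟩ : ∃ l ∈ c.perp L.1.2, LinearIndependent ℂ ![l, c.cross b d] := by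
    by_contra! hcon
    have hle : c.perp L.1.2 ≤ Submodule.span ℂ {c.cross b d} := by
      intro l hl
      have h1 := hcon l hl
      rw [LinearIndependent.pair_symm_iff, LinearIndependent.pair_iff' hbd] at h1
      push Not at h1
      exact Submodule.mem_span_singleton.2 h1
    have h1 := Submodule.finrank_mono hle
    rw [hN, finrank_span_singleton hbd] at h1
    omega
  -- Now `V₃` is the whole kernel of `a ×`, and `l` is orthogonal to `V₅`, hence to `V₃`.
  have hlr : l ∈ LinearMap.range (c.cross a) := by
    rw [c.range_cross, c.ker_cross_eq_span hV h hab had]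
    refine c.mem_perp_span.2 fun x hx => ?_
    have hxL : x ∈ L.1.1 := by
      rcases hx with rfl | rfl | rfl <;> assumption
    exact hl x (L.2.2.2 hxL)
  obtain ⟨f, rfl⟩ := hlr
  refine ⟨a, b, d, f, hab, had, h, hli, hspan h ha hb hd, hperp hli fun i => ?_⟩
  fin_cases i
  exacts [hl, hbdN]

end CrossProduct

end Lines

section Irreducible

variable {V : Type*} [AddCommGroup V] [Module ℂ V] (c : CrossProduct V)

namespace CrossProduct

/-! ### The isotropic cone -/

theorem exists_orthogonal_anisotropic [Module.Finite ℂ V] (hV : finrank ℂ V = 7) (a : V) :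
    ∃ u, c.form a u = 0 ∧ c.form u u ≠ 0 := by
  by_contra! h
  have h1 := c.finrank_isotropic_le hV (S := LinearMap.ker (c.form a)) fun x hx =>
    h x (LinearMap.mem_ker.1 hx)
  have h2 := LinearMap.finrank_range_add_finrank_ker (c.form a)
  have h3 := (LinearMap.range (c.form a)).finrank_le
  rw [finrank_self] at h3
  omega

/-- The multiple `t • (⟨u, u⟩ a - 2 ⟨a, u⟩ u)` of the reflection of `a` in the hyperplane `u^⊥`. -/
def reflect (a : V) (x : ℂ × V) : V :=
  x.1 • (c.form x.2 x.2 • a - (2 * c.form a x.2) • x.2)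

theorem isPolyMap_reflect [Module.Finite ℂ V] (a : V) : IsPolyMap (c.reflect a) :=
  isPolyMap_fst.smul (((IsPolyMap.bilinear c.form isPolyMap_snd isPolyMap_snd).smul
    (isPolyMap_const a)).sub (IsPolyMap.smul (isPolyMap_of_mem (polyFun_mul (const_mem_polyFun 2)
      ((isPolyMap_linear (c.form a)).comp isPolyMap_snd).mem)) isPolyMap_snd))

theorem form_reflect {a : V} (ha : c.form a a = 0) (x : ℂ × V) :
    c.form (c.reflect a x) (c.reflect a x) = 0 := by
  simp only [reflect, map_smul, map_sub, LinearMap.smul_apply, LinearMap.sub_apply, ha,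
    smul_eq_mul, c.symm x.2 a]
  ring

/-- `reflect a` is a polynomial map from an affine space into the isotropic cone. Its image contains
`a`, reached by reflecting in an anisotropic vector orthogonal to `a`. -/
theorem exists_isotropic_of_reflect [Module.Finite ℂ V] (hV : finrank ℂ V = 7) {a : V}
    (ha : c.form a a = 0) {P Q : V → ℂ} (hP : P ∈ polyFun V) (hQ : Q ∈ polyFun V) (hPa : P a ≠ 0)
    {x : ℂ × V} (hQx : Q (c.reflect a x) ≠ 0) :
    ∃ z, c.form z z = 0 ∧ P z ≠ 0 ∧ Q z ≠ 0 := by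
  obtain ⟨u, hau, hu⟩ := c.exists_orthogonal_anisotropic hV a
  have h : c.reflect a ((c.form u u)⁻¹, u) = a := by
    simp [reflect, hau, smul_smul, inv_mul_cancel₀ hu]
  obtain ⟨z, hz⟩ := polyFun_exists_ne ((c.isPolyMap_reflect a).comp_mem hP)
    ((c.isPolyMap_reflect a).comp_mem hQ) (x := ((c.form u u)⁻¹, u)) (by rwa [h]) hQx
  exact ⟨_, c.form_reflect ha z, hz⟩

/-- The reflection in the hyperplane orthogonal to `a - b` exchanges `a` and `b`; here `⟨a - b, a -
b⟩ = -2 ⟨a, b⟩`. -/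
theorem reflect_sub {a b : V} (ha : c.form a a = 0) (hb : c.form b b = 0) (hab : c.form a b ≠ 0) :
    c.reflect a (-(2 * c.form a b)⁻¹, a - b) = b := by
  simp only [reflect, map_sub, LinearMap.sub_apply, ha, hb, c.symm b a]
  match_scalars <;> field_simp <;> ring

theorem exists_form_ne_zero {a : V} (ha : a ≠ 0) : ∃ u, c.form a u ≠ 0 := by
  by_contra! h
  exact ha (c.nondeg a h)

/-- If `⟨a, b⟩ ≠ 0`, both `a` and `b` lie in the image of `reflect a`. Otherwise `a` is first moved
to an isotropic vector not orthogonal to `b`. -/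
theorem polyIrreducible_cone [Module.Finite ℂ V] (hV : finrank ℂ V = 7) :
    PolyIrreducible {a : V | a ≠ 0 ∧ c.form a a = 0} := by
  rintro P hP Q hQ ⟨a, ⟨ha0, ha⟩, hPa⟩ ⟨b, ⟨hb0, hb⟩, hQb⟩
  obtain ⟨w, hw⟩ := c.exists_form_ne_zero ha0
  -- The extra linear factor keeps the points found away from the origin.
  have hP' : (fun x => P x * c.form w x) ∈ polyFun V := polyFun_mul hP (linear_mem_polyFun _)
  obtain ⟨a', ha', hPa', hab⟩ : ∃ a', c.form a' a' = 0 ∧ P a' * c.form w a' ≠ 0 ∧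
      c.form b a' ≠ 0 := by
    have hPa' : P a * c.form w a ≠ 0 := mul_ne_zero hPa (by rwa [c.symm])
    by_cases hab : c.form b a = 0
    · obtain ⟨v, hv⟩ := c.exists_form_ne_zero hb0
      obtain ⟨u, hau, hbu⟩ := polyFun_exists_ne (linear_mem_polyFun (c.form a))
        (linear_mem_polyFun (c.form b)) hw hv
      -- When `⟨a, b⟩ = 0`, the pairing of `b` with `reflect a (1, u)` is `-2 ⟨a, u⟩ ⟨b, u⟩`.
      refine c.exists_isotropic_of_reflect hV ha hP' (linear_mem_polyFun (c.form b)) hPa'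
        (x := (1, u)) ?_
      simp [reflect, hab, hau, hbu]
    · exact ⟨a, ha, hPa', hab⟩
  rw [c.symm] at hab
  obtain ⟨z, hz, hPz, hQz⟩ := c.exists_isotropic_of_reflect hV ha' hP' hQ hPa'
    (x := (-(2 * c.form a' b)⁻¹, a' - b)) (by rwa [c.reflect_sub ha' hb hab])
  refine ⟨z, ⟨fun h => right_ne_zero_of_mul hPz (by rw [h, map_zero]), hz⟩,
    left_ne_zero_of_mul hPz, hQz⟩

/-! ### A parametrization of the general lines -/

/-- A vector annihilated by `a`, if `a` is isotropic. -/
def annihilated (a u v : V) : V := c.cross a (c.form a u • v - c.form a v • u)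

theorem cross_annihilated {a : V} (ha : c.form a a = 0) (u v : V) :
    c.cross a (c.annihilated a u v) = 0 := by
  rw [annihilated, c.cross_cross_self, ha]
  simp [mul_comm]

/-- The frame of `V₃` and the frame of the orthogonal of `V₅` defined by `a`, `u`, `v`, `d`. -/
def lineFrame (x : V × V × V × V) : (Fin 3 → V) × (Fin 2 → V) :=
  (![x.1, c.annihilated x.1 x.2.1 x.2.2.1, x.2.2.2],
    ![c.cross x.1 x.2.2.2, c.cross (c.annihilated x.1 x.2.1 x.2.2.1) x.2.2.2])

theorem isPolyMap_lineFrame [Module.Finite ℂ V] : IsPolyMap c.lineFrame := by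
  have ha : IsPolyMap fun x : V × V × V × V => x.1 := isPolyMap_fst
  have hu : IsPolyMap fun x : V × V × V × V => x.2.1 := isPolyMap_fst.comp isPolyMap_snd
  have hv : IsPolyMap fun x : V × V × V × V => x.2.2.1 :=
    isPolyMap_fst.comp (isPolyMap_snd.comp isPolyMap_snd)
  have hd : IsPolyMap fun x : V × V × V × V => x.2.2.2 :=
    isPolyMap_snd.comp (isPolyMap_snd.comp isPolyMap_snd)
  have hb : IsPolyMap fun x : V × V × V × V => c.annihilated x.1 x.2.1 x.2.2.1 :=
    IsPolyMap.bilinear c.cross ha (((IsPolyMap.bilinear c.form ha hu).smul hv).sub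
      ((IsPolyMap.bilinear c.form ha hv).smul hu))
  refine IsPolyMap.prodMk (IsPolyMap.pi fun i => ?_) (IsPolyMap.pi fun i => ?_)
  · fin_cases i
    exacts [ha, hb, hd]
  · fin_cases i
    exacts [IsPolyMap.bilinear c.cross ha hd, IsPolyMap.bilinear c.cross hb hd]

variable {c} in
theorem IsLineData.exists_lineFrame {a b d : V} (h : c.IsLineData a b d) :
    ∃ x : V × V × V × V, (x.1 ≠ 0 ∧ c.form x.1 x.1 = 0) ∧
      c.lineFrame x = (![a, b, d], ![c.cross a d, c.cross b d]) := by
  have hab := (pair_of_triple h.indep).1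
  obtain ⟨y, hay, hby⟩ := c.exists_eq_cross hab h.cross_eq
  obtain ⟨v, hv, -⟩ := c.exists_form_eq hab
  -- Since `⟨a, y⟩ = 0` and `⟨a, v⟩ = 1`, the vector multiplied by `a` is just `y`.
  have hb : c.annihilated a y (-v) = b := by
    rw [annihilated, hay, hby, map_neg, hv]
    simp
  refine ⟨(a, y, -v, d), ⟨hab.ne_zero 0, (c.form_eq_zero_of_cross hab h.cross_eq).1⟩, ?_⟩
  simp only [lineFrame, hb]

variable {c} in
-- A degenerate line is the limit at `t = 0` of those with `d` replaced by `d + t f`, because `a ×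
-- (d + t f) = t (a × f)`.
theorem Calibrates.exists_lineData_ne_zero [Module.Finite ℂ V] (hV : finrank ℂ V = 7)
    {Ω : V [⋀^Fin 3]→ₗ[ℂ] ℂ} (hΩ : c.Calibrates Ω) {L : Flag35 V} (hL : L ∈ F1CG Ω) {d e : ℕ}
    {P : ⋀[ℂ]^3 V × ⋀[ℂ]^5 V → ℂ} (hP : P ∈ bihomForms (⋀[ℂ]^3 V) (⋀[ℂ]^5 V) d e)
    (hPL : P ((plucker L.1.1 L.2.1).rep, (plucker L.1.2 L.2.2.1).rep) ≠ 0) :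
    ∃ a b d, ∃ _ : c.IsLineData a b d, ∃ L' : Flag35 V,
      L'.1.1 = Submodule.span ℂ (Set.range ![a, b, d]) ∧
      L'.1.2 = c.perp (Submodule.span ℂ (Set.range ![c.cross a d, c.cross b d])) ∧
      P ((plucker L'.1.1 L'.2.1).rep, (plucker L'.1.2 L'.2.2.1).rep) ≠ 0 := by
  rcases hΩ.exists_lineData hV hL with
    ⟨a, b, d, h, h3, h5⟩ | ⟨a, b, d, f, hab, had, h, hi, h3, h5⟩
  · exact ⟨a, b, d, h, L, h3, h5, hPL⟩
  obtain ⟨R, hR, hR₀, hRp⟩ := c.exists_poly_flag hV h hi h3 h5 hP hPL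
  have hd : IsPolyMap fun t : ℂ => d + t • f :=
    (isPolyMap_const d).add (isPolyMap_id.smul (isPolyMap_const f))
  -- The second frame contains `a × f` rather than `a × (d + t f)`, so that it is still independent
  -- at `t = 0`.
  have hpoly : IsPolyMap fun t : ℂ =>
      ((![a, b, d + t • f] : Fin 3 → V), (![c.cross a f, c.cross b (d + t • f)] : Fin 2 → V)) := by
    refine IsPolyMap.prodMk (IsPolyMap.pi fun i => ?_) (IsPolyMap.pi fun i => ?_)
    · fin_cases i
      exacts [isPolyMap_const a, isPolyMap_const b, hd]
    · fin_cases i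
      exacts [isPolyMap_const _, (isPolyMap_linear (c.cross b)).comp hd]
  obtain ⟨t, htR, ht⟩ := polyFun_exists_ne (hpoly.comp_mem hR) (linear_mem_polyFun LinearMap.id)
    (x := 0) (y := 1) (by simpa using hR₀) one_ne_zero
  rw [LinearMap.id_apply] at ht
  obtain ⟨h1, h2, h4⟩ := hRp _ _ htR
  have hcross : c.cross a (d + t • f) = t • c.cross a f := by rw [map_add, had, map_smul, zero_add]
  have h2' : LinearIndependent ℂ ![c.cross a (d + t • f), c.cross b (d + t • f)] := by
    rw [hcross, LinearIndependent.pair_iff]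
    intro r s hrs
    obtain ⟨h5, h6⟩ := LinearIndependent.pair_iff.1 h2 (r * t) s (by rw [← hrs]; module)
    exact ⟨(mul_eq_zero.1 h5).resolve_right ht, h6⟩
  have hline : c.IsLineData a b (d + t • f) := ⟨hab, h1, h2'⟩
  refine ⟨a, b, d + t • f, hline, hline.flag hV, rfl, rfl, h4 _ rfl ?_⟩
  refine congrArg c.perp (le_antisymm ?_ ?_)
  · rw [Submodule.span_le]
    rintro _ ⟨i, rfl⟩
    fin_cases i
    · change c.cross a (d + t • f) ∈ _
      rw [hcross]
      exact Submodule.smul_mem _ _ (Submodule.subset_span ⟨0, rfl⟩)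
    · exact Submodule.subset_span ⟨1, rfl⟩
  · rw [Submodule.span_le]
    rintro _ ⟨i, rfl⟩
    fin_cases i
    · have h6 : c.cross a f = t⁻¹ • c.cross a (d + t • f) := by
        rw [hcross, smul_smul, inv_mul_cancel₀ ht, one_smul]
      change c.cross a f ∈ _
      rw [h6]
      exact Submodule.smul_mem _ _ (Submodule.subset_span ⟨0, rfl⟩)
    · exact Submodule.subset_span ⟨1, rfl⟩

variable {c} in
theorem Calibrates.exists_poly_lineFrame [Module.Finite ℂ V] (hV : finrank ℂ V = 7)
    {Ω : V [⋀^Fin 3]→ₗ[ℂ] ℂ} (hΩ : c.Calibrates Ω) {L : Flag35 V} (hL : L ∈ F1CG Ω) {d e : ℕ}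
    {P : ⋀[ℂ]^3 V × ⋀[ℂ]^5 V → ℂ} (hP : P ∈ bihomForms (⋀[ℂ]^3 V) (⋀[ℂ]^5 V) d e)
    (hPL : P ((plucker L.1.1 L.2.1).rep, (plucker L.1.2 L.2.2.1).rep) ≠ 0) :
    ∃ R ∈ polyFun (V × V × V × V), (∃ x, (x.1 ≠ 0 ∧ c.form x.1 x.1 = 0) ∧ R x ≠ 0) ∧
      ∀ x, R x ≠ 0 → LinearIndependent ℂ (c.lineFrame x).1 ∧
        LinearIndependent ℂ (c.lineFrame x).2 ∧
        ∀ L : Flag35 V, L.1.1 = Submodule.span ℂ (Set.range (c.lineFrame x).1) →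
          L.1.2 = c.perp (Submodule.span ℂ (Set.range (c.lineFrame x).2)) →
          P ((plucker L.1.1 L.2.1).rep, (plucker L.1.2 L.2.2.1).rep) ≠ 0 := by
  obtain ⟨a, b, d, h, L', h3, h5, hPL'⟩ := hΩ.exists_lineData_ne_zero hV hL hP hPL
  obtain ⟨R, hR, hR₀, hRp⟩ := c.exists_poly_flag hV h.indep h.indep_cross h3 h5 hP hPL'
  obtain ⟨x, hx, hxf⟩ := h.exists_lineFrame
  exact ⟨fun x => R (c.lineFrame x), c.isPolyMap_lineFrame.comp_mem hR,
    ⟨x, hx, by simpa only [hxf] using hR₀⟩, fun x hx => hRp _ _ hx⟩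

variable {c} in
-- Two open sets meeting `F1CG` pull back to nonempty open conditions on the isotropic cone times
-- `V³`, which is irreducible; a common parameter gives a line in both.
theorem Calibrates.isPreirreducible [Module.Finite ℂ V] (hV : finrank ℂ V = 7)
    {Ω : V [⋀^Fin 3]→ₗ[ℂ] ℂ} (hΩ : c.Calibrates Ω) :
    @IsPreirreducible _ (zariskiFlag35 V) (F1CG Ω) := by
  rintro _ _ ⟨O₁, hO₁, rfl⟩ ⟨O₂, hO₂, rfl⟩ ⟨L₁, hL₁, hLO₁⟩ ⟨L₂, hL₂, hLO₂⟩
  obtain ⟨d₁, e₁, P₁, hP₁, hPL₁, hPO₁⟩ := zariskiBiproj_exists_basic hO₁ hLO₁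
  obtain ⟨d₂, e₂, P₂, hP₂, hPL₂, hPO₂⟩ := zariskiBiproj_exists_basic hO₂ hLO₂
  obtain ⟨R₁, hR₁, hx₁, hRp₁⟩ := hΩ.exists_poly_lineFrame hV hL₁ hP₁ hPL₁
  obtain ⟨R₂, hR₂, hx₂, hRp₂⟩ := hΩ.exists_poly_lineFrame hV hL₂ hP₂ hPL₂
  obtain ⟨x, hx, hx₁, hx₂⟩ := (c.polyIrreducible_cone hV).prod_univ R₁ hR₁ R₂ hR₂ hx₁ hx₂
  obtain ⟨h1, h2, h3⟩ := hRp₁ x hx₁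
  have h : c.IsLineData x.1 (c.annihilated x.1 x.2.1 x.2.2.1) x.2.2.2 :=
    ⟨c.cross_annihilated hx.2 _ _, h1, h2⟩
  exact ⟨h.flag hV, h.flag_mem hV hΩ, hPO₁ _ (h3 (h.flag hV) rfl rfl),
    hPO₂ _ ((hRp₂ x hx₂).2.2 (h.flag hV) rfl rfl)⟩

end CrossProduct

end Irreducible

/-! ### Homogeneous polynomial functions of two variables -/

section BinaryForms

/-- The coefficients are those of `p(t) = P(1, t)`. Homogeneity gives the formula for nonzero first
coordinate, and a polynomial identity in that coordinate extends it to zero. -/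
theorem exists_coeff_of_homForms {d : ℕ} {P : (Fin 2 → ℂ) → ℂ} (hP : P ∈ homForms (Fin 2 → ℂ) d) :
    ∃ r : ℕ → ℂ, ∀ x : Fin 2 → ℂ,
      P x = ∑ i ∈ Finset.range (d + 1), r i * x 0 ^ (d - i) * x 1 ^ i := by
  have hpoly (b : ℂ) : IsPolyMap fun t : ℂ => (![t, b] : Fin 2 → ℂ) := IsPolyMap.pi fun i => by
    fin_cases i
    exacts [isPolyMap_id, isPolyMap_const b]
  have hpoly' : IsPolyMap fun t : ℂ => (![1, t] : Fin 2 → ℂ) := IsPolyMap.pi fun i => by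
    fin_cases i
    exacts [isPolyMap_const 1, isPolyMap_id]
  obtain ⟨p, hp⟩ := polyFun_exists_polynomial (hpoly'.comp_mem hP.1)
  have hhom (a b : ℂ) (ha : a ≠ 0) : P ![a, b] = a ^ d * p.eval (b / a) := by
    rw [← hp, ← hP.2]
    congr 1
    ext i
    fin_cases i
    · simp
    · simp [mul_div_cancel₀ b ha]
  have hdeg : p.natDegree ≤ d := by
    by_contra! hlt
    obtain ⟨q, hq⟩ := polyFun_exists_polynomial ((hpoly 1).comp_mem hP.1)
    -- If `p` had degree greater than `d`, then `P(a, 1) = a ^ d p(1/a)` times a positive power of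
    -- `a` would be the reversed polynomial, whose value at `0` is the leading coefficient.
    have hinf : (Polynomial.X ^ (p.natDegree - d) * q : Polynomial ℂ) = p.reverse := by
      refine Polynomial.eq_of_infinite_eval_eq _ _
        ((Set.finite_singleton (0 : ℂ)).infinite_compl.mono fun a ha => ?_)
      have ha : a ≠ 0 := ha
      let _ := invertibleOfNonzero (inv_ne_zero ha)
      have h1 := Polynomial.eval₂_reverse_mul_pow (RingHom.id ℂ) a⁻¹ p
      rw [invOf_eq_inv, inv_inv, inv_pow, mul_inv_eq_iff_eq_mul₀ (pow_ne_zero _ ha)] at h1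
      change (Polynomial.X ^ (p.natDegree - d) * q).eval a = p.reverse.eval a
      rw [Polynomial.eval_mul, Polynomial.eval_pow, Polynomial.eval_X, ← hq, hhom a 1 ha,
        ← mul_assoc, ← pow_add, Nat.sub_add_cancel hlt.le, one_div, mul_comm]
      exact h1.symm
    have h2 := congrArg (Polynomial.eval 0) hinf
    rw [Polynomial.eval_mul, Polynomial.eval_pow, Polynomial.eval_X,
      zero_pow (Nat.sub_ne_zero_of_lt hlt), zero_mul, ← Polynomial.coeff_zero_eq_eval_zero,
      Polynomial.coeff_zero_reverse] at h2
    have h3 := Polynomial.leadingCoeff_eq_zero.1 h2.symm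
    simp [h3] at hlt
  refine ⟨p.coeff, fun x => ?_⟩
  have hx : x = ![x 0, x 1] := by
    ext i
    fin_cases i <;> rfl
  have key (a b : ℂ) (ha : a ≠ 0) :
      P ![a, b] = ∑ i ∈ Finset.range (d + 1), p.coeff i * a ^ (d - i) * b ^ i := by
    rw [hhom a b ha, Polynomial.eval_eq_sum_range' (Nat.lt_succ_of_le hdeg), Finset.mul_sum]
    refine Finset.sum_congr rfl fun i hi => ?_
    have hi : i ≤ d := Nat.lt_succ_iff.1 (Finset.mem_range.1 hi)
    rw [div_pow, ← Nat.sub_add_cancel hi, pow_add, Nat.sub_add_cancel hi]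
    field_simp
  rw [hx]
  by_contra hne
  have hQ : (fun t : ℂ => P ![t, x 1] -
      ∑ i ∈ Finset.range (d + 1), p.coeff i * t ^ (d - i) * x 1 ^ i) ∈ polyFun ℂ := by
    refine polyFun_sub ((hpoly (x 1)).comp_mem hP.1) (polyFun_sum _ fun i _ => polyFun_mul
      (polyFun_mul (const_mem_polyFun _) ?_) (const_mem_polyFun _))
    exact pow_mem (linear_mem_polyFun LinearMap.id) (d - i)
  refine (polyFun_finite_zeros hQ (t₀ := x 0) (sub_ne_zero.2 hne)).not_infinite
    ((Set.finite_singleton (0 : ℂ)).infinite_compl.mono fun a ha => ?_)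
  exact sub_eq_zero.2 (key a (x 1) ha)

theorem eq_of_homForms_one {P : (Fin 2 → ℂ) → ℂ} (hP : P ∈ homForms (Fin 2 → ℂ) 1)
    (x : Fin 2 → ℂ) : P x = ∑ i, x i * P (Pi.single i 1) := by
  obtain ⟨r, hr⟩ := exists_coeff_of_homForms hP
  simp [hr, Finset.sum_range_succ, Fin.sum_univ_two]
  ring

theorem bihomForms_left {E F : Type*} [AddCommGroup E] [Module ℂ E] [AddCommGroup F] [Module ℂ F]
    {d e : ℕ} {P : E × F → ℂ} (hP : P ∈ bihomForms E F d e) (y : F) :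
    (fun x => P (x, y)) ∈ homForms E d :=
  ⟨(isPolyMap_id.prodMk (isPolyMap_const y)).comp_mem hP.1, fun a x => by
    simpa using hP.2 a 1 x y⟩

theorem bihomForms_right {E F : Type*} [AddCommGroup E] [Module ℂ E] [AddCommGroup F] [Module ℂ F]
    {d e : ℕ} {P : E × F → ℂ} (hP : P ∈ bihomForms E F d e) (x : E) :
    (fun y => P (x, y)) ∈ homForms F e :=
  ⟨((isPolyMap_const x).prodMk isPolyMap_id).comp_mem hP.1, fun a y => by
    simpa using hP.2 1 a x y⟩

end BinaryForms

/-! ### The product of the Segre embedding with the conic -/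

section Model

variable {G H : Type*} [AddCommGroup G] [Module ℂ G] [AddCommGroup H] [Module ℂ H]
  (g : Basis (Fin 2 × Fin 2) ℂ G) (h : Basis (Fin 3) ℂ H)

/-- The Segre map in the basis `g`. -/
def segre (z : (Fin 2 → ℂ) × (Fin 2 → ℂ)) : G := ∑ k : Fin 2 × Fin 2, (z.1 k.1 * z.2 k.2) • g k

/-- The parametrization of the conic in the basis `h`. -/
def conic (s : Fin 2 → ℂ) : H := s 0 ^ 2 • h 0 + (s 0 * s 1) • h 1 + s 1 ^ 2 • h 2

theorem coord_segre (z : (Fin 2 → ℂ) × (Fin 2 → ℂ)) (k : Fin 2 × Fin 2) :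
    g.coord k (segre g z) = z.1 k.1 * z.2 k.2 := by
  simp [segre, Basis.coord_apply, Finsupp.single_apply]

theorem coord_conic_castSucc (s : Fin 2 → ℂ) (i : Fin 2) :
    h.coord i.castSucc (conic h s) = s i * s 0 := by
  fin_cases i
  · simp [conic]
    ring
  · simp [conic]
    ring

theorem coord_conic_succ (s : Fin 2 → ℂ) (i : Fin 2) :
    h.coord i.succ (conic h s) = s i * s 1 := by
  fin_cases i
  · simp [conic]
  · simp [conic]
    ring

theorem segre_ne_zero {z : (Fin 2 → ℂ) × (Fin 2 → ℂ)} (h1 : z.1 ≠ 0) (h2 : z.2 ≠ 0) :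
    segre g z ≠ 0 := by
  obtain ⟨i, hi⟩ := Function.ne_iff.1 h1
  obtain ⟨j, hj⟩ := Function.ne_iff.1 h2
  intro h0
  have := coord_segre g z (i, j)
  rw [h0, map_zero] at this
  exact mul_ne_zero hi hj this.symm

theorem conic_ne_zero {s : Fin 2 → ℂ} (hs : s ≠ 0) : conic h s ≠ 0 := by
  intro h0
  have h1 := coord_conic_castSucc h s 0
  have h2 := coord_conic_succ h s 1
  rw [h0, map_zero] at h1 h2
  apply hs
  ext i
  fin_cases i
  · simpa using h1.symm
  · simpa using h2.symm

theorem segre_smul (a b : ℂ) (x y : Fin 2 → ℂ) :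
    segre g (a • x, b • y) = (a * b) • segre g (x, y) := by
  simp only [segre, Finset.smul_sum, smul_smul, Pi.smul_apply, smul_eq_mul]
  refine Finset.sum_congr rfl fun k _ => ?_
  congr 1
  ring

theorem conic_smul (a : ℂ) (x : Fin 2 → ℂ) : conic h (a • x) = a ^ 2 • conic h x := by
  simp only [conic, Pi.smul_apply, smul_eq_mul]
  module

theorem segre_mem (ξ : Dual ℂ G) :
    (fun z => ξ (segre g z)) ∈ bihomForms (Fin 2 → ℂ) (Fin 2 → ℂ) 1 1 := by
  refine ⟨?_, fun a b x y => ?_⟩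
  · have : IsPolyMap (segre g) := IsPolyMap.sum _ fun k _ => IsPolyMap.smul
      (isPolyMap_of_mem (polyFun_mul ((isPolyMap_eval k.1).comp isPolyMap_fst).mem
        ((isPolyMap_eval k.2).comp isPolyMap_snd).mem)) (isPolyMap_const _)
    exact this ξ
  · simp only [segre_smul, map_smul, smul_eq_mul, pow_one]

theorem conic_mem (ξ : Dual ℂ H) :
    (fun z => ξ (conic h z.1)) ∈ bihomForms (Fin 2 → ℂ) (Fin 2 → ℂ) 2 0 := by
  refine ⟨?_, fun a b x y => ?_⟩
  · have hx (i : Fin 2) : (fun z : (Fin 2 → ℂ) × (Fin 2 → ℂ) => z.1 i) ∈ polyFun _ :=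
      ((isPolyMap_eval i).comp isPolyMap_fst).mem
    have : IsPolyMap fun z : (Fin 2 → ℂ) × (Fin 2 → ℂ) => conic h z.1 :=
      ((IsPolyMap.smul (isPolyMap_of_mem (pow_mem (hx 0) 2)) (isPolyMap_const _)).add
        (IsPolyMap.smul (isPolyMap_of_mem (polyFun_mul (hx 0) (hx 1))) (isPolyMap_const _))).add
        (IsPolyMap.smul (isPolyMap_of_mem (pow_mem (hx 1) 2)) (isPolyMap_const _))
    exact this ξ
  · simp only [conic_smul, map_smul, smul_eq_mul, pow_zero, mul_one]

/-- The map `ℙ¹ × ℙ¹ → ℙ³ × ℙ²` whose components are the Segre embedding and the first projection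
followed by the parametrization of a conic. -/
def segreConic (x : ℙ ℂ (Fin 2 → ℂ) × ℙ ℂ (Fin 2 → ℂ)) : ℙ ℂ G × ℙ ℂ H :=
  (Projectivization.mk ℂ (segre g (x.1.rep, x.2.rep))
    (segre_ne_zero g x.1.rep_nonzero x.2.rep_nonzero),
    Projectivization.mk ℂ (conic h x.1.rep) (conic_ne_zero h x.1.rep_nonzero))

theorem segreConic_mk {x y : Fin 2 → ℂ} (hx : x ≠ 0) (hy : y ≠ 0) :
    segreConic g h (Projectivization.mk ℂ x hx, Projectivization.mk ℂ y hy) =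
      (Projectivization.mk ℂ (segre g (x, y)) (segre_ne_zero g hx hy),
        Projectivization.mk ℂ (conic h x) (conic_ne_zero h hx)) := by
  obtain ⟨a, ha⟩ := Projectivization.exists_smul_eq_mk_rep ℂ x hx
  obtain ⟨b, hb⟩ := Projectivization.exists_smul_eq_mk_rep ℂ y hy
  have ha : (a : ℂ) • x = (Projectivization.mk ℂ x hx).rep := ha
  have hb : (b : ℂ) • y = (Projectivization.mk ℂ y hy).rep := hb
  refine Prod.ext ?_ ?_
  · refine (Projectivization.mk_eq_mk_iff' ℂ _ _ _ _).2 ⟨a * b, ?_⟩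
    rw [← segre_smul, ha, hb]
  · refine (Projectivization.mk_eq_mk_iff' ℂ _ _ _ _).2 ⟨(a : ℂ) ^ 2, ?_⟩
    rw [← conic_smul, ha]

theorem segreConic_fst_isGivenBy :
    IsGivenByCompleteLinearSystem 1 1 fun x => (segreConic g h x).1 := by
  let φ : Dual ℂ G →ₗ[ℂ] bihomForms (Fin 2 → ℂ) (Fin 2 → ℂ) 1 1 :=
    { toFun := fun ξ => ⟨fun z => ξ (segre g z), segre_mem g ξ⟩
      map_add' := fun _ _ => rfl
      map_smul' := fun _ _ => rfl }
  have hφ : Function.Bijective φ := by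
    constructor
    · rw [injective_iff_map_eq_zero]
      intro ξ hξ
      refine g.ext fun k => ?_
      have h1 := congrFun (congrArg Subtype.val hξ) (Pi.single k.1 1, Pi.single k.2 1)
      have h2 : segre g (Pi.single k.1 1, Pi.single k.2 1) = g k := by
        rw [segre, Finset.sum_eq_single k]
        · simp
        · intro l _ hl
          have : l.1 ≠ k.1 ∨ l.2 ≠ k.2 := by
            by_contra! h3
            exact hl (Prod.ext h3.1 h3.2)
          rcases this with h3 | h3 <;> simp [h3]
        · simp
      simpa [φ, h2] using h1
    · rintro ⟨P, hP⟩
      refine ⟨g.constr ℂ fun k => P (Pi.single k.1 1, Pi.single k.2 1), Subtype.ext ?_⟩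
      ext ⟨x, y⟩
      change g.constr ℂ _ (segre g (x, y)) = P (x, y)
      have h1 := eq_of_homForms_one (bihomForms_left hP y) x
      have h2 (i) := eq_of_homForms_one (bihomForms_right hP (Pi.single i 1)) y
      simp only [h1, h2, segre, map_sum, map_smul, Basis.constr_basis, smul_eq_mul,
        Fintype.sum_prod_type, Finset.mul_sum, mul_assoc]
  exact ⟨LinearEquiv.ofBijective φ hφ, fun x y hx hy => ⟨segre g (x, y), segre_ne_zero g hx hy,
    congrArg Prod.fst (segreConic_mk g h hx hy), fun ξ => rfl⟩⟩

theorem segreConic_snd_isGivenBy :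
    IsGivenByCompleteLinearSystem 2 0 fun x => (segreConic g h x).2 := by
  let φ : Dual ℂ H →ₗ[ℂ] bihomForms (Fin 2 → ℂ) (Fin 2 → ℂ) 2 0 :=
    { toFun := fun ξ => ⟨fun z => ξ (conic h z.1), conic_mem h ξ⟩
      map_add' := fun _ _ => rfl
      map_smul' := fun _ _ => rfl }
  have hφ : Function.Bijective φ := by
    constructor
    · rw [injective_iff_map_eq_zero]
      intro ξ hξ
      have h1 (s : Fin 2 → ℂ) : ξ (conic h s) = 0 := congrFun (congrArg Subtype.val hξ) (s, 0)
      have e0 := h1 ![1, 0]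
      have e1 := h1 ![0, 1]
      have e2 := h1 ![1, 1]
      simp [conic] at e0 e1 e2
      rw [e0, e1] at e2
      refine h.ext fun k => ?_
      fin_cases k
      · exact e0
      · simpa using e2
      · exact e1
    · rintro ⟨P, hP⟩
      obtain ⟨r, hr⟩ := exists_coeff_of_homForms (bihomForms_left hP 0)
      refine ⟨h.constr ℂ fun k => r k, Subtype.ext ?_⟩
      ext ⟨x, y⟩
      change h.constr ℂ _ (conic h x) = P (x, y)
      have h1 : P (x, y) = P (x, 0) := by simpa using (hP.2 1 0 x y).symm
      rw [h1, hr]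
      simp only [conic, map_add, map_smul, Basis.constr_basis, smul_eq_mul, Finset.sum_range_succ,
        Finset.sum_range_zero]
      simp
      ring
  exact ⟨LinearEquiv.ofBijective φ hφ, fun x y hx hy => ⟨conic h x, conic_ne_zero h hx,
    congrArg Prod.snd (segreConic_mk g h hx hy), fun ξ => rfl⟩⟩

/-- The equations of the image of `segreConic`. -/
def IsOnImage (ξ : G) (n : H) : Prop :=
  ∀ i j : Fin 2, h.coord i.castSucc n * g.coord (1, j) ξ = h.coord i.succ n * g.coord (0, j) ξ

theorem isOnImage_smul {ξ : G} {n : H} {a b : ℂ} (ha : a ≠ 0) (hb : b ≠ 0) :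
    IsOnImage g h (a • ξ) (b • n) ↔ IsOnImage g h ξ n := by
  refine forall₂_congr fun i j => ?_
  simp only [map_smul, smul_eq_mul]
  constructor
  · intro h1
    refine mul_left_cancel₀ (mul_ne_zero ha hb) ?_
    linear_combination h1
  · intro h1
    linear_combination (a * b) * h1

theorem isOnImage_segre_conic (x y : Fin 2 → ℂ) : IsOnImage g h (segre g (x, y)) (conic h x) := by
  intro i j
  rw [coord_segre, coord_segre, coord_conic_castSucc, coord_conic_succ]
  ring

/-- The equations make the pairs `(ξ₀ⱼ, ξ₁ⱼ)` and `(nᵢ, nᵢ₊₁)` proportional, hence all multiples of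
one vector `x`. If the row `ξ₀` is nonzero, `x = (1, n₁ / n₀)` and `y = ξ₀`; otherwise `x = (0, 1)`
and `y = ξ₁`. -/
theorem exists_of_isOnImage {ξ : G} {n : H} (hξ : ξ ≠ 0) (hn : n ≠ 0) (h1 : IsOnImage g h ξ n) :
    ∃ (x y : Fin 2 → ℂ) (r : ℂ), x ≠ 0 ∧ y ≠ 0 ∧ ξ = segre g (x, y) ∧ conic h x = r • n := by
  have hξ' : ξ = ∑ k, g.coord k ξ • g k := (g.sum_repr ξ).symm
  have hn' : n = ∑ k, h.coord k n • h k := (h.sum_repr n).symm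
  by_cases h0 : ∃ j, g.coord (0, j) ξ ≠ 0
  · obtain ⟨j, hj⟩ := h0
    have e0 := h1 0
    have e1 := h1 1
    simp only [Fin.castSucc_zero, Fin.succ_zero_eq_one, Fin.castSucc_one,
      Fin.succ_one_eq_two] at e0 e1
    have hn0 : h.coord 0 n ≠ 0 := by
      intro hn0
      have e2 := e0 j
      rw [hn0, zero_mul, eq_comm, mul_eq_zero, or_iff_left hj] at e2
      have e3 := e1 j
      rw [e2, zero_mul, eq_comm, mul_eq_zero, or_iff_left hj] at e3
      apply hn
      rw [hn', Fin.sum_univ_three, hn0, e2, e3]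
      simp
    refine ⟨![1, h.coord 1 n / h.coord 0 n], fun j => g.coord (0, j) ξ, (h.coord 0 n)⁻¹,
      fun h2 => one_ne_zero (congrFun h2 0), fun h2 => hj (congrFun h2 j), ?_, ?_⟩
    · refine g.ext_elem fun k => ?_
      change g.coord k ξ = g.coord k _
      rw [coord_segre]
      obtain ⟨i, k⟩ := k
      fin_cases i
      · simp
      · simp only [Fin.mk_one, Matrix.cons_val_one, Matrix.cons_val_fin_one]
        field_simp
        linear_combination e0 k
    · refine h.ext_elem fun k => ?_
      change h.coord k _ = h.coord k _
      have e2 : h.coord 1 n ^ 2 = h.coord 0 n * h.coord 2 n := by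
        refine mul_right_cancel₀ hj ?_
        linear_combination -h.coord 1 n * e0 j + h.coord 0 n * e1 j
      fin_cases k
      · refine (coord_conic_castSucc h _ 0).trans ?_
        have hn0' : h.repr n 0 ≠ 0 := hn0
        simp [hn0']
      · refine (coord_conic_castSucc h _ 1).trans ?_
        simp [div_eq_inv_mul]
      · refine (coord_conic_succ h _ 1).trans ?_
        simp only [Fin.reduceFinMk, map_smul, smul_eq_mul, Matrix.cons_val_one,
          Matrix.cons_val_fin_one]
        field_simp
        exact e2
  · push Not at h0
    obtain ⟨j, hj⟩ : ∃ j, g.coord (1, j) ξ ≠ 0 := by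
      by_contra! h2
      apply hξ
      rw [hξ']
      refine Finset.sum_eq_zero fun k _ => ?_
      obtain ⟨i, k⟩ := k
      fin_cases i
      · simp only [Fin.zero_eta]; rw [h0, zero_smul]
      · simp only [Fin.mk_one]; rw [h2, zero_smul]
    have e (i : Fin 2) : h.coord i.castSucc n = 0 := by
      have := h1 i j
      rw [h0, mul_zero, mul_eq_zero, or_iff_left hj] at this
      exact this
    have e0 := e 0
    have e1 := e 1
    simp only [Fin.castSucc_zero, Fin.castSucc_one] at e0 e1
    have hn2 : h.coord 2 n ≠ 0 := by
      intro h2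
      apply hn
      rw [hn', Fin.sum_univ_three, h2, e0, e1]
      simp
    refine ⟨![0, 1], fun j => g.coord (1, j) ξ, (h.coord 2 n)⁻¹,
      fun h2 => one_ne_zero (congrFun h2 1), fun h2 => hj (congrFun h2 j), ?_, ?_⟩
    · refine g.ext_elem fun k => ?_
      change g.coord k ξ = g.coord k _
      rw [coord_segre]
      obtain ⟨i, k⟩ := k
      fin_cases i
      · simpa using h0 k
      · simp
    · refine h.ext_elem fun k => ?_
      change h.coord k _ = h.coord k _
      fin_cases k
      · refine (coord_conic_castSucc h _ 0).trans ?_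
        have e0' : h.repr n 0 = 0 := e0
        simp [e0']
      · refine (coord_conic_castSucc h _ 1).trans ?_
        have e1' : h.repr n 1 = 0 := e1
        simp [e1']
      · refine (coord_conic_succ h _ 1).trans ?_
        simp only [Fin.reduceFinMk, map_smul, smul_eq_mul, Matrix.cons_val_one,
          Matrix.cons_val_fin_one]
        field_simp

theorem mem_range_segreConic {y : ℙ ℂ G × ℙ ℂ H} :
    y ∈ Set.range (segreConic g h) ↔ IsOnImage g h y.1.rep y.2.rep := by
  constructor
  · rintro ⟨x, rfl⟩
    obtain ⟨a, ha⟩ := Projectivization.exists_smul_eq_mk_rep ℂ _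
      (segre_ne_zero g (z := (x.1.rep, x.2.rep)) x.1.rep_nonzero x.2.rep_nonzero)
    obtain ⟨b, hb⟩ := Projectivization.exists_smul_eq_mk_rep ℂ _ (conic_ne_zero h x.1.rep_nonzero)
    rw [segreConic, ← ha, ← hb]
    exact (isOnImage_smul g h a.ne_zero b.ne_zero).2 (isOnImage_segre_conic g h _ _)
  · intro hy
    obtain ⟨s, u, r, hs, hu, h1, h2⟩ :=
      exists_of_isOnImage g h y.1.rep_nonzero y.2.rep_nonzero hy
    refine ⟨(Projectivization.mk ℂ s hs, Projectivization.mk ℂ u hu), ?_⟩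
    rw [segreConic_mk]
    refine Prod.ext ?_ ?_
    · rw [← y.1.mk_rep]
      exact (Projectivization.mk_eq_mk_iff' ℂ _ _ _ _).2 ⟨1, by rw [one_smul, h1]⟩
    · rw [← y.2.mk_rep]
      exact (Projectivization.mk_eq_mk_iff' ℂ _ _ _ _).2 ⟨r, h2.symm⟩

theorem isClosed_range_segreConic :
    IsClosed[zariskiBiproj G H] (Set.range (segreConic g h)) := by
  let P (k : Fin 2 × Fin 2) (z : G × H) : ℂ :=
    h.coord k.1.castSucc z.2 * g.coord (1, k.2) z.1 - h.coord k.1.succ z.2 * g.coord (0, k.2) z.1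
  have hP (k) : P k ∈ bihomForms G H 1 1 := by
    refine ⟨?_, fun a b x y => ?_⟩
    · have h1 (i) : (fun z : G × H => h.coord i z.2) ∈ polyFun (G × H) :=
        linear_mem_polyFun (h.coord i ∘ₗ LinearMap.snd ℂ G H)
      have h2 (i) : (fun z : G × H => g.coord i z.1) ∈ polyFun (G × H) :=
        linear_mem_polyFun (g.coord i ∘ₗ LinearMap.fst ℂ G H)
      exact polyFun_sub (polyFun_mul (h1 _) (h2 _)) (polyFun_mul (h1 _) (h2 _))
    · simp only [P, map_smul, smul_eq_mul]
      ring
  have hrange : (Set.range (segreConic g h))ᶜ =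
      ⋃ k, {y : ℙ ℂ G × ℙ ℂ H | P k (y.1.rep, y.2.rep) ≠ 0} := by
    ext y
    rw [Set.mem_compl_iff, mem_range_segreConic, IsOnImage, Set.mem_iUnion]
    simp only [P, Prod.exists, Set.mem_ofPred_eq, sub_ne_zero]
    push Not
    rfl
  refine @IsClosed.mk _ (zariskiBiproj G H) _ ?_
  rw [hrange]
  refine @isOpen_iUnion _ _ (zariskiBiproj G H) _ fun k =>
    TopologicalSpace.GenerateOpen.basic _ ⟨1, 1, P k, hP k, rfl⟩

/-- Two consecutive coordinates, which give the first projection on the image. -/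
def conicPair (i : Fin 2) : H →ₗ[ℂ] Fin 2 → ℂ :=
  LinearMap.pi ![h.coord i.castSucc, h.coord i.succ]

/-- A row of coordinates, which gives the second projection on the image. -/
def segreRow (i : Fin 2) : G →ₗ[ℂ] Fin 2 → ℂ := LinearMap.pi fun j => g.coord (i, j)

theorem conicPair_conic (i : Fin 2) (s : Fin 2 → ℂ) : conicPair h i (conic h s) = s i • s := by
  ext j
  fin_cases j
  · exact coord_conic_castSucc h s i
  · exact coord_conic_succ h s i

theorem segreRow_segre (i : Fin 2) (z : (Fin 2 → ℂ) × (Fin 2 → ℂ)) :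
    segreRow g i (segre g z) = z.1 i • z.2 := by
  ext j
  exact coord_segre g z (i, j)

theorem conicPair_rep (i : Fin 2) (x : ℙ ℂ (Fin 2 → ℂ) × ℙ ℂ (Fin 2 → ℂ)) :
    ∃ r : ℂ, r ≠ 0 ∧ conicPair h i (segreConic g h x).2.rep = (r * x.1.rep i) • x.1.rep := by
  obtain ⟨b, hb⟩ := Projectivization.exists_smul_eq_mk_rep ℂ _ (conic_ne_zero h x.1.rep_nonzero)
  refine ⟨b, b.ne_zero, ?_⟩
  rw [segreConic, ← hb, Units.smul_def, map_smul, conicPair_conic, smul_smul]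

theorem segreRow_rep (i : Fin 2) (x : ℙ ℂ (Fin 2 → ℂ) × ℙ ℂ (Fin 2 → ℂ)) :
    ∃ r : ℂ, r ≠ 0 ∧ segreRow g i (segreConic g h x).1.rep = (r * x.1.rep i) • x.2.rep := by
  obtain ⟨b, hb⟩ := Projectivization.exists_smul_eq_mk_rep ℂ _
    (segre_ne_zero g (z := (x.1.rep, x.2.rep)) x.1.rep_nonzero x.2.rep_nonzero)
  refine ⟨b, b.ne_zero, ?_⟩
  rw [segreConic, ← hb, Units.smul_def, map_smul, segreRow_segre, smul_smul]

theorem mk_conicPair {i : Fin 2} {x : ℙ ℂ (Fin 2 → ℂ) × ℙ ℂ (Fin 2 → ℂ)}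
    (h0 : conicPair h i (segreConic g h x).2.rep ≠ 0) : Projectivization.mk ℂ _ h0 = x.1 := by
  obtain ⟨r, -, hr⟩ := conicPair_rep g h i x
  conv_rhs => rw [← x.1.mk_rep]
  exact (Projectivization.mk_eq_mk_iff' ℂ _ _ _ _).2 ⟨_, hr.symm⟩

theorem mk_segreRow {i : Fin 2} {x : ℙ ℂ (Fin 2 → ℂ) × ℙ ℂ (Fin 2 → ℂ)}
    (h0 : segreRow g i (segreConic g h x).1.rep ≠ 0) : Projectivization.mk ℂ _ h0 = x.2 := by
  obtain ⟨r, -, hr⟩ := segreRow_rep g h i x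
  conv_rhs => rw [← x.2.mk_rep]
  exact (Projectivization.mk_eq_mk_iff' ℂ _ _ _ _).2 ⟨_, hr.symm⟩

theorem exists_coordinates_ne_zero (x : ℙ ℂ (Fin 2 → ℂ) × ℙ ℂ (Fin 2 → ℂ)) :
    ∃ i, conicPair h i (segreConic g h x).2.rep ≠ 0 ∧
      segreRow g i (segreConic g h x).1.rep ≠ 0 := by
  obtain ⟨i, hi⟩ := Function.ne_iff.1 x.1.rep_nonzero
  obtain ⟨r, hr0, hr⟩ := conicPair_rep g h i x
  obtain ⟨r', hr0', hr'⟩ := segreRow_rep g h i x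
  refine ⟨i, ?_, ?_⟩
  · rw [hr]
    exact smul_ne_zero (mul_ne_zero hr0 hi) x.1.rep_nonzero
  · rw [hr']
    exact smul_ne_zero (mul_ne_zero hr0' hi) x.2.rep_nonzero

theorem segreConic_injective : Function.Injective (segreConic g h) := by
  intro x x' hx
  obtain ⟨i, h1, h2⟩ := exists_coordinates_ne_zero g h x
  have h1' := h1
  have h2' := h2
  rw [hx] at h1' h2'
  refine Prod.ext ?_ ?_
  · rw [← mk_conicPair g h h1, ← mk_conicPair g h h1']
    simp only [hx]
  · rw [← mk_segreRow g h h2, ← mk_segreRow g h h2']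
    simp only [hx]

theorem linear_fst_mem {E F : Type*} [AddCommGroup E] [Module ℂ E] [AddCommGroup F] [Module ℂ F]
    (ξ : Dual ℂ E) : (fun z : E × F => ξ z.1) ∈ bihomForms E F 1 0 :=
  ⟨linear_mem_polyFun (ξ ∘ₗ LinearMap.fst ℂ E F), fun a b x y => by simp⟩

theorem linear_snd_mem {E F : Type*} [AddCommGroup E] [Module ℂ E] [AddCommGroup F] [Module ℂ F]
    (ξ : Dual ℂ F) : (fun z : E × F => ξ z.2) ∈ bihomForms E F 0 1 :=
  ⟨linear_mem_polyFun (ξ ∘ₗ LinearMap.snd ℂ E F), fun a b x y => by simp⟩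

/-- On the chart where the coordinate `sᵢ` of the first factor is nonzero, the linear maps
`conicPair i` and `segreRow i` return `s` and `t` up to nonzero scalars, so the inverse is regular.
-/
theorem segreConic_isClosedEmbedding : IsClosedEmbeddingOfVarieties (segreConic g h) := by
  refine ⟨fun x _ => ⟨1, 1, segre g, segre_mem g,
    segre_ne_zero g x.1.rep_nonzero x.2.rep_nonzero, fun y _ _ => rfl⟩,
    fun x _ => ⟨2, 0, fun z => conic h z.1, conic_mem h, conic_ne_zero h x.1.rep_nonzero,
    fun y _ _ => rfl⟩, isClosed_range_segreConic g h, ?_⟩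
  have hne : (Pi.single 0 1 : Fin 2 → ℂ) ≠ 0 := by simp
  have : Nonempty (ℙ ℂ (Fin 2 → ℂ)) := ⟨Projectivization.mk ℂ _ hne⟩
  have hinv := Function.leftInverse_invFun (segreConic_injective g h)
  refine ⟨Function.invFun (segreConic g h), hinv, ?_, ?_⟩
  · rintro _ ⟨x, rfl⟩
    obtain ⟨i, h1, -⟩ := exists_coordinates_ne_zero g h x
    refine ⟨0, 1, fun z => conicPair h i z.2, fun ξ => linear_snd_mem (ξ ∘ₗ conicPair h i), h1, ?_⟩
    rintro _ ⟨y, rfl⟩ h2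
    exact (congrArg Prod.fst (hinv y)).trans (mk_conicPair g h h2).symm
  · rintro _ ⟨x, rfl⟩
    obtain ⟨i, -, h1⟩ := exists_coordinates_ne_zero g h x
    refine ⟨1, 0, fun z => segreRow g i z.1, fun ξ => linear_fst_mem (ξ ∘ₗ segreRow g i), h1, ?_⟩
    rintro _ ⟨y, rfl⟩ h2
    exact (congrArg Prod.snd (hinv y)).trans (mk_segreRow g h h2).symm

end Model

/-! ### Adapted bases of a nondegenerate four-space -/

section Adapted

variable {V : Type*} [AddCommGroup V] [Module ℂ V] (c : CrossProduct V)

namespace CrossProduct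

theorem exists_isotropic_pair {B : Submodule ℂ V} {x y : V} (hx : x ∈ B) (hy : y ∈ B)
    (h : c.gram x y ≠ 0) : ∃ p ∈ B, ∃ m ∈ B, c.form p p = 0 ∧ c.form m m = 0 ∧
      c.form p m = -(1 / 2) := by
  -- Any nonzero value of `⟨p, m⟩` can be rescaled; `-1/2` makes the anticommutator of `p ×` and `m
  -- ×` on the orthogonal of `p` and `m` equal to the identity.
  suffices ∃ p ∈ B, ∃ m ∈ B, c.form p p = 0 ∧ c.form m m = 0 ∧ c.form p m ≠ 0 by
    obtain ⟨p, hp, m, hm, hpp, hmm, hpm⟩ := this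
    refine ⟨p, hp, (-(2 * c.form p m)⁻¹) • m, B.smul_mem _ hm, hpp, by simp [hmm], ?_⟩
    rw [map_smul, smul_eq_mul]
    field_simp
  rw [gram] at h
  by_cases hyy : c.form y y = 0
  · rw [hyy, mul_zero, zero_sub, neg_ne_zero] at h
    have hxy : c.form x y ≠ 0 := fun h0 => h (by rw [h0]; norm_num)
    refine ⟨y, hy, x - (c.form x x / (2 * c.form x y)) • y, B.sub_mem hx (B.smul_mem _ hy), hyy,
      ?_, ?_⟩
    · simp only [map_sub, map_smul, LinearMap.sub_apply, LinearMap.smul_apply, smul_eq_mul, hyy,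
        c.symm y x]
      field_simp
      ring
    · simp only [map_sub, map_smul, smul_eq_mul, hyy, c.symm y x]
      simpa using hxy
  -- The quadratic form at `⟨y, y⟩ x + t y` is `⟨y, y⟩ ((t + ⟨x, y⟩)² + gram x y)`, with roots `t =
  -- -⟨x, y⟩ ± s`.
  · obtain ⟨s, hs⟩ := IsAlgClosed.exists_pow_nat_eq
      (-(c.form x x * c.form y y - c.form x y ^ 2)) (n := 2) (by norm_num)
    have hmem (t : ℂ) : c.form y y • x + t • y ∈ B := B.add_mem (B.smul_mem _ hx) (B.smul_mem _ hy)
    refine ⟨_, hmem (-c.form x y + s), _, hmem (-c.form x y - s), ?_, ?_, ?_⟩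
    · simp only [map_add, map_smul, LinearMap.add_apply, LinearMap.smul_apply, smul_eq_mul,
        c.symm y x]
      linear_combination c.form y y * hs
    · simp only [map_add, map_smul, LinearMap.add_apply, LinearMap.smul_apply, smul_eq_mul,
        c.symm y x]
      linear_combination c.form y y * hs
    · simp only [map_add, map_smul, LinearMap.add_apply, LinearMap.smul_apply, smul_eq_mul,
        c.symm y x]
      intro h0
      refine mul_ne_zero hyy (mul_ne_zero two_ne_zero h) ?_
      linear_combination h0 + c.form y y * hs

/-- A pair of isotropic vectors orthogonal to `A` whose products with `A` are in `A`. -/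
structure IsAdaptedPair (A : Submodule ℂ V) (p m : V) : Prop where
  form_left : c.form p p = 0
  form_right : c.form m m = 0
  form_eq : c.form p m = -(1 / 2)
  left_mem : p ∈ c.perp A
  right_mem : m ∈ c.perp A
  cross_mem : c.cross p m ∈ c.perp A
  left_cross_mem : ∀ a ∈ A, c.cross p a ∈ A
  right_cross_mem : ∀ a ∈ A, c.cross m a ∈ A

variable {c} in
-- `A^⊥` is a subalgebra, so it acts on `A`: `⟨b', b × a⟩ = ⟨b' × b, a⟩ = 0`. It contains `x`, `y`
-- with nonzero Gram determinant, hence a hyperbolic pair.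
theorem Null.exists_adaptedPair [Module.Finite ℂ V] (hV : finrank ℂ V = 7) {A : Submodule ℂ V}
    (hA : finrank ℂ A = 4) (hN : c.Null A) (hnd : c.NondegOn A) :
    ∃ p m, c.IsAdaptedPair A p m := by
  obtain ⟨x, y, hxy, hAxy⟩ := hN.exists_eq_perp hV hA
  have hB : c.perp A = Submodule.span ℂ {x, y, c.cross x y} := by rw [hAxy, c.perp_perp]
  have hg : c.gram x y ≠ 0 :=
    c.gram_ne_zero_of_nondegOn (pair_of_triple hxy).1 (by rwa [← hAxy])
  obtain ⟨p, hp, m, hm, hpp, hmm, hpm⟩ := c.exists_isotropic_pair (B := c.perp A)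
    (by rw [hB]; exact Submodule.subset_span (by simp))
    (by rw [hB]; exact Submodule.subset_span (by simp)) hg
  have hstable {b : V} (hb : b ∈ c.perp A) {a : V} (ha : a ∈ A) : c.cross b a ∈ A := by
    rw [← c.perp_perp A]
    intro b' hb'
    change c.form b' (c.cross b a) = 0
    rw [← c.form_cross, c.symm]
    exact hN.cross_mem_perp hV hA hb' hb a ha
  exact ⟨p, m, hpp, hmm, hpm, hp, hm, hN.cross_mem_perp hV hA hp hm, fun a => hstable hp,
    fun a => hstable hm⟩

namespace IsAdaptedPair

variable {c} {A : Submodule ℂ V} {p m : V}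

/-- With `left_left` and `right_right`, these are the relations of the Clifford algebra of a
hyperbolic plane, that is, of two by two matrices acting on `A`. -/
theorem cross_cross (h : c.IsAdaptedPair A p m) {a : V} (ha : a ∈ A) :
    c.cross p (c.cross m a) + c.cross m (c.cross p a) = a := by
  rw [c.cross_cross_add, h.form_eq, c.symm p, c.symm m, h.left_mem a ha, h.right_mem a ha]
  module

theorem left_left (h : c.IsAdaptedPair A p m) {a : V} (ha : a ∈ A) :
    c.cross p (c.cross p a) = 0 := by
  rw [c.cross_cross_self, h.form_left, c.symm p, h.left_mem a ha]
  module

theorem right_right (h : c.IsAdaptedPair A p m) {a : V} (ha : a ∈ A) :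
    c.cross m (c.cross m a) = 0 := by
  rw [c.cross_cross_self, h.form_right, c.symm m, h.right_mem a ha]
  module

theorem product_cross (h : c.IsAdaptedPair A p m) {a : V} (ha : a ∈ A) :
    c.cross (c.cross p m) a = (1 / 2 : ℂ) • a - c.cross p (c.cross m a) := by
  have h1 := c.cross_cross_assoc p m a
  rw [h.form_eq, c.symm p, c.symm m, h.left_mem a ha, h.right_mem a ha] at h1
  linear_combination (norm := module) h1

/-- The kernel of the product with `m` on `A` is two-dimensional. -/
theorem exists_kernel_basis [Module.Finite ℂ V] (h : c.IsAdaptedPair A p m)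
    (hA : finrank ℂ A = 4) : ∃ a : Fin 2 → A, LinearIndependent ℂ a ∧ ∀ i, c.cross m (a i) = 0 := by
  let M : A →ₗ[ℂ] A := (c.cross m).restrict h.right_cross_mem
  have hM (a : A) : (M a : V) = c.cross m a := rfl
  have hker : LinearMap.range M = LinearMap.ker M := by
    ext a
    rw [LinearMap.mem_ker]
    constructor
    · rintro ⟨a, rfl⟩
      exact Subtype.ext (h.right_right a.2)
    -- If `m × a = 0`, the anticommutation relation gives `a = m × (p × a)`.
    · intro ha
      refine ⟨⟨c.cross p a, h.left_cross_mem a a.2⟩, Subtype.ext ?_⟩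
      have h1 := h.cross_cross a.2
      rw [← hM a, ha, Submodule.coe_zero, map_zero, zero_add] at h1
      exact h1
  have h2 := LinearMap.finrank_range_add_finrank_ker M
  rw [hker, hA] at h2
  obtain ⟨n, hn, k, hk, hnk⟩ := exists_basis_fin_two (N := LinearMap.ker M) (by omega)
  refine ⟨![n, k], hnk, fun i => ?_⟩
  fin_cases i
  · exact congrArg Subtype.val (LinearMap.mem_ker.1 hn)
  · exact congrArg Subtype.val (LinearMap.mem_ker.1 hk)

/-- `A` is the sum of the kernel of `m ×` and its image under `p ×`, and `m ×` inverts `p ×` there.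
-/
theorem exists_basis [Module.Finite ℂ V] (h : c.IsAdaptedPair A p m) (hA : finrank ℂ A = 4) :
    ∃ b : Basis (Fin 2 × Fin 2) ℂ A, ∀ j, c.cross m (b (0, j)) = 0 ∧
      (b (1, j) : V) = c.cross p (b (0, j)) := by
  obtain ⟨a, ha, hma⟩ := h.exists_kernel_basis hA
  let P : A →ₗ[ℂ] A := (c.cross p).restrict h.left_cross_mem
  let M : A →ₗ[ℂ] A := (c.cross m).restrict h.right_cross_mem
  have hMa (j) : M (a j) = 0 := Subtype.ext (hma j)
  have hMP (j) : M (P (a j)) = a j := Subtype.ext (by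
    have h1 := h.cross_cross (a j).2
    rw [hma j, map_zero, zero_add] at h1
    exact h1)
  let v : Fin 2 × Fin 2 → A := fun k => ![a k.2, P (a k.2)] k.1
  have hv : LinearIndependent ℂ v := by
    rw [Fintype.linearIndependent_iff] at ha ⊢
    intro r hr
    simp only [Fintype.sum_prod_type, Fin.sum_univ_two (f := fun i => ∑ j, _), v,
      Matrix.cons_val_zero, Matrix.cons_val_one] at hr
    have h1 := congrArg M hr
    simp only [map_add, map_sum, map_smul, hMa, hMP, smul_zero, Finset.sum_const_zero, zero_add,
      map_zero] at h1
    have h2 := ha (fun j => r (1, j)) h1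
    simp only [h2, zero_smul, Finset.sum_const_zero, add_zero] at hr
    have h3 := ha (fun j => r (0, j)) hr
    rintro ⟨i, j⟩
    fin_cases i
    exacts [h3 j, h2 j]
  refine ⟨basisOfLinearIndependentOfCardEqFinrank hv (by simp [hA]), fun j => ?_⟩
  simp only [coe_basisOfLinearIndependentOfCardEqFinrank]
  exact ⟨hma j, rfl⟩

/-- By nondegeneracy `A^⊥` meets `A` only in zero, so the basis `p`, `p × m`, `m` of `A^⊥` gives one
of `V ⧸ A`. The factors `-2` and `-1` normalize the coefficients in `form_cross_eq`. -/
theorem exists_quotient_basis [Module.Finite ℂ V] (hV : finrank ℂ V = 7)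
    (h : c.IsAdaptedPair A p m) (hA : finrank ℂ A = 4) (hnd : c.NondegOn A) :
    ∃ b : Basis (Fin 3) ℂ (V ⧸ A), b 0 = A.mkQ p ∧ b 1 = A.mkQ ((-2 : ℂ) • c.cross p m) ∧
      b 2 = A.mkQ (-m) := by
  have hgram : c.gram p m ≠ 0 := by
    rw [gram, h.form_left, h.form_eq]
    norm_num
  have hv : LinearIndependent ℂ ![A.mkQ p, A.mkQ ((-2 : ℂ) • c.cross p m), A.mkQ (-m)] := by
    rw [triple_iff]
    intro r s t hrst
    rw [← map_smul A.mkQ r, ← map_smul A.mkQ s, ← map_smul A.mkQ t, ← map_add, ← map_add,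
      Submodule.mkQ_apply, Submodule.Quotient.mk_eq_zero] at hrst
    have h1 : r • p + s • (-2 : ℂ) • c.cross p m + t • -m ∈ c.perp A :=
      add_mem (add_mem (Submodule.smul_mem _ _ h.left_mem)
        (Submodule.smul_mem _ _ (Submodule.smul_mem _ _ h.cross_mem)))
        (Submodule.smul_mem _ _ (neg_mem h.right_mem))
    have h2 := hnd _ hrst fun s hs => by
      rw [c.symm]
      exact h1 s hs
    obtain ⟨h3, h4, h5⟩ := triple_iff.1 (c.triple_of_gram hgram) r (-t) (s * -2)
      (by rw [← h2]; module)
    exact ⟨h3, by simpa using h5, by simpa using h4⟩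
  have hq := Submodule.finrank_quotient_add_finrank A
  refine ⟨basisOfLinearIndependentOfCardEqFinrank hv (by rw [Fintype.card_fin]; omega), ?_⟩
  simp only [coe_basisOfLinearIndependentOfCardEqFinrank]
  exact ⟨rfl, rfl, rfl⟩

/-- The three-form in coordinates adapted to `A`. -/
theorem form_cross_eq (h : c.IsAdaptedPair A p m) {a : Fin 2 → V} (ha : ∀ j, a j ∈ A)
    (hma : ∀ j, c.cross m (a j) = 0) (α γ α' γ' : Fin 2 → ℂ) (r s t : ℂ) :
    c.form (c.cross (∑ j, (α j • a j + γ j • c.cross p (a j)))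
      (∑ j, (α' j • a j + γ' j • c.cross p (a j)))) (r • p + s • (-2 : ℂ) • c.cross p m + t • -m) =
    c.form (c.cross p (a 0)) (a 1) *
      (r * (α 0 * α' 1 - α 1 * α' 0) +
        s * (α 0 * γ' 1 - γ 1 * α' 0 + γ 0 * α' 1 - α 1 * γ' 0) +
        t * (γ 0 * γ' 1 - γ 1 * γ' 0)) := by
  have hmp (j) : c.cross m (c.cross p (a j)) = a j := by
    have h1 := h.cross_cross (ha j)
    rwa [hma j, map_zero, zero_add] at h1
  have haa (i j) : c.form (a i) (a j) = 0 := by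
    conv_lhs => rw [← hmp i]
    rw [c.form_cross_swap, hma, map_zero, neg_zero]
  have hcc (i j) : c.form (c.cross p (a i)) (c.cross p (a j)) = 0 := by
    rw [c.form_cross_swap, h.left_left (ha j), map_zero, neg_zero]
  have hca (i j) : c.form (c.cross p (a i)) (a j) = -c.form (c.cross p (a j)) (a i) := by
    rw [c.form_cross_swap, c.symm]
  have hca0 (i) : c.form (c.cross p (a i)) (a i) = 0 := c.form_cross_right p (a i)
  have hcyc (u v n : V) : c.form (c.cross u v) n = c.form (c.cross n u) v := by
    rw [c.form_cross n, c.symm]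
  -- `p × m` acts as `1/2` on the kernel of `m ×` and as `-1/2` on its image under `p ×`.
  have hpa (i) : c.cross (c.cross p m) (a i) = (1 / 2 : ℂ) • a i := by
    rw [h.product_cross (ha i), hma, map_zero, sub_zero]
  have hpc (i) : c.cross (c.cross p m) (c.cross p (a i)) = (-(1 / 2) : ℂ) • c.cross p (a i) := by
    rw [h.product_cross (h.left_cross_mem _ (ha i)), hmp]
    module
  rw [hcyc]
  simp only [Fin.sum_univ_two, map_add, map_smul, map_neg, LinearMap.add_apply,
    LinearMap.smul_apply, LinearMap.neg_apply, hma, hmp, h.left_left (ha _), hpa, hpc, haa, hcc,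
    hca0, c.symm (a _) (c.cross p _), hca 1 0, smul_eq_mul, smul_zero, map_zero,
    LinearMap.zero_apply]
  ring

end IsAdaptedPair

variable {c} in
theorem Null.exists_adapted_bases [Module.Finite ℂ V] (hV : finrank ℂ V = 7) {A : Submodule ℂ V}
    (hA : finrank ℂ A = 4) (hN : c.Null A) (hnd : c.NondegOn A) :
    ∃ (b : Basis (Fin 2 × Fin 2) ℂ A) (e : Basis (Fin 3) ℂ (V ⧸ A)) (δ : ℂ), δ ≠ 0 ∧
      ∀ (u v : A) (w : V), c.form (c.cross u v) w = δ *
        (e.coord 0 (A.mkQ w) *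
            (b.coord (0, 0) u * b.coord (0, 1) v - b.coord (0, 1) u * b.coord (0, 0) v) +
          e.coord 1 (A.mkQ w) *
            (b.coord (0, 0) u * b.coord (1, 1) v - b.coord (1, 1) u * b.coord (0, 0) v +
              b.coord (1, 0) u * b.coord (0, 1) v - b.coord (0, 1) u * b.coord (1, 0) v) +
          e.coord 2 (A.mkQ w) *
            (b.coord (1, 0) u * b.coord (1, 1) v - b.coord (1, 1) u * b.coord (1, 0) v)) := by
  obtain ⟨p, m, h⟩ := hN.exists_adaptedPair hV hA hnd
  obtain ⟨b, hb⟩ := h.exists_basis hA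
  obtain ⟨e, he0, he1, he2⟩ := h.exists_quotient_basis hV hA hnd
  have hexp (u : A) : (u : V) = ∑ j, (b.coord (0, j) u • (b (0, j) : V) +
      b.coord (1, j) u • c.cross p (b (0, j))) := by
    conv_lhs => rw [← b.sum_repr u]
    simp only [← (hb _).2, Fintype.sum_prod_type, Fin.sum_univ_two, Submodule.coe_add,
      Submodule.coe_smul, Basis.coord_apply]
    abel
  have hform (u v : A) (w : V) := by
    have h1 : w - (e.coord 0 (A.mkQ w) • p + e.coord 1 (A.mkQ w) • (-2 : ℂ) • c.cross p m +
        e.coord 2 (A.mkQ w) • -m) ∈ A := by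
      rw [← Submodule.Quotient.mk_eq_zero, ← Submodule.mkQ_apply, map_sub, sub_eq_zero]
      conv_lhs => rw [← e.sum_repr (A.mkQ w)]
      rw [Fin.sum_univ_three, he0, he1, he2]
      simp only [map_add, map_smul, Basis.coord_apply]
    have h2 := hN u u.2 v v.2 _ h1
    rw [map_sub, sub_eq_zero] at h2
    rw [hexp u, hexp v, h.form_cross_eq (a := fun j => (b (0, j) : V)) (fun j => (b (0, j)).2)
      (fun j => (hb j).1), ← hexp u, ← hexp v] at h2
    exact h2
  -- If this constant were zero, all products of vectors of `A` would vanish, although they span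
  -- `A^⊥`, which contains `p`.
  refine ⟨b, e, c.form (c.cross p (b (0, 0))) (b (0, 1)), fun h0 => ?_, hform⟩
  have hp : p ∈ c.products A := by
    rw [hN.products_eq hV hA]
    exact h.left_mem
  have hle : c.products A ≤ ⊥ := by
    rw [products, Submodule.span_le]
    rintro _ ⟨u, hu, v, hv, rfl⟩
    refine c.nondeg _ fun w => ?_
    rw [hform ⟨u, hu⟩ ⟨v, hv⟩ w, h0, zero_mul]
  have h1 := h.form_eq
  rw [(Submodule.mem_bot ℂ).1 (hle hp)] at h1
  norm_num at h1

end CrossProduct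

end Adapted

/-! ### The lines through a nondegenerate four-space -/

section LinesThrough

variable {V : Type*} [AddCommGroup V] [Module ℂ V] (c : CrossProduct V)

theorem flagThrough_injective (A : Gr V 4) : Function.Injective (flagThrough A) := by
  intro x y hxy
  have h := congrArg Subtype.val hxy
  have h3 : (LinearMap.ker x.1.rep).map A.1.subtype = (LinearMap.ker y.1.rep).map A.1.subtype :=
    congrArg Prod.fst h
  have h5 : x.2.submodule.comap A.1.mkQ = y.2.submodule.comap A.1.mkQ := congrArg Prod.snd h
  refine Prod.ext ?_ ?_
  · have hker := Submodule.map_injective_of_injective A.1.subtype_injective h3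
    obtain ⟨r, hr⟩ : ∃ r : ℂ, r • y.1.rep = x.1.rep := by
      have := mem_span_of_iInf_ker_le_ker (ι := Unit) (L := fun _ => y.1.rep) (K := x.1.rep)
        (by simp [hker])
      simpa [Submodule.mem_span_singleton] using this
    rw [← x.1.mk_rep, ← y.1.mk_rep]
    exact (Projectivization.mk_eq_mk_iff' ℂ _ _ _ _).2 ⟨r, hr⟩
  · exact Projectivization.submodule_injective
      (Submodule.comap_injective_of_surjective A.1.mkQ_surjective h5)

theorem exists_flagThrough_eq [Module.Finite ℂ V] {A : Gr V 4} {L : Flag35 V}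
    (hA : A ∈ L.points) : ∃ x, flagThrough A x = L := by
  obtain ⟨h3, h5⟩ := hA
  have hlt : L.1.1.comap A.1.subtype < ⊤ := by
    rw [lt_top_iff_ne_top]
    intro h
    rw [Submodule.comap_subtype_eq_top] at h
    have := Submodule.finrank_mono h
    rw [A.2, L.2.1] at this
    omega
  obtain ⟨ξ, hξ, hker⟩ := Submodule.exists_le_ker_of_lt_top _ hlt
  obtain ⟨v, hv, hvA⟩ : ∃ v ∈ L.1.2, v ∉ A.1 := by
    by_contra! h
    have := Submodule.finrank_mono (s := L.1.2) (t := A.1) h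
    rw [A.2, L.2.2.1] at this
    omega
  have hv0 : A.1.mkQ v ≠ 0 := by
    rwa [Submodule.mkQ_apply, Ne, Submodule.Quotient.mk_eq_zero]
  let x : ℙ ℂ (Dual ℂ A.1) × ℙ ℂ (V ⧸ A.1) :=
    (Projectivization.mk ℂ ξ hξ, Projectivization.mk ℂ _ hv0)
  refine ⟨x, Subtype.ext (Prod.ext ?_ ?_)⟩
  · refine (Submodule.eq_of_le_of_finrank_eq ?_ ?_).symm
    · intro w hw
      refine ⟨⟨w, h3 hw⟩, ?_, rfl⟩
      obtain ⟨a, ha⟩ := Projectivization.exists_smul_eq_mk_rep ℂ ξ hξ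
      change x.1.rep ⟨w, h3 hw⟩ = 0
      rw [← ha, LinearMap.smul_apply, LinearMap.mem_ker.1 (hker (by exact hw)), smul_zero]
    · rw [L.2.1, (flagThrough A x).2.1]
  · refine Submodule.eq_of_le_of_finrank_eq ?_ ?_
    · intro w hw
      have hw' : A.1.mkQ w ∈ x.2.submodule := hw
      rw [Projectivization.submodule_mk, Submodule.mem_span_singleton] at hw'
      obtain ⟨r, hr⟩ := hw'
      rw [← map_smul, ← sub_eq_zero, ← map_sub, Submodule.mkQ_apply,
        Submodule.Quotient.mk_eq_zero] at hr
      have := sub_mem (L.1.2.smul_mem r hv) (h5 hr)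
      rwa [sub_sub_cancel] at this
    · rw [L.2.2.1, (flagThrough A x).2.2.1]

theorem mem_points_flagThrough (A : Gr V 4) (x : ℙ ℂ (Dual ℂ A.1) × ℙ ℂ (V ⧸ A.1)) :
    A ∈ (flagThrough A x).points :=
  ⟨Submodule.map_subtype_le _ _, Submodule.le_comap_mkQ _ _⟩

/-- An alternating form `ω` vanishes on the kernel of `ξ` if and only if `ξ ∧ ω = 0`. -/
theorem vanishes_on_ker_iff {E : Type*} [AddCommGroup E] [Module ℂ E] (ω : E →ₗ[ℂ] E →ₗ[ℂ] ℂ)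
    (hω : ∀ u, ω u u = 0) {ξ : Dual ℂ E} (hξ : ξ ≠ 0) :
    (∀ u v, ξ u = 0 → ξ v = 0 → ω u v = 0) ↔
      ∀ u v w, ξ u * ω v w + ξ v * ω w u + ξ w * ω u v = 0 := by
  have hanti (u v) : ω u v = -ω v u := by
    have h := hω (u + v)
    simp only [map_add, LinearMap.add_apply, hω] at h
    linear_combination h
  constructor
  · intro h
    have key (u v w) (hu : ξ u ≠ 0) : ξ u * ω v w + ξ v * ω w u + ξ w * ω u v = 0 := by
      -- These two combinations lie in the kernel of `ξ`; expanding gives `ξ u` times the required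
      -- identity.
      have h1 := h (ξ u • v - ξ v • u) (ξ u • w - ξ w • u) (by simp [mul_comm])
        (by simp [mul_comm])
      simp only [map_sub, map_smul, LinearMap.sub_apply, LinearMap.smul_apply, smul_eq_mul,
        hω] at h1
      refine mul_left_cancel₀ hu ?_
      linear_combination h1 + ξ u * ξ v * hanti w u + ξ u * ξ w * hanti u v
    intro u v w
    by_cases hu : ξ u = 0
    · by_cases hv : ξ v = 0
      · by_cases hw : ξ w = 0
        · rw [hu, hv, hw]; ring
        · linear_combination key w u v hw
      · linear_combination key v w u hv
    · exact key u v w hu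
  · intro h u v hu hv
    obtain ⟨e, he⟩ : ∃ e, ξ e ≠ 0 := by
      by_contra! h0
      exact hξ (LinearMap.ext h0)
    have h1 := h e u v
    rw [hu, hv, zero_mul, zero_mul, add_zero, add_zero, mul_eq_zero] at h1
    exact h1.resolve_left he

namespace CrossProduct

variable {c} in
-- `V₅ = A + ⟨w⟩` and the three-form vanishes on `A`, so only `w` has to be tested in the last slot.
theorem Calibrates.flagThrough_mem_iff [Module.Finite ℂ V] {Ω : V [⋀^Fin 3]→ₗ[ℂ] ℂ}
    (hΩ : c.Calibrates Ω) {A : Gr V 4} (hA : A ∈ CG Ω)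
    (x : ℙ ℂ (Dual ℂ A.1) × ℙ ℂ (V ⧸ A.1)) {w : V} (hw : A.1.mkQ w = x.2.rep) :
    flagThrough A x ∈ F1CG Ω ↔
      ∀ u v : A.1, x.1.rep u = 0 → x.1.rep v = 0 → c.form (c.cross u v) w = 0 := by
  rw [hΩ.mem_F1CG]
  have hmem (z : V) : z ∈ (flagThrough A x).1.2 ↔ ∃ r : ℂ, z - r • w ∈ A.1 := by
    change A.1.mkQ z ∈ x.2.submodule ↔ _
    rw [x.2.submodule_eq, Submodule.mem_span_singleton, ← hw]
    refine exists_congr fun r => ?_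
    rw [← Submodule.Quotient.mk_eq_zero, ← Submodule.mkQ_apply, map_sub, map_smul, sub_eq_zero,
      eq_comm]
  constructor
  · intro h u v hu hv
    exact h u ⟨u, hu, rfl⟩ v ⟨v, hv, rfl⟩ w ((hmem w).2 ⟨1, by simp⟩)
  · rintro h _ ⟨u, hu, rfl⟩ _ ⟨v, hv, rfl⟩ z hz
    obtain ⟨r, hr⟩ := (hmem z).1 hz
    have h1 := hΩ.mem_CG.1 hA u u.2 v v.2 _ hr
    rw [map_sub, map_smul, h u v hu hv, smul_zero, sub_zero] at h1
    exact h1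

/-- The condition is `ξ ∧ ω = 0` for `ω = ⟨· × ·, w⟩` on `A`. On a four-space this three-form has
four coefficients, one for each triple of basis vectors, and they are the four equations of the
image. -/
theorem vanishes_on_ker_iff_isOnImage [Module.Finite ℂ V] {A : Submodule ℂ V}
    {b : Basis (Fin 2 × Fin 2) ℂ A} {e : Basis (Fin 3) ℂ (V ⧸ A)} {δ : ℂ} (hδ : δ ≠ 0)
    (hform : ∀ (u v : A) (w : V), c.form (c.cross u v) w = δ *
        (e.coord 0 (A.mkQ w) *
            (b.coord (0, 0) u * b.coord (0, 1) v - b.coord (0, 1) u * b.coord (0, 0) v) +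
          e.coord 1 (A.mkQ w) *
            (b.coord (0, 0) u * b.coord (1, 1) v - b.coord (1, 1) u * b.coord (0, 0) v +
              b.coord (1, 0) u * b.coord (0, 1) v - b.coord (0, 1) u * b.coord (1, 0) v) +
          e.coord 2 (A.mkQ w) *
            (b.coord (1, 0) u * b.coord (1, 1) v - b.coord (1, 1) u * b.coord (1, 0) v)))
    {ξ : Dual ℂ A} (hξ : ξ ≠ 0) (w : V) :
    (∀ u v : A, ξ u = 0 → ξ v = 0 → c.form (c.cross u v) w = 0) ↔
      IsOnImage b.dualBasis e ξ (A.mkQ w) := by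
  let ω : A →ₗ[ℂ] A →ₗ[ℂ] ℂ :=
    ((c.cross.compl₁₂ A.subtype A.subtype)).compr₂ (c.form.flip w)
  have hω (u v : A) : ω u v = c.form (c.cross u v) w := rfl
  have hiff := vanishes_on_ker_iff ω (fun u => by rw [hω, c.cross_self]; simp) hξ
  simp only [hω] at hiff
  rw [hiff]
  have hcoord (k) : b.dualBasis.coord k ξ = ξ (b k) := b.dualBasis_repr ξ k
  have hexp (u : A) : ξ u = ∑ k, b.coord k u * ξ (b k) := by
    conv_lhs => rw [← b.sum_repr u]
    simp only [map_sum, map_smul, smul_eq_mul, Basis.coord_apply]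
  have hb (k l) : b.coord k (b l) = if l = k then 1 else 0 := by
    simp [Finsupp.single_apply]
  simp only [hform]
  constructor
  · intro h
    have key (k l n) := h (b k) (b l) (b n)
    simp only [hb] at key
    intro i j
    rw [hcoord, hcoord]
    fin_cases i <;> fin_cases j
    · have := key (0, 0) (0, 1) (1, 0)
      simp at this ⊢
      refine mul_left_cancel₀ hδ ?_
      linear_combination this
    · have := key (0, 0) (0, 1) (1, 1)
      simp at this ⊢
      refine mul_left_cancel₀ hδ ?_
      linear_combination this
    · have := key (1, 0) (1, 1) (0, 0)
      simp at this ⊢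
      refine mul_left_cancel₀ hδ ?_
      linear_combination -this
    · have := key (1, 0) (1, 1) (0, 1)
      simp at this ⊢
      refine mul_left_cancel₀ hδ ?_
      linear_combination -this
  · intro h u v w'
    have e00 := h 0 0
    have e01 := h 0 1
    have e10 := h 1 0
    have e11 := h 1 1
    simp only [hcoord, Fin.castSucc_zero, Fin.succ_zero_eq_one, Fin.castSucc_one,
      Fin.succ_one_eq_two] at e00 e01 e10 e11
    rw [hexp u, hexp v, hexp w']
    simp only [Fintype.sum_prod_type, Fin.sum_univ_two]
    generalize b.coord (0, 0) u = u00, b.coord (0, 1) u = u01, b.coord (1, 0) u = u10,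
      b.coord (1, 1) u = u11, b.coord (0, 0) v = v00, b.coord (0, 1) v = v01,
      b.coord (1, 0) v = v10, b.coord (1, 1) v = v11, b.coord (0, 0) w' = w00,
      b.coord (0, 1) w' = w01, b.coord (1, 0) w' = w10, b.coord (1, 1) w' = w11
    -- The three-form is the sum of its four coefficients times the three by three minors of the
    -- coordinates.
    let D (x₁ x₂ x₃ y₁ y₂ y₃ z₁ z₂ z₃ : ℂ) : ℂ := x₁ * (y₂ * z₃ - y₃ * z₂) -
      x₂ * (y₁ * z₃ - y₃ * z₁) + x₃ * (y₁ * z₂ - y₂ * z₁)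
    linear_combination δ * (D u00 u01 u10 v00 v01 v10 w00 w01 w10) * e00 +
      δ * (D u00 u01 u11 v00 v01 v11 w00 w01 w11) * e01 -
      δ * (D u10 u11 u00 v10 v11 v00 w10 w11 w00) * e10 -
      δ * (D u10 u11 u01 v10 v11 v01 w10 w11 w01) * e11

variable {c} in
/-- The lines through a nondegenerate point of the Cayley Grassmannian. -/
theorem Calibrates.exists_lines_embedding [Module.Finite ℂ V] (hV : finrank ℂ V = 7)
    {Ω : V [⋀^Fin 3]→ₗ[ℂ] ℂ} (hΩ : c.Calibrates Ω) {A : Gr V 4} (hA : A ∈ c.nondegLocus ∩ CG Ω) :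
    ∃ f : ℙ ℂ (Fin 2 → ℂ) × ℙ ℂ (Fin 2 → ℂ) → ℙ ℂ (Dual ℂ A.1) × ℙ ℂ (V ⧸ A.1),
      IsClosedEmbeddingOfVarieties f ∧ IsGivenByCompleteLinearSystem 1 1 (fun x => (f x).1) ∧
      IsGivenByCompleteLinearSystem 2 0 (fun x => (f x).2) ∧
      Set.BijOn (flagThrough A) (Set.range f) (linesThrough Ω A) := by
  obtain ⟨b, e, δ, hδ, hform⟩ := (hΩ.mem_CG.1 hA.2).exists_adapted_bases hV A.2
    (c.mem_nondegLocus.1 hA.1)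
  have hmem (x : ℙ ℂ (Dual ℂ A.1) × ℙ ℂ (V ⧸ A.1)) :
      flagThrough A x ∈ F1CG Ω ↔ x ∈ Set.range (segreConic b.dualBasis e) := by
    obtain ⟨w, hw⟩ := A.1.mkQ_surjective x.2.rep
    rw [hΩ.flagThrough_mem_iff hA.2 x hw,
      c.vanishes_on_ker_iff_isOnImage hδ hform x.1.rep_nonzero w, hw, mem_range_segreConic]
  refine ⟨segreConic b.dualBasis e, segreConic_isClosedEmbedding _ _,
    segreConic_fst_isGivenBy _ _, segreConic_snd_isGivenBy _ _,
    fun x hx => ⟨(hmem x).2 hx, mem_points_flagThrough A x⟩,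
    (flagThrough_injective A).injOn, ?_⟩
  rintro L ⟨hL, hAL⟩
  obtain ⟨x, rfl⟩ := exists_flagThrough_eq hAL
  exact ⟨x, (hmem x).1 hL, rfl⟩

variable {c} in
theorem Calibrates.nonempty_lines [Module.Finite ℂ V] (hV : finrank ℂ V = 7)
    {Ω : V [⋀^Fin 3]→ₗ[ℂ] ℂ} (hΩ : c.Calibrates Ω) : (F1CG Ω).Nonempty := by
  obtain ⟨A, hA⟩ := hΩ.nonempty hV
  obtain ⟨f, -, -, -, hf⟩ := hΩ.exists_lines_embedding hV hA
  have hne : (Pi.single 0 1 : Fin 2 → ℂ) ≠ 0 := by simp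
  exact ⟨_, (hf.mapsTo ⟨(Projectivization.mk ℂ _ hne, Projectivization.mk ℂ _ hne), rfl⟩).1⟩

end CrossProduct

end LinesThrough

/-! ### The open set of forms -/

section Forms

variable {V : Type*} [AddCommGroup V] [Module ℂ V]

theorem isOpen_infAct_surjective [Module.Finite ℂ V] :
    IsOpen[zariskiAffine (V [⋀^Fin 3]→ₗ[ℂ] ℂ)]
      {Ω : V [⋀^Fin 3]→ₗ[ℂ] ℂ | Function.Surjective (infActHom Ω)} := by
  rw [@isOpen_iff_forall_mem_open _ (zariskiAffine _)]
  intro Ω hΩ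
  obtain ⟨P, hP, hPΩ, h⟩ := exists_poly_infAct_surjective hΩ
  exact ⟨{Ω' | P Ω' ≠ 0}, h, TopologicalSpace.GenerateOpen.basic _ ⟨P, hP, rfl⟩, hPΩ⟩

end Forms

end

end CayleyGrassmannian

theorem mainTheorem8 {V : Type*} [AddCommGroup V] [Module ℂ V] (hV : Module.finrank ℂ V = 7) :
    ∃ 𝒰 : Set (V [⋀^Fin 3]→ₗ[ℂ] ℂ),
      IsOpen[zariskiAffine (V [⋀^Fin 3]→ₗ[ℂ] ℂ)] 𝒰 ∧ 𝒰.Nonempty ∧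
      (∀ e : Module.Basis (Fin 7) ℂ V, normalForm e ∈ 𝒰) ∧
      ∀ Ω ∈ 𝒰,
        (∃ U : Set (Gr V 4),
          IsOpen[zariskiGr4 V] U ∧
          (U ∩ CG Ω).Nonempty ∧
          CG Ω ⊆
            closure[zariskiGr4 V] (U ∩ CG Ω) ∧
          ∀ A ∈ U ∩ CG Ω,
            ∃ f : ℙ ℂ (Fin 2 → ℂ) × ℙ ℂ (Fin 2 → ℂ) →
                ℙ ℂ (Module.Dual ℂ A.1) × ℙ ℂ (V ⧸ A.1),
              IsClosedEmbeddingOfVarieties f ∧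
              IsGivenByCompleteLinearSystem 1 1 (fun x => (f x).1) ∧
              IsGivenByCompleteLinearSystem 2 0 (fun x => (f x).2) ∧
              Set.BijOn (flagThrough A) (Set.range f)
                (linesThrough Ω A)) ∧
        @IsIrreducible _ (zariskiFlag35 V) (F1CG Ω) := by
  have : Module.Finite ℂ V := Module.finite_of_finrank_pos (by rw [hV]; norm_num)
  -- The open set consists of the forms with surjective infinitesimal action; it is the orbit of the
  -- normal forms.
  refine ⟨{Ω | Function.Surjective (infActHom Ω)}, isOpen_infAct_surjective,
    ⟨normalForm (Module.finBasisOfFinrankEq ℂ V hV), infAct_normalForm_surjective _⟩,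
    infAct_normalForm_surjective, fun Ω hΩ => ?_⟩
  obtain ⟨e, rfl⟩ := exists_normalForm_of_surjective hV hΩ
  obtain ⟨c, hc⟩ := exists_crossProduct_normalForm e
  exact ⟨⟨c.nondegLocus, c.isOpen_nondegLocus, hc.nonempty hV, hc.subset_closure hV,
    fun A hA => hc.exists_lines_embedding hV hA⟩, hc.nonempty_lines hV, hc.isPreirreducible hV⟩
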